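/- Let $\mathcal G$ be a second countable locally compact Hausdorff étale groupoid with unit space $\mathcal G^{(0)}$, range and source maps $r,s$, and isotropy groups $\mathcal G^x_x=r^{-1}(x)\cap s^{-1}(x)$. Let $C^*_r(\mathcal G)$ be its reduced $C^*$-algebra, that is, the completion of the convolution $*$-algebra $C_c(\mathcal G)$ in the norm $\|f\|_r=\sup_{x}\|\pi_x(f)\|$, where $\pi_x$ is the representation on $\ell^2(s^{-1}(x))$ given by $(\pi_x(f)\psi)(g)=\sum_{h\in r^{-1}(r(g))}f(h)\psi(h^{-1}g)$. Let $P:C^*_r(\mathcal G)\to C_0(\mathcal G^{(0)})$ be the conditional expectation extending the restriction map $C_c(\mathcal G)\to C_c(\mathcal G^{(0)})$. Let $c:\mathcal G\to\mathbb R$ be a continuous homomorphism, i.e. $c(gh)=c(g)+c(h)$ when $s(g)=r(h)$, and let $\sigma^c$ be the one-parameter group of automorphisms of $C^*_r(\mathcal G)$ with $\sigma^c_t(f)(g)=e^{itc(g)}f(g)$ for $f\in C_c(\mathcal G)$. Let $\beta\in\mathbb R$. A non-zero regular Borel measure $m$ on $\mathcal G^{(0)}$ (in particular, finite on compact sets)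 is *$(\mathcal G,c)$-conformal with exponent $\beta$* when $$m(s(W))=\int_{r(W)}e^{\beta c(r_W^{-1}(x))}\,dm(x)$$ for every open bisection $W\subseteq\mathcal G$ (an open set on which $r$ and $s$ are injective), where $r_W^{-1}$ is the inverse of $r:W\to r(W)$. A *weight* on a $C^*$-algebra $A$ is a map $\psi:A_+\to[0,\infty]$ with $\psi(a+b)=\psi(a)+\psi(b)$ and $\psi(\lambda a)=\lambda\psi(a)$ for $a,b\in A_+$, $\lambda>0$. It is *proper* when it is non-zero, $\{a\in A_+:\psi(a)<\infty\}$ is dense in $A_+$, and $\{a\in A_+:\psi(a)\le\alpha\}$ is closed for all $\alpha\ge0$. Put $\mathcal N_\psi=\{a\in A:\psi(a^*a)<\infty\}$; a proper weight $\psi$ extends uniquely to a linear functional, again denoted $\psi$, on $\mathcal N_\psi^*\mathcal N_\psi=\operatorname{Span}\{a^*b:a,b\in\mathcal N_\psi\}$. A proper weight $\psi$ is a *$\beta$-KMS weight* for a pointwise norm-continuous one-parameter group $\alpha$ of automorphisms of $A$ when $\psi\circ\alpha_t=\psi$ on $A_+$ for all $t\in\mathbb R$, and for all $a,b\in\mathcal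 N_\psi\cap\mathcal N_\psi^*$ there is a continuous bounded function $F$ on the closed strip of all $z\in\mathbb C$ whose imaginary part lies between $0$ and $\beta$, holomorphic in the interior of the strip, such that $F(t)=\psi(a\alpha_t(b))$ and $F(t+i\beta)=\psi(\alpha_t(b)a)$ for all $t\in\mathbb R$. Suppose that $\ker c\cap\mathcal G^x_x=\{x\}$ for all $x\in\mathcal G^{(0)}$ and that $\ker c=\{g\in\mathcal G:c(g)=0\}$ is open in $\mathcal G$. Then the map $m\mapsto\varphi_m$, where $$\varphi_m(a)=\int_{\mathcal G^{(0)}}P(a)\,dm\qquad(a\in C^*_r(\mathcal G)_+),$$ is a bijection from the set of $(\mathcal G,c)$-conformal measures on $\mathcal G^{(0)}$ with exponent $\beta$ onto the set of $\beta$-KMS weights for $\sigma^c$ on $C^*_r(\mathcal G)$. -/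

import Mathlib

open scoped ENNReal CompactlySupported ZeroAtInfty

noncomputable section

/-- An étale topological groupoid with space of arrows `G` and unit space `X`: range and source
maps `r, s : G → X`, units `unit x`, inverses, and a product `mul g h` which is only meaningful when
`s g = r h`.  All structure maps are continuous and `r`, `s` are local homeomorphisms. The map
`unit` identifies `X` with the subspace of units of `G`. -/
structure EtaleGroupoid (G X : Type*) [TopologicalSpace G] [TopologicalSpace X] where
  /-- the range map -/
  r : G → X
  /-- the source map -/
  s : G → X
  /-- the unit at a point -/
  unit : X → G
  /-- the product, only meaningful on composable pairs -/
  mul : G → G → G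
  /-- the inverse -/
  inv : G → G
  r_unit : ∀ x, r (unit x) = x
  s_unit : ∀ x, s (unit x) = x
  r_mul : ∀ g h, s g = r h → r (mul g h) = r g
  s_mul : ∀ g h, s g = r h → s (mul g h) = s h
  mul_assoc : ∀ g h k, s g = r h → s h = r k → mul (mul g h) k = mul g (mul h k)
  unit_mul : ∀ g, mul (unit (r g)) g = g
  mul_unit : ∀ g, mul g (unit (s g)) = g
  r_inv : ∀ g, r (inv g) = s g
  s_inv : ∀ g, s (inv g) = r g
  inv_mul : ∀ g, mul (inv g) g = unit (s g)
  mul_inv : ∀ g, mul g (inv g) = unit (r g)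
  continuous_unit : Continuous unit
  continuousOn_mul : ContinuousOn (fun p : G × G => mul p.1 p.2) {p | s p.1 = r p.2}
  continuous_inv : Continuous inv
  isLocalHomeomorph_r : IsLocalHomeomorph r
  isLocalHomeomorph_s : IsLocalHomeomorph s

namespace EtaleGroupoid

section Groupoid

variable {G X : Type*} [TopologicalSpace G] [TopologicalSpace X] (𝒢 : EtaleGroupoid G X)

theorem inv_mul_cancel_left {g h : G} (e : 𝒢.s g = 𝒢.r h) :
    𝒢.mul (𝒢.inv g) (𝒢.mul g h) = h := by
  rw [← 𝒢.mul_assoc _ _ _ (𝒢.s_inv g) e, 𝒢.inv_mul, e, 𝒢.unit_mul]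

theorem mul_inv_cancel_left {g h : G} (e : 𝒢.r g = 𝒢.r h) :
    𝒢.mul g (𝒢.mul (𝒢.inv g) h) = h := by
  rw [← 𝒢.mul_assoc _ _ _ (𝒢.r_inv g).symm ((𝒢.s_inv g).trans e), 𝒢.mul_inv, e, 𝒢.unit_mul]

theorem mul_inv_cancel_right {g h : G} (e : 𝒢.s g = 𝒢.r h) :
    𝒢.mul (𝒢.mul g h) (𝒢.inv h) = g := by
  rw [𝒢.mul_assoc _ _ _ e (𝒢.r_inv h).symm, 𝒢.mul_inv, ← e, 𝒢.mul_unit]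

theorem inv_mul_cancel_right {g h : G} (e : 𝒢.s g = 𝒢.s h) :
    𝒢.mul (𝒢.mul g (𝒢.inv h)) h = g := by
  rw [𝒢.mul_assoc _ _ _ (e.trans (𝒢.r_inv h).symm) (𝒢.s_inv h), 𝒢.inv_mul, ← e, 𝒢.mul_unit]

theorem inv_unique {g h : G} (e : 𝒢.s g = 𝒢.r h) (e' : 𝒢.mul g h = 𝒢.unit (𝒢.s h)) :
    g = 𝒢.inv h := by
  have := 𝒢.mul_inv_cancel_right e
  rw [e', ← 𝒢.r_inv, 𝒢.unit_mul] at this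
  exact this.symm

theorem inv_inv (g : G) : 𝒢.inv (𝒢.inv g) = g :=
  (𝒢.inv_unique (𝒢.r_inv g).symm (by rw [𝒢.mul_inv, 𝒢.s_inv])).symm

theorem inv_mul_rev {g h : G} (e : 𝒢.s g = 𝒢.r h) :
    𝒢.inv (𝒢.mul g h) = 𝒢.mul (𝒢.inv h) (𝒢.inv g) := by
  have e1 : 𝒢.s (𝒢.inv h) = 𝒢.r (𝒢.inv g) := by rw [𝒢.s_inv, 𝒢.r_inv, e]
  refine (𝒢.inv_unique ?_ ?_).symm
  · rw [𝒢.s_mul _ _ e1, 𝒢.s_inv, 𝒢.r_mul _ _ e]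
  · rw [𝒢.mul_assoc _ _ _ e1 (by rw [𝒢.s_inv, 𝒢.r_mul _ _ e]), 𝒢.inv_mul_cancel_left e, 𝒢.inv_mul,
      𝒢.s_mul _ _ e]

theorem continuous_r : Continuous 𝒢.r := 𝒢.isLocalHomeomorph_r.continuous

theorem continuous_s : Continuous 𝒢.s := 𝒢.isLocalHomeomorph_s.continuous

theorem s_inv_mul {h g : G} (e : 𝒢.r h = 𝒢.r g) : 𝒢.s (𝒢.mul (𝒢.inv h) g) = 𝒢.s g :=
  𝒢.s_mul _ _ ((𝒢.s_inv h).trans e)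

theorem r_inv_mul {h g : G} (e : 𝒢.r h = 𝒢.r g) : 𝒢.r (𝒢.mul (𝒢.inv h) g) = 𝒢.s h := by
  rw [𝒢.r_mul _ _ ((𝒢.s_inv h).trans e), 𝒢.r_inv]

/-- A compactly supported function is supported on at most `N` points of each fibre of a local
homeomorphism. -/
theorem exists_fibre_bound {p : G → X} (hp : IsLocalHomeomorph p) (f : C_c(G, ℂ)) :
    ∃ N : ℕ, ∀ x, {h : G | p h = x ∧ f h ≠ 0}.Finite ∧ {h : G | p h = x ∧ f h ≠ 0}.ncard ≤ N := by
  have hK : IsCompact (tsupport f) := f.hasCompactSupport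
  have hloc : ∀ g : G, ∃ U : Set G, IsOpen U ∧ g ∈ U ∧ Set.InjOn p U := by
    intro g
    obtain ⟨e, he, rfl⟩ := hp g
    exact ⟨e.source, e.open_source, he, e.injOn⟩
  choose U hUo hgU hUi using hloc
  obtain ⟨t, ht⟩ := hK.elim_finite_subcover U hUo fun g _ => Set.mem_iUnion.2 ⟨g, hgU g⟩
  refine ⟨t.card, fun x => ?_⟩
  have hsub : {h : G | p h = x ∧ f h ≠ 0} ⊆ ⋃ g ∈ t, {h | h ∈ U g ∧ p h = x} := by
    rintro h ⟨h1, h2⟩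
    obtain ⟨g, hg, hgh⟩ := Set.mem_iUnion₂.1 (ht (subset_tsupport f h2))
    exact Set.mem_iUnion₂.2 ⟨g, hg, hgh, h1⟩
  have hss : ∀ g, {h | h ∈ U g ∧ p h = x}.Subsingleton := fun g a ha b hb =>
    hUi g ha.1 hb.1 (ha.2.trans hb.2.symm)
  have hfin : (⋃ g ∈ t, {h | h ∈ U g ∧ p h = x}).Finite :=
    t.finite_toSet.biUnion fun g _ => (hss g).finite
  refine ⟨hfin.subset hsub, (Set.ncard_le_ncard hsub hfin).trans ?_⟩
  have hle1 : ∀ g, {h | h ∈ U g ∧ p h = x}.ncard ≤ 1 := fun g => by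
    rcases (hss g).eq_empty_or_singleton with e | ⟨a, e⟩ <;> rw [e] <;> simp
  refine (Finset.set_ncard_biUnion_le t _).trans ?_
  calc ∑ g ∈ t, {h | h ∈ U g ∧ p h = x}.ncard ≤ ∑ _g ∈ t, 1 :=
        Finset.sum_le_sum fun g _ => hle1 g
    _ = t.card := by simp

theorem finite_fibre (f : C_c(G, ℂ)) (x : X) : {h : G | 𝒢.r h = x ∧ f h ≠ 0}.Finite := by
  obtain ⟨N, hN⟩ := exists_fibre_bound 𝒢.isLocalHomeomorph_r f
  exact (hN x).1

theorem finite_fibre' (f : C_c(G, ℂ)) (x : X) : {h : {h : G // 𝒢.r h = x} | f h ≠ 0}.Finite :=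
  Set.Finite.of_finite_image (f := Subtype.val)
    ((𝒢.finite_fibre f x).subset (by rintro _ ⟨h, hh, rfl⟩; exact ⟨h.2, hh⟩))
    Subtype.val_injective.injOn

theorem summable_fibre (f : C_c(G, ℂ)) (x : X) (F : {h : G // 𝒢.r h = x} → ℂ) :
    Summable fun h : {h : G // 𝒢.r h = x} => f h * F h :=
  summable_of_hasFiniteSupport ((𝒢.finite_fibre' f x).subset fun h hh => by
    simp only [Function.mem_support] at hh
    exact left_ne_zero_of_mul hh)

end Groupoid

section Representation

variable {G X : Type*} [TopologicalSpace G] [TopologicalSpace X] (𝒢 : EtaleGroupoid G X)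

/-- The Hilbert space `ℓ²(G_x)`, where `G_x` is the fibre of the source map over `x`. -/
abbrev Ell2 (x : X) : Type _ := lp (fun _ : {g : G // 𝒢.s g = x} => ℂ) 2

/-- The formula `(π_x(f)ψ)(g) = ∑_{h ∈ r⁻¹(r(g))} f(h) ψ(h⁻¹g)` for a function `ψ` on `G_x`. -/
def regFun (f : C_c(G, ℂ)) (x : X) (ψ : {g : G // 𝒢.s g = x} → ℂ) (g : {g : G // 𝒢.s g = x}) : ℂ :=
  ∑' h : {h : G // 𝒢.r h = 𝒢.r g},
    f h * ψ ⟨𝒢.mul (𝒢.inv h) g, (𝒢.s_inv_mul h.2).trans g.2⟩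

/-- The change of variables `h ↦ h⁻¹g`. -/
def fibreEquiv (x : X) (g : {g : G // 𝒢.s g = x}) :
    {h : G // 𝒢.r h = 𝒢.r g} ≃ {k : G // 𝒢.s k = x} where
  toFun h := ⟨𝒢.mul (𝒢.inv h) g, (𝒢.s_inv_mul h.2).trans g.2⟩
  invFun k := ⟨𝒢.mul g (𝒢.inv k), 𝒢.r_mul _ _ (by rw [𝒢.r_inv, g.2, k.2])⟩
  left_inv := by
    rintro ⟨h, hh⟩
    refine Subtype.ext ?_
    simp only
    have e : 𝒢.s (𝒢.inv h) = 𝒢.r g := (𝒢.s_inv h).trans hh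
    rw [𝒢.inv_mul_rev e, 𝒢.inv_inv, 𝒢.mul_inv_cancel_left hh.symm]
  right_inv := by
    rintro ⟨k, hk⟩
    refine Subtype.ext ?_
    simp only
    have e : 𝒢.s (g : G) = 𝒢.r (𝒢.inv k) := by rw [𝒢.r_inv, g.2, hk]
    rw [𝒢.inv_mul_rev e, 𝒢.inv_inv, 𝒢.inv_mul_cancel_right (hk.trans g.2.symm)]

theorem regFun_eq (f : C_c(G, ℂ)) (x : X) (ψ : {g : G // 𝒢.s g = x} → ℂ)
    (g : {g : G // 𝒢.s g = x}) :
    𝒢.regFun f x ψ g = ∑' k : {k : G // 𝒢.s k = x}, f (𝒢.mul g (𝒢.inv k)) * ψ k := by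
  rw [← (𝒢.fibreEquiv x g).tsum_eq]
  refine tsum_congr fun h => ?_
  congr 2
  exact congrArg Subtype.val ((𝒢.fibreEquiv x g).left_inv h).symm

theorem finite_row (f : C_c(G, ℂ)) (x : X) (g : {g : G // 𝒢.s g = x}) :
    {k : {k : G // 𝒢.s k = x} | f (𝒢.mul g (𝒢.inv k)) ≠ 0}.Finite :=
  (𝒢.finite_fibre' f (𝒢.r g)).preimage ((𝒢.fibreEquiv x g).symm.injective.injOn)

theorem regFun_eq_sum (f : C_c(G, ℂ)) (x : X) (ψ : {g : G // 𝒢.s g = x} → ℂ)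
    (g : {g : G // 𝒢.s g = x}) :
    𝒢.regFun f x ψ g = ∑ k ∈ (𝒢.finite_row f x g).toFinset, f (𝒢.mul g (𝒢.inv k)) * ψ k := by
  rw [𝒢.regFun_eq]
  refine tsum_eq_sum fun k hk => ?_
  simp only [Set.Finite.mem_toFinset, Set.mem_ofPred_eq, not_not] at hk
  rw [hk, zero_mul]

theorem exists_row_bound (f : C_c(G, ℂ)) :
    ∃ N : ℕ, ∀ x g, (𝒢.finite_row f x g).toFinset.card ≤ N := by
  obtain ⟨N, hN⟩ := exists_fibre_bound 𝒢.isLocalHomeomorph_r f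
  refine ⟨N, fun x g => ?_⟩
  rw [← Set.ncard_coe_finset, Set.Finite.coe_toFinset]
  refine le_trans ?_ (hN (𝒢.r g)).2
  refine Set.ncard_le_ncard_of_injOn (fun k => 𝒢.mul g (𝒢.inv k)) (fun k hk => ⟨?_, hk⟩) ?_
    (hN (𝒢.r g)).1
  · exact ((𝒢.fibreEquiv x g).symm k).2
  · intro k _ k' _ hkk
    exact (𝒢.fibreEquiv x g).symm.injective (Subtype.ext hkk)

theorem exists_col_bound (f : C_c(G, ℂ)) :
    ∃ N : ℕ, ∀ x (k : {k : G // 𝒢.s k = x}) (S : Finset {g : G // 𝒢.s g = x}),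
      (∀ g ∈ S, f (𝒢.mul g (𝒢.inv k)) ≠ 0) → S.card ≤ N := by
  obtain ⟨N, hN⟩ := exists_fibre_bound 𝒢.isLocalHomeomorph_s f
  refine ⟨N, fun x k S hS => ?_⟩
  rw [← Set.ncard_coe_finset]
  have e : ∀ g : {g : G // 𝒢.s g = x}, 𝒢.s (g : G) = 𝒢.r (𝒢.inv k) := fun g => by
    rw [𝒢.r_inv, g.2, k.2]
  refine le_trans ?_ (hN (𝒢.r k)).2
  refine Set.ncard_le_ncard_of_injOn (fun g => 𝒢.mul g (𝒢.inv k)) (fun g hg => ⟨?_, hS g hg⟩) ?_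
    (hN (𝒢.r k)).1
  · rw [𝒢.s_mul _ _ (e g), 𝒢.s_inv]
  · intro g _ g' _ hgg
    refine Subtype.ext ?_
    have h1 := 𝒢.inv_mul_cancel_right (g.2.trans k.2.symm)
    have h2 := 𝒢.inv_mul_cancel_right (g'.2.trans k.2.symm)
    simp only at hgg
    rw [← h1, ← h2, hgg]

/-- Each `f` acts by operators that are bounded uniformly in `x`. -/
theorem exists_bound (f : C_c(G, ℂ)) :
    ∃ C : ℝ, 0 ≤ C ∧ ∀ (x : X) (ψ : 𝒢.Ell2 x) (S : Finset {g : G // 𝒢.s g = x}),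
      ∑ g ∈ S, ‖𝒢.regFun f x ψ g‖ ^ (2 : ENNReal).toReal ≤
        (C * ‖ψ‖) ^ (2 : ENNReal).toReal := by
  obtain ⟨N, hN⟩ := 𝒢.exists_row_bound f
  obtain ⟨N', hN'⟩ := 𝒢.exists_col_bound f
  obtain ⟨M, hM⟩ := f.hasCompactSupport.exists_bound_of_continuous f.continuous
  refine ⟨√(N * M ^ 2 * N'), Real.sqrt_nonneg _, fun x ψ S => ?_⟩
  classical
  have h2 : ∀ a : ℝ, a ^ (2 : ENNReal).toReal = a ^ 2 := fun a => by simp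
  simp only [h2, mul_pow]
  rw [Real.sq_sqrt (by positivity)]
  set F : {g : G // 𝒢.s g = x} → Finset {g : G // 𝒢.s g = x} :=
    fun g => (𝒢.finite_row f x g).toFinset with hF
  have hrow : ∀ g, ‖𝒢.regFun f x ψ g‖ ^ 2 ≤ N * M ^ 2 * ∑ k ∈ F g, ‖ψ k‖ ^ 2 := by
    intro g
    rw [𝒢.regFun_eq_sum]
    calc ‖∑ k ∈ F g, f (𝒢.mul g (𝒢.inv k)) * ψ k‖ ^ 2
        ≤ (∑ k ∈ F g, M * ‖ψ k‖) ^ 2 := by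
          gcongr
          refine (norm_sum_le _ _).trans (Finset.sum_le_sum fun k _ => ?_)
          rw [norm_mul]
          gcongr
          exact hM _
      _ ≤ (F g).card * ∑ k ∈ F g, (M * ‖ψ k‖) ^ 2 := sq_sum_le_card_mul_sum_sq
      _ ≤ N * ∑ k ∈ F g, (M * ‖ψ k‖) ^ 2 := by
          gcongr
          exact hN x g
      _ = N * M ^ 2 * ∑ k ∈ F g, ‖ψ k‖ ^ 2 := by
          simp only [mul_pow, ← Finset.mul_sum]
          ring
  calc ∑ g ∈ S, ‖𝒢.regFun f x ψ g‖ ^ 2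
      ≤ ∑ g ∈ S, N * M ^ 2 * ∑ k ∈ F g, ‖ψ k‖ ^ 2 := Finset.sum_le_sum fun g _ => hrow g
    _ = N * M ^ 2 * ∑ g ∈ S, ∑ k ∈ F g, ‖ψ k‖ ^ 2 := by rw [Finset.mul_sum]
    _ = N * M ^ 2 * ∑ k ∈ S.biUnion F, ∑ g ∈ S with k ∈ F g, ‖ψ k‖ ^ 2 := by
        congr 1
        refine Finset.sum_comm' fun g k => ?_
        simp only [Finset.mem_filter, Finset.mem_biUnion]
        tauto
    _ ≤ N * M ^ 2 * ∑ k ∈ S.biUnion F, N' * ‖ψ k‖ ^ 2 := by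
        gcongr with k hk
        rw [Finset.sum_const, nsmul_eq_mul]
        gcongr
        refine hN' x k _ fun g hg => ?_
        simpa [hF] using (Finset.mem_filter.1 hg).2
    _ = N * M ^ 2 * N' * ∑ k ∈ S.biUnion F, ‖ψ k‖ ^ 2 := by
        rw [← Finset.mul_sum, ← _root_.mul_assoc]
    _ ≤ N * M ^ 2 * N' * ‖ψ‖ ^ 2 := by
        gcongr
        have := lp.sum_rpow_le_norm_rpow (p := 2) (by simp) ψ (S.biUnion F)
        simpa only [h2] using this

/-- The representation `π_x` of `C_c(G)` on `ℓ²(G_x)`. -/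
def regRep (f : C_c(G, ℂ)) (x : X) : 𝒢.Ell2 x →L[ℂ] 𝒢.Ell2 x :=
  LinearMap.mkContinuousOfExistsBound
    { toFun := fun ψ => ⟨𝒢.regFun f x ψ, memℓp_gen' ((𝒢.exists_bound f).choose_spec.2 x ψ)⟩
      map_add' := fun φ ψ => by
        refine lp.ext (funext fun g => ?_)
        simp only [lp.coeFn_add, Pi.add_apply, 𝒢.regFun_eq_sum, mul_add, Finset.sum_add_distrib]
      map_smul' := fun c ψ => by
        refine lp.ext (funext fun g => ?_)
        simp only [lp.coeFn_smul, Pi.smul_apply, 𝒢.regFun_eq_sum, smul_eq_mul, Finset.mul_sum,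
          RingHom.id_apply]
        exact Finset.sum_congr rfl fun k _ => by ring }
    ⟨(𝒢.exists_bound f).choose, fun ψ => lp.norm_le_of_forall_sum_le (by simp)
      (mul_nonneg (𝒢.exists_bound f).choose_spec.1 (norm_nonneg _))
      ((𝒢.exists_bound f).choose_spec.2 x ψ)⟩

theorem regRep_apply (f : C_c(G, ℂ)) (x : X) (ψ : 𝒢.Ell2 x) (g : {g : G // 𝒢.s g = x}) :
    𝒢.regRep f x ψ g = 𝒢.regFun f x ψ g := rfl

theorem norm_regRep_le (f : C_c(G, ℂ)) (x : X) :
    ‖𝒢.regRep f x‖ ≤ (𝒢.exists_bound f).choose :=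
  ContinuousLinearMap.opNorm_le_bound _ (𝒢.exists_bound f).choose_spec.1 fun ψ =>
    lp.norm_le_of_forall_sum_le (by simp)
      (mul_nonneg (𝒢.exists_bound f).choose_spec.1 (norm_nonneg _))
      ((𝒢.exists_bound f).choose_spec.2 x ψ)

/-- The C*-algebra of bounded families `(T_x)` of operators on the Hilbert spaces `ℓ²(G_x)`, with
norm `sup_x ‖T_x‖`. -/
def BddFam : Type _ := lp (fun x : X => 𝒢.Ell2 x →L[ℂ] 𝒢.Ell2 x) ∞

instance : NonUnitalCStarAlgebra 𝒢.BddFam :=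
  inferInstanceAs (NonUnitalCStarAlgebra (lp (fun x : X => 𝒢.Ell2 x →L[ℂ] 𝒢.Ell2 x) ∞))

variable {𝒢} in
/-- The operator at `x` of a bounded family. -/
def BddFam.op (T : 𝒢.BddFam) (x : X) : 𝒢.Ell2 x →L[ℂ] 𝒢.Ell2 x :=
  (show lp (fun x : X => 𝒢.Ell2 x →L[ℂ] 𝒢.Ell2 x) ∞ from T) x

namespace BddFam

variable {𝒢} (S T : 𝒢.BddFam) (x : X)

theorem ext {S T : 𝒢.BddFam} (h : ∀ x, S.op x = T.op x) : S = T := lp.ext (funext h)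

theorem op_add : (S + T).op x = S.op x + T.op x := rfl

theorem op_sub : (S - T).op x = S.op x - T.op x := rfl

theorem op_smul (a : ℂ) : (a • T).op x = a • T.op x := rfl

theorem op_mul : (S * T).op x = S.op x * T.op x := rfl

theorem op_star : (star T).op x = star (T.op x) := rfl

theorem norm_eq : ‖T‖ = ⨆ x, ‖T.op x‖ := rfl

theorem norm_op_le : ‖T.op x‖ ≤ ‖T‖ := lp.norm_apply_le_norm (by simp) _ x

end BddFam

/-- The family `(π_x(f))_x`. Its norm is the reduced norm `sup_x ‖π_x(f)‖` of `f`. -/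
def regFam (f : C_c(G, ℂ)) : 𝒢.BddFam :=
  (⟨fun x => 𝒢.regRep f x, memℓp_infty ⟨_, by rintro _ ⟨x, rfl⟩; exact 𝒢.norm_regRep_le f x⟩⟩ :
    lp (fun x : X => 𝒢.Ell2 x →L[ℂ] 𝒢.Ell2 x) ∞)

theorem regFam_op (f : C_c(G, ℂ)) (x : X) : (𝒢.regFam f).op x = 𝒢.regRep f x := rfl

theorem norm_regFam (f : C_c(G, ℂ)) : ‖𝒢.regFam f‖ = ⨆ x, ‖𝒢.regRep f x‖ := rfl

open Classical in
/-- The basis vector `δ_k` of `ℓ²(G_x)`. -/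
def delta (x : X) (k : {k : G // 𝒢.s k = x}) : 𝒢.Ell2 x := lp.single 2 k (1 : ℂ)

theorem regRep_delta (f : C_c(G, ℂ)) (x : X) (k g : {k : G // 𝒢.s k = x}) :
    𝒢.regRep f x (𝒢.delta x k) g = f (𝒢.mul g (𝒢.inv k)) := by
  classical
  rw [regRep_apply, regFun_eq, tsum_eq_single k]
  · simp [delta]
  · intro k' hk'
    simp [delta, lp.single_apply, hk']

theorem inner_delta (x : X) (k : {k : G // 𝒢.s k = x}) (ψ : 𝒢.Ell2 x) :
    inner ℂ (𝒢.delta x k) ψ = ψ k := by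
  simp [delta, lp.inner_single_left]

/-- Operators on `ℓ²(G_x)` are determined by their matrix coefficients. -/
theorem clm_ext {x : X} {S T : 𝒢.Ell2 x →L[ℂ] 𝒢.Ell2 x}
    (h : ∀ k g, S (𝒢.delta x k) g = T (𝒢.delta x k) g) : S = T := by
  classical
  refine lp.ext_continuousLinearMap (by simp) fun k => ?_
  refine ContinuousLinearMap.ext_ring ?_
  refine lp.ext (funext fun g => ?_)
  have := h k g
  simp only [delta] at this
  exact this

theorem regFam_add (f₁ f₂ : C_c(G, ℂ)) : 𝒢.regFam (f₁ + f₂) = 𝒢.regFam f₁ + 𝒢.regFam f₂ := by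
  refine BddFam.ext fun x => 𝒢.clm_ext fun k g => ?_
  change 𝒢.regRep (f₁ + f₂) x (𝒢.delta x k) g =
    𝒢.regRep f₁ x (𝒢.delta x k) g + 𝒢.regRep f₂ x (𝒢.delta x k) g
  simp only [regRep_delta, CompactlySupportedContinuousMap.add_apply]

theorem regFam_smul (a : ℂ) (f : C_c(G, ℂ)) : 𝒢.regFam (a • f) = a • 𝒢.regFam f := by
  refine BddFam.ext fun x => 𝒢.clm_ext fun k g => ?_
  change 𝒢.regRep (a • f) x (𝒢.delta x k) g = a • 𝒢.regRep f x (𝒢.delta x k) g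
  simp only [regRep_delta, CompactlySupportedContinuousMap.smul_apply]

theorem regFam_zero : 𝒢.regFam 0 = 0 := by
  simpa using 𝒢.regFam_smul 0 0

end Representation

section Convolution

variable {G X : Type*} [TopologicalSpace G] [TopologicalSpace X] (𝒢 : EtaleGroupoid G X)

/-- The convolution `(f₁ * f₂)(g) = ∑_{h ∈ r⁻¹(r(g))} f₁(h) f₂(h⁻¹g)`. -/
def convFun (f₁ f₂ : G → ℂ) (g : G) : ℂ :=
  ∑' h : {h : G // 𝒢.r h = 𝒢.r g}, f₁ h * f₂ (𝒢.mul (𝒢.inv h) g)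

variable [T2Space G]

theorem t2Space_units (𝒢 : EtaleGroupoid G X) : T2Space X :=
  T2Space.of_injective_continuous (Function.LeftInverse.injective 𝒢.r_unit) 𝒢.continuous_unit

theorem continuous_convFun_aux {F f : G → ℂ} (hF : Continuous F) (hFc : HasCompactSupport F)
    (hf : Continuous f) (e : OpenPartialHomeomorph G X) (he : 𝒢.r = e)
    (hs : tsupport F ⊆ e.source) : Continuous (𝒢.convFun F f) := by
  have := 𝒢.t2Space_units
  rw [continuous_iff_continuousAt]
  intro g₀
  by_cases hg : 𝒢.r g₀ ∈ e.target
  · have hO : IsOpen (𝒢.r ⁻¹' e.target) := e.open_target.preimage 𝒢.continuous_r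
    have hre : ∀ g ∈ 𝒢.r ⁻¹' e.target, 𝒢.r (e.symm (𝒢.r g)) = 𝒢.r g := fun g hg => by
      have h1 := e.right_inv hg
      rwa [← he] at h1
    have hsec : ContinuousOn (fun g => e.symm (𝒢.r g)) (𝒢.r ⁻¹' e.target) :=
      e.continuousOn_symm.comp 𝒢.continuous_r.continuousOn fun g hg => hg
    have h1 : ContinuousOn
        (fun g => F (e.symm (𝒢.r g)) * f (𝒢.mul (𝒢.inv (e.symm (𝒢.r g))) g))
        (𝒢.r ⁻¹' e.target) := by
      refine (hF.comp_continuousOn hsec).mul (hf.comp_continuousOn ?_)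
      refine 𝒢.continuousOn_mul.comp
        ((𝒢.continuous_inv.comp_continuousOn hsec).prodMk continuousOn_id) fun g hg => ?_
      change 𝒢.s (𝒢.inv (e.symm (𝒢.r g))) = 𝒢.r g
      rw [𝒢.s_inv, hre g hg]
    refine (h1.continuousAt (hO.mem_nhds hg)).congr ?_
    filter_upwards [hO.mem_nhds hg] with g hg
    refine Eq.symm ?_
    rw [convFun]
    refine tsum_eq_single (⟨e.symm (𝒢.r g), hre g hg⟩ : {h : G // 𝒢.r h = 𝒢.r g}) fun h hne => ?_
    by_cases hFh : F h = 0
    · rw [hFh, zero_mul]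
    · refine absurd (Subtype.ext ?_) hne
      have hh : (h : G) ∈ e.source := hs (subset_tsupport F hFh)
      have := e.left_inv hh
      rw [← he, h.2] at this
      exact this.symm
  · have hO : IsOpen (𝒢.r ⁻¹' (𝒢.r '' tsupport F)ᶜ) :=
      (IsCompact.image hFc 𝒢.continuous_r).isClosed.isOpen_compl.preimage 𝒢.continuous_r
    have hmem : g₀ ∈ 𝒢.r ⁻¹' (𝒢.r '' tsupport F)ᶜ := by
      rintro ⟨h, hh, hr⟩
      refine hg (hr ▸ ?_)
      rw [he]
      exact e.map_source (hs hh)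
    refine (continuousAt_const (y := (0 : ℂ))).congr ?_
    filter_upwards [hO.mem_nhds hmem] with g hg
    rw [convFun]
    refine Eq.symm ?_
    convert tsum_zero with h
    by_contra hne
    exact hg ⟨h, subset_tsupport F (left_ne_zero_of_mul hne), h.2⟩

theorem hasCompactSupport_convFun (f₁ f₂ : C_c(G, ℂ)) : HasCompactSupport (𝒢.convFun f₁ f₂) := by
  have hcl : IsClosed {p : G × G | 𝒢.s p.1 = 𝒢.r p.2} := by
    have := 𝒢.t2Space_units
    exact isClosed_eq (𝒢.continuous_s.comp continuous_fst) (𝒢.continuous_r.comp continuous_snd)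
  have hK : IsCompact ((tsupport f₁ ×ˢ tsupport f₂) ∩ {p : G × G | 𝒢.s p.1 = 𝒢.r p.2}) :=
    (IsCompact.prod f₁.hasCompactSupport f₂.hasCompactSupport).inter_right hcl
  refine HasCompactSupport.intro
    (hK.image_of_continuousOn (𝒢.continuousOn_mul.mono Set.inter_subset_right)) fun g hg => ?_
  rw [convFun]
  convert tsum_zero with h
  by_contra hne
  refine hg ⟨(h, 𝒢.mul (𝒢.inv h) g), ⟨⟨subset_tsupport _ (left_ne_zero_of_mul hne),
    subset_tsupport _ (right_ne_zero_of_mul hne)⟩, ?_⟩, 𝒢.mul_inv_cancel_left h.2⟩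
  exact (𝒢.r_inv_mul h.2).symm

theorem hasCompactSupport_invol (f : C_c(G, ℂ)) :
    HasCompactSupport fun g => starRingEnd ℂ (f (𝒢.inv g)) := by
  refine HasCompactSupport.intro (IsCompact.image f.hasCompactSupport 𝒢.continuous_inv)
    fun g hg => ?_
  by_contra hne
  refine hg ⟨𝒢.inv g, subset_tsupport _ fun h0 => hne (by simp [h0]), 𝒢.inv_inv g⟩

/-- The involution `f*(g) = conj (f(g⁻¹))` of `C_c(G)`. -/
def invol (f : C_c(G, ℂ)) : C_c(G, ℂ) :=
  ⟨⟨fun g => starRingEnd ℂ (f (𝒢.inv g)),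
    Complex.continuous_conj.comp (f.continuous.comp 𝒢.continuous_inv)⟩,
    𝒢.hasCompactSupport_invol f⟩

theorem regFam_invol (f : C_c(G, ℂ)) : 𝒢.regFam (𝒢.invol f) = star (𝒢.regFam f) := by
  refine BddFam.ext fun x => 𝒢.clm_ext fun k g => ?_
  change 𝒢.regRep (𝒢.invol f) x (𝒢.delta x k) g =
    (ContinuousLinearMap.adjoint (𝒢.regRep f x)) (𝒢.delta x k) g
  rw [← 𝒢.inner_delta x g (ContinuousLinearMap.adjoint _ _), ContinuousLinearMap.adjoint_inner_right,
    ← inner_conj_symm, 𝒢.inner_delta, regRep_delta, regRep_delta]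
  have e : 𝒢.s (g : G) = 𝒢.r (𝒢.inv k) := by rw [𝒢.r_inv, g.2, k.2]
  change starRingEnd ℂ (f (𝒢.inv _)) = _
  rw [𝒢.inv_mul_rev e, 𝒢.inv_inv]

variable [LocallyCompactSpace G]

theorem continuous_convFun (f₁ f₂ : C_c(G, ℂ)) : Continuous (𝒢.convFun f₁ f₂) := by
  choose e hge her using 𝒢.isLocalHomeomorph_r
  have hK : IsCompact (tsupport f₁) := f₁.hasCompactSupport
  obtain ⟨t, ht⟩ := hK.elim_finite_subcover (fun g => (e g).source) (fun g => (e g).open_source)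
    fun g _ => Set.mem_iUnion.2 ⟨g, hge g⟩
  have ht' : tsupport f₁ ⊆ ⋃ i : Fin t.card, (e (t.equivFin.symm i)).source := by
    intro h hh
    obtain ⟨g, hg, hgh⟩ := Set.mem_iUnion₂.1 (ht hh)
    refine Set.mem_iUnion.2 ⟨t.equivFin ⟨g, hg⟩, ?_⟩
    simpa using hgh
  obtain ⟨ρ, hρs, hρ1, -, -⟩ := exists_continuous_sum_one_of_isOpen_isCompact
    (fun i : Fin t.card => (e (t.equivFin.symm i)).open_source) hK ht'
  have hsum : ∀ h, f₁ h = ∑ i, (ρ i h : ℂ) * f₁ h := by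
    intro h
    rw [← Finset.sum_mul]
    by_cases hh : f₁ h = 0
    · simp [hh]
    · have h1 := hρ1 (subset_tsupport f₁ hh)
      simp only [Finset.sum_apply, Pi.one_apply] at h1
      rw [← Complex.ofReal_sum, h1]
      simp
  have hconv : 𝒢.convFun f₁ f₂ = fun g => ∑ i, 𝒢.convFun (fun h => (ρ i h : ℂ) * f₁ h) f₂ g := by
    funext g
    simp only [convFun]
    rw [← Summable.tsum_finsetSum]
    · refine tsum_congr fun h => ?_
      conv_lhs => rw [hsum h]
      rw [Finset.sum_mul]
    · intro i _
      refine (𝒢.summable_fibre f₁ (𝒢.r g)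
        fun h => (ρ i h : ℂ) * f₂ (𝒢.mul (𝒢.inv h) g)).congr fun h => ?_
      ring
  rw [hconv]
  refine continuous_finsetSum _ fun i _ => ?_
  refine 𝒢.continuous_convFun_aux ?_ ?_ f₂.continuous (e (t.equivFin.symm i)) (her _) ?_
  · exact (Complex.continuous_ofReal.comp (ρ i).continuous).mul f₁.continuous
  · exact f₁.hasCompactSupport.mul_left
  · refine subset_trans (closure_mono fun h hh => ?_) (hρs i)
    simp only [Function.mem_support] at hh ⊢
    exact fun h0 => hh (by simp [h0])

/-- The convolution product of `C_c(G)`. -/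
def conv (f₁ f₂ : C_c(G, ℂ)) : C_c(G, ℂ) :=
  ⟨⟨𝒢.convFun f₁ f₂, 𝒢.continuous_convFun f₁ f₂⟩, 𝒢.hasCompactSupport_convFun f₁ f₂⟩

theorem regFam_conv (f₁ f₂ : C_c(G, ℂ)) :
    𝒢.regFam (𝒢.conv f₁ f₂) = 𝒢.regFam f₁ * 𝒢.regFam f₂ := by
  refine BddFam.ext fun x => 𝒢.clm_ext fun k g => ?_
  change 𝒢.regRep (𝒢.conv f₁ f₂) x (𝒢.delta x k) g =
    𝒢.regRep f₁ x (𝒢.regRep f₂ x (𝒢.delta x k)) g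
  have e : 𝒢.s (g : G) = 𝒢.r (𝒢.inv k) := by rw [𝒢.r_inv, g.2, k.2]
  rw [regRep_delta, regRep_apply]
  change 𝒢.convFun f₁ f₂ _ = _
  rw [convFun, regFun]
  simp only [regRep_delta]
  rw [𝒢.r_mul _ _ e]
  refine tsum_congr fun h => ?_
  rw [𝒢.mul_assoc _ _ _ ((𝒢.s_inv _).trans h.2) e]

end Convolution

section Diagonal

variable {G X : Type*} [TopologicalSpace G] [TopologicalSpace X] (𝒢 : EtaleGroupoid G X)

/-- The unit at `x` as a point of the fibre `G_x`. -/
def unitPt (x : X) : {g : G // 𝒢.s g = x} := ⟨𝒢.unit x, 𝒢.s_unit x⟩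

/-- The diagonal coefficient `⟨δ_x, T_x δ_x⟩`. -/
def diagCoeff (T : 𝒢.BddFam) (x : X) : ℂ :=
  inner ℂ (𝒢.delta x (𝒢.unitPt x)) (T.op x (𝒢.delta x (𝒢.unitPt x)))

theorem norm_delta (x : X) (k : {g : G // 𝒢.s g = x}) : ‖𝒢.delta x k‖ = 1 := by
  simp [delta, lp.norm_single]

theorem diagCoeff_sub (S T : 𝒢.BddFam) (x : X) :
    𝒢.diagCoeff (S - T) x = 𝒢.diagCoeff S x - 𝒢.diagCoeff T x := by
  simp only [diagCoeff, BddFam.op_sub, sub_apply, inner_sub_right]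

theorem norm_diagCoeff_le (T : 𝒢.BddFam) (x : X) : ‖𝒢.diagCoeff T x‖ ≤ ‖T‖ := by
  refine (norm_inner_le_norm _ _).trans ?_
  rw [norm_delta, one_mul]
  refine ((T.op x).le_opNorm _).trans ?_
  rw [norm_delta, mul_one]
  exact T.norm_op_le x

theorem diagCoeff_regFam (f : C_c(G, ℂ)) (x : X) : 𝒢.diagCoeff (𝒢.regFam f) x = f (𝒢.unit x) := by
  rw [diagCoeff, inner_delta, regFam_op, regRep_delta, unitPt]
  congr 1
  have h := 𝒢.mul_inv (𝒢.unit x)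
  rwa [𝒢.r_unit] at h

theorem isClosedEmbedding_unit [T2Space G] : Topology.IsClosedEmbedding 𝒢.unit := by
  have h : Topology.IsEmbedding 𝒢.unit :=
    Topology.IsEmbedding.of_leftInverse 𝒢.r_unit 𝒢.continuous_r 𝒢.continuous_unit
  refine ⟨h, ?_⟩
  have : Set.range 𝒢.unit = {g | 𝒢.unit (𝒢.r g) = g} := by
    ext g
    exact ⟨by rintro ⟨x, rfl⟩; exact congrArg _ (𝒢.r_unit x), fun hg => ⟨_, hg⟩⟩
  rw [this]
  exact isClosed_eq (𝒢.continuous_unit.comp 𝒢.continuous_r) continuous_id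

end Diagonal

section ReducedAlgebra

variable {G X : Type*} [TopologicalSpace G] [TopologicalSpace X] [T2Space G] [LocallyCompactSpace G]
  (𝒢 : EtaleGroupoid G X)

/-- The image of the convolution `*`-algebra `C_c(G)` under `⊕_x π_x`. -/
def convAlg : NonUnitalStarSubalgebra ℂ 𝒢.BddFam where
  carrier := Set.range 𝒢.regFam
  add_mem' := by
    rintro _ _ ⟨f₁, rfl⟩ ⟨f₂, rfl⟩
    exact ⟨f₁ + f₂, 𝒢.regFam_add f₁ f₂⟩
  zero_mem' := ⟨0, 𝒢.regFam_zero⟩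
  mul_mem' := by
    rintro _ _ ⟨f₁, rfl⟩ ⟨f₂, rfl⟩
    exact ⟨𝒢.conv f₁ f₂, 𝒢.regFam_conv f₁ f₂⟩
  smul_mem' := by
    rintro a _ ⟨f, rfl⟩
    exact ⟨a • f, 𝒢.regFam_smul a f⟩
  star_mem' := by
    rintro _ ⟨f, rfl⟩
    exact ⟨𝒢.invol f, 𝒢.regFam_invol f⟩

/-- The reduced groupoid C*-algebra `C*_r(G)`: the completion of `C_c(G)` in the reduced norm
`sup_x ‖π_x(f)‖`, realised as the closure of the image of `C_c(G)` in the C*-algebra of bounded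
families of operators on the Hilbert spaces `ℓ²(G_x)`. -/
def ReducedCStar : Type _ := 𝒢.convAlg.topologicalClosure

instance : NonUnitalCStarAlgebra 𝒢.ReducedCStar :=
  NonUnitalStarSubalgebra.nonUnitalCStarAlgebra 𝒢.convAlg.topologicalClosure
    (h_closed := 𝒢.convAlg.isClosed_topologicalClosure)

/-- The order of the C*-algebra `C*_r(G)`: `a ≤ b` when `b - a` is self-adjoint with non-negative
spectrum. -/
instance : PartialOrder 𝒢.ReducedCStar := CStarAlgebra.spectralOrder _

instance : StarOrderedRing 𝒢.ReducedCStar := CStarAlgebra.spectralOrderedRing _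

/-- The inclusion of `C*_r(G)` in the bounded families of operators. -/
def toFam : 𝒢.ReducedCStar →⋆ₙₐ[ℂ] 𝒢.BddFam :=
  NonUnitalStarSubalgebraClass.subtype 𝒢.convAlg.topologicalClosure

theorem toFam_injective : Function.Injective 𝒢.toFam := Subtype.val_injective

theorem norm_toFam (a : 𝒢.ReducedCStar) : ‖𝒢.toFam a‖ = ‖a‖ := rfl

theorem toFam_mem (a : 𝒢.ReducedCStar) : 𝒢.toFam a ∈ closure (Set.range 𝒢.regFam) := a.2

/-- The canonical map of `C_c(G)` to `C*_r(G)`. -/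
def ofCc (f : C_c(G, ℂ)) : 𝒢.ReducedCStar :=
  (⟨𝒢.regFam f, subset_closure ⟨f, rfl⟩⟩ : 𝒢.convAlg.topologicalClosure)

theorem toFam_ofCc (f : C_c(G, ℂ)) : 𝒢.toFam (𝒢.ofCc f) = 𝒢.regFam f := rfl

theorem norm_ofCc (f : C_c(G, ℂ)) : ‖𝒢.ofCc f‖ = ⨆ x, ‖𝒢.regRep f x‖ := rfl

theorem denseRange_ofCc : DenseRange 𝒢.ofCc := by
  intro a
  rw [Metric.mem_closure_range_iff]
  intro ε hε
  obtain ⟨f, hf⟩ := Metric.mem_closure_range_iff.1 (𝒢.toFam_mem a) ε hε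
  exact ⟨f, hf⟩

theorem ofCc_conv (f₁ f₂ : C_c(G, ℂ)) : 𝒢.ofCc (𝒢.conv f₁ f₂) = 𝒢.ofCc f₁ * 𝒢.ofCc f₂ :=
  𝒢.toFam_injective (𝒢.regFam_conv f₁ f₂)

theorem ofCc_invol (f : C_c(G, ℂ)) : 𝒢.ofCc (𝒢.invol f) = star (𝒢.ofCc f) :=
  𝒢.toFam_injective (𝒢.regFam_invol f)

theorem exists_approx (a : 𝒢.ReducedCStar) {ε : ℝ} (hε : 0 < ε) :
    ∃ f : C_c(G, ℂ), ∀ x, dist (𝒢.diagCoeff (𝒢.toFam a) x) (f (𝒢.unit x)) < ε := by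
  obtain ⟨f, hf⟩ := Metric.mem_closure_range_iff.1 (𝒢.toFam_mem a) ε hε
  refine ⟨f, fun x => lt_of_le_of_lt ?_ hf⟩
  rw [dist_eq_norm, dist_eq_norm, ← 𝒢.diagCoeff_regFam, ← 𝒢.diagCoeff_sub]
  exact 𝒢.norm_diagCoeff_le _ x

/-- The conditional expectation `P : C*_r(G) → C₀(X)`, given by `P(a)(x) = ⟨δ_x, a_x δ_x⟩`. It is the
continuous extension of the restriction of functions `C_c(G) → C_c(X)`. -/
def condExp (a : 𝒢.ReducedCStar) : C₀(X, ℂ) where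
  toFun := 𝒢.diagCoeff (𝒢.toFam a)
  continuous_toFun := by
    refine continuous_of_uniform_approx_of_continuous fun u hu => ?_
    obtain ⟨ε, hε, hu⟩ := Metric.mem_uniformity_dist.1 hu
    obtain ⟨f, hf⟩ := 𝒢.exists_approx a hε
    exact ⟨fun x => f (𝒢.unit x), f.continuous.comp 𝒢.continuous_unit, fun x => hu (hf x)⟩
  zero_at_infty' := by
    rw [Metric.tendsto_nhds]
    intro ε hε
    obtain ⟨f, hf⟩ := 𝒢.exists_approx a hε
    have hK : IsCompact (𝒢.unit ⁻¹' tsupport f) :=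
      𝒢.isClosedEmbedding_unit.isCompact_preimage f.hasCompactSupport
    filter_upwards [hK.compl_mem_cocompact] with x hx
    have h0 : f (𝒢.unit x) = 0 := image_eq_zero_of_notMem_tsupport hx
    have := hf x
    rwa [h0] at this

theorem condExp_ofCc (f : C_c(G, ℂ)) (x : X) : 𝒢.condExp (𝒢.ofCc f) x = f (𝒢.unit x) :=
  𝒢.diagCoeff_regFam f x

theorem norm_condExp_apply_le (a : 𝒢.ReducedCStar) (x : X) : ‖𝒢.condExp a x‖ ≤ ‖a‖ :=
  𝒢.norm_diagCoeff_le (𝒢.toFam a) x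

end ReducedAlgebra

/-- A continuous homomorphism `c : G → ℝ`. -/
structure RealHom {G X : Type*} [TopologicalSpace G] [TopologicalSpace X]
    (𝒢 : EtaleGroupoid G X) where
  /-- the underlying function -/
  toFun : G → ℝ
  continuous_toFun : Continuous toFun
  map_mul : ∀ g h, 𝒢.s g = 𝒢.r h → toFun (𝒢.mul g h) = toFun g + toFun h

section Action

variable {G X : Type*} [TopologicalSpace G] [TopologicalSpace X]
  {𝒢 : EtaleGroupoid G X} (c : 𝒢.RealHom)

instance : CoeFun 𝒢.RealHom fun _ => G → ℝ := ⟨RealHom.toFun⟩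

theorem RealHom.map_mul_inv {g k : G} (e : 𝒢.s g = 𝒢.s k) : c (𝒢.mul g (𝒢.inv k)) = c g - c k := by
  have h := c.map_mul (𝒢.mul g (𝒢.inv k)) k
    (by rw [𝒢.s_mul _ _ (e.trans (𝒢.r_inv k).symm), 𝒢.s_inv])
  rw [𝒢.inv_mul_cancel_right e] at h
  linarith

/-- The function `g ↦ e^{itc(g)}`. -/
def phase (t : ℝ) (g : G) : ℂ := Complex.exp (Complex.I * t * c g)

theorem norm_phase (t : ℝ) (g : G) : ‖phase c t g‖ = 1 := by
  rw [phase, Complex.norm_exp]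
  simp

theorem phase_neg (t : ℝ) (g : G) : phase c (-t) g = starRingEnd ℂ (phase c t g) := by
  rw [phase, phase, ← Complex.exp_conj]
  simp

theorem phase_neg_mul (t : ℝ) (g : G) : phase c (-t) g * phase c t g = 1 := by
  rw [phase, phase, ← Complex.exp_add]
  simp

/-- The function `e^{itc} f` for `f ∈ C_c(G)`. -/
def twist (t : ℝ) (f : C_c(G, ℂ)) : C_c(G, ℂ) where
  toFun g := phase c t g * f g
  continuous_toFun := by
    have := c.continuous_toFun
    have := f.continuous
    unfold phase
    fun_prop
  hasCompactSupport' := f.hasCompactSupport.mul_left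

/-- The unitary `u_t` on `ℓ²(G_x)` given by multiplication with `e^{itc}`. -/
def unitaryOp (t : ℝ) (x : X) : 𝒢.Ell2 x →L[ℂ] 𝒢.Ell2 x :=
  LinearMap.mkContinuous
    { toFun := fun ψ => ⟨fun g => phase c t g * ψ g, memℓp_gen (by
        simpa only [norm_mul, norm_phase, one_mul] using (lp.memℓp ψ).summable (by simp))⟩
      map_add' := fun φ ψ => lp.ext (funext fun g => mul_add _ _ _)
      map_smul' := fun a ψ => lp.ext (funext fun g => mul_left_comm _ _ _) }
    1 fun ψ => lp.norm_le_of_forall_sum_le (by simp) (by positivity) fun S => by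
      rw [one_mul]
      refine le_trans (le_of_eq ?_) (lp.sum_rpow_le_norm_rpow (by simp) ψ S)
      refine Finset.sum_congr rfl fun g _ => ?_
      change ‖phase c t g * ψ g‖ ^ _ = _
      rw [norm_mul, norm_phase, one_mul]

theorem unitaryOp_apply (t : ℝ) (x : X) (ψ : 𝒢.Ell2 x) (g : {g : G // 𝒢.s g = x}) :
    unitaryOp c t x ψ g = phase c t g * ψ g := rfl

/-- The family `(u_t)_x` of unitaries. -/
def unitaryFam (t : ℝ) : 𝒢.BddFam :=
  (⟨fun x => unitaryOp c t x, memℓp_infty ⟨1, by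
    rintro _ ⟨x, rfl⟩
    exact LinearMap.mkContinuous_norm_le _ zero_le_one _⟩⟩ :
    lp (fun x : X => 𝒢.Ell2 x →L[ℂ] 𝒢.Ell2 x) ∞)

theorem unitaryFam_op (t : ℝ) (x : X) : (unitaryFam c t).op x = unitaryOp c t x := rfl

theorem unitaryFam_neg_mul (t : ℝ) (T : 𝒢.BddFam) : unitaryFam c (-t) * (unitaryFam c t * T) = T := by
  refine BddFam.ext fun x => ContinuousLinearMap.ext fun ψ => lp.ext (funext fun g => ?_)
  change phase c (-t) g * (phase c t g * T.op x ψ g) = T.op x ψ g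
  rw [← _root_.mul_assoc, phase_neg_mul, one_mul]

theorem mul_unitaryFam_neg (t : ℝ) (T : 𝒢.BddFam) : T * unitaryFam c t * unitaryFam c (-t) = T := by
  refine BddFam.ext fun x => ContinuousLinearMap.ext fun ψ => ?_
  change T.op x (unitaryOp c t x (unitaryOp c (-t) x ψ)) = T.op x ψ
  congr 1
  refine lp.ext (funext fun g => ?_)
  change phase c t g * (phase c (-t) g * ψ g) = ψ g
  rw [mul_left_comm, ← _root_.mul_assoc, phase_neg_mul, one_mul]

theorem conj_neg_conj (t : ℝ) (T : 𝒢.BddFam) :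
    unitaryFam c (-t) * (unitaryFam c t * T * unitaryFam c (-t)) * unitaryFam c (- -t) = T := by
  rw [_root_.mul_assoc (unitaryFam c t), unitaryFam_neg_mul, mul_unitaryFam_neg]

theorem star_unitaryFam (t : ℝ) : star (unitaryFam c t) = unitaryFam c (-t) := by
  refine BddFam.ext fun x => 𝒢.clm_ext fun k g => ?_
  change (ContinuousLinearMap.adjoint (unitaryOp c t x)) (𝒢.delta x k) g =
    unitaryOp c (-t) x (𝒢.delta x k) g
  rw [← 𝒢.inner_delta x g (ContinuousLinearMap.adjoint _ _), ContinuousLinearMap.adjoint_inner_right,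
    ← inner_conj_symm, 𝒢.inner_delta, unitaryOp_apply, unitaryOp_apply, map_mul, phase_neg]
  classical
  by_cases h : g = k
  · subst h
    simp [delta]
  · simp [delta, lp.single_apply, h, Ne.symm h]

theorem regFam_twist (t : ℝ) (f : C_c(G, ℂ)) :
    𝒢.regFam (twist c t f) = unitaryFam c t * 𝒢.regFam f * unitaryFam c (-t) := by
  refine BddFam.ext fun x => 𝒢.clm_ext fun k g => ?_
  have h1 : unitaryOp c (-t) x (𝒢.delta x k) = phase c (-t) k • 𝒢.delta x k := by
    refine lp.ext (funext fun g => ?_)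
    rw [unitaryOp_apply, lp.coeFn_smul, Pi.smul_apply, smul_eq_mul]
    classical
    by_cases h : g = k
    · rw [h]
    · simp [delta, lp.single_apply, h]
  change 𝒢.regRep (twist c t f) x (𝒢.delta x k) g =
    phase c t g * 𝒢.regRep f x (unitaryOp c (-t) x (𝒢.delta x k)) g
  rw [h1, map_smul, lp.coeFn_smul, Pi.smul_apply, smul_eq_mul, regRep_delta, regRep_delta]
  change phase c t _ * f _ = _
  rw [← _root_.mul_assoc]
  congr 1
  rw [phase, phase, phase, ← Complex.exp_add, c.map_mul_inv (g.2.trans k.2.symm)]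
  congr 1
  push_cast
  ring

variable [T2Space G] [LocallyCompactSpace G]

theorem conj_mem (t : ℝ) (a : 𝒢.ReducedCStar) :
    unitaryFam c t * 𝒢.toFam a * unitaryFam c (-t) ∈ 𝒢.convAlg.topologicalClosure :=
  map_mem_closure (f := fun T => unitaryFam c t * T * unitaryFam c (-t)) (by fun_prop)
    (𝒢.toFam_mem a) (by rintro _ ⟨f, rfl⟩; exact ⟨twist c t f, regFam_twist c t f⟩)

/-- The automorphism `σ^c_t` of `C*_r(G)`, implemented in each representation `π_x` by the unitary
`u_t`; it is the continuous extension of the map `f ↦ e^{itc} f` of `C_c(G)`. -/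
def sigma (t : ℝ) : 𝒢.ReducedCStar ≃⋆ₐ[ℂ] 𝒢.ReducedCStar where
  toFun a := (⟨_, conj_mem c t a⟩ : 𝒢.convAlg.topologicalClosure)
  invFun a := (⟨_, conj_mem c (-t) a⟩ : 𝒢.convAlg.topologicalClosure)
  left_inv a := 𝒢.toFam_injective (conj_neg_conj c t (𝒢.toFam a))
  right_inv a := 𝒢.toFam_injective <| by
    have h := conj_neg_conj c (-t) (𝒢.toFam a)
    rw [neg_neg] at h
    change unitaryFam c t * (unitaryFam c (-t) * 𝒢.toFam a * unitaryFam c (- -t)) *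
      unitaryFam c (-t) = 𝒢.toFam a
    rwa [neg_neg]
  map_mul' a b := 𝒢.toFam_injective <| by
    change unitaryFam c t * (𝒢.toFam a * 𝒢.toFam b) * unitaryFam c (-t) =
      (unitaryFam c t * 𝒢.toFam a * unitaryFam c (-t)) *
        (unitaryFam c t * 𝒢.toFam b * unitaryFam c (-t))
    simp only [_root_.mul_assoc, unitaryFam_neg_mul]
  map_add' a b := 𝒢.toFam_injective <| by
    change unitaryFam c t * (𝒢.toFam a + 𝒢.toFam b) * unitaryFam c (-t) =
      unitaryFam c t * 𝒢.toFam a * unitaryFam c (-t) +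
        unitaryFam c t * 𝒢.toFam b * unitaryFam c (-t)
    rw [_root_.mul_add, _root_.add_mul]
  map_star' a := 𝒢.toFam_injective <| by
    change unitaryFam c t * star (𝒢.toFam a) * unitaryFam c (-t) =
      star (unitaryFam c t * 𝒢.toFam a * unitaryFam c (-t))
    rw [star_mul, star_mul, star_unitaryFam, star_unitaryFam, neg_neg, _root_.mul_assoc]
  map_smul' z a := 𝒢.toFam_injective <| by
    change unitaryFam c t * (z • 𝒢.toFam a) * unitaryFam c (-t) =
      z • (unitaryFam c t * 𝒢.toFam a * unitaryFam c (-t))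
    rw [mul_smul_comm, smul_mul_assoc]

theorem sigma_ofCc (t : ℝ) (f : C_c(G, ℂ)) : sigma c t (𝒢.ofCc f) = 𝒢.ofCc (twist c t f) :=
  𝒢.toFam_injective (regFam_twist c t f).symm

end Action

section Measures

variable {G X : Type*} [TopologicalSpace G] [TopologicalSpace X]

/-- The inverse `r_W⁻¹ : r(W) → W` of the restriction of `r` to a set `W` on which `r` is
injective (with the value `unit x` at points `x` outside `r(W)`). -/
def rInv (𝒢 : EtaleGroupoid G X) (W : Set G) (x : X) : G :=
  open Classical in if h : ∃ g ∈ W, 𝒢.r g = x then h.choose else 𝒢.unit x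

theorem rInv_apply (𝒢 : EtaleGroupoid G X) {W : Set G} (hW : Set.InjOn 𝒢.r W) {g : G}
    (hg : g ∈ W) : 𝒢.rInv W (𝒢.r g) = g := by
  have h : ∃ g' ∈ W, 𝒢.r g' = 𝒢.r g := ⟨g, hg, rfl⟩
  rw [rInv, dif_pos h]
  exact hW h.choose_spec.1 hg h.choose_spec.2

/-- A measure `m` on the unit space is `(G, c)`-conformal with exponent `β` when
`m(s(W)) = ∫_{r(W)} exp(β c(r_W⁻¹(x))) dm(x)` for every open bisection `W`, that is, for every
open `W ⊆ G` on which `r` and `s` are injective. Both sides may be infinite. -/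
def IsConformal {𝒢 : EtaleGroupoid G X} (c : 𝒢.RealHom) (β : ℝ) [MeasurableSpace X]
    (m : MeasureTheory.Measure X) : Prop :=
  ∀ W : Set G, IsOpen W → Set.InjOn 𝒢.r W → Set.InjOn 𝒢.s W →
    m (𝒢.s '' W) = ∫⁻ x in 𝒢.r '' W, ENNReal.ofReal (Real.exp (β * c (𝒢.rInv W x))) ∂m

/-- The weight `φ_m(a) = ∫ P(a) dm` on the positive elements of `C*_r(G)`. -/
def weightOf [T2Space G] [LocallyCompactSpace G] [MeasurableSpace X] (𝒢 : EtaleGroupoid G X)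
    (m : MeasureTheory.Measure X) (a : {a : 𝒢.ReducedCStar // 0 ≤ a}) : ℝ≥0∞ :=
  ∫⁻ x, ENNReal.ofReal (𝒢.condExp a x).re ∂m

end Measures

end EtaleGroupoid

section Weights

variable {A : Type*} [NonUnitalCStarAlgebra A] [PartialOrder A] [StarOrderedRing A]

/-- A proper weight on a C*-algebra: a non-zero, densely defined, lower semi-continuous weight
`ψ : A₊ → [0, ∞]`. -/
structure IsProperWeight (ψ : {a : A // 0 ≤ a} → ℝ≥0∞) : Prop where
  map_add : ∀ a b : {a : A // 0 ≤ a}, ψ ⟨a + b, add_nonneg a.2 b.2⟩ = ψ a + ψ b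
  map_smul : ∀ (r : ℝ) (hr : 0 < r) (a : {a : A // 0 ≤ a}),
    ψ ⟨r • (a : A), smul_nonneg hr.le a.2⟩ = ENNReal.ofReal r * ψ a
  nonzero : ∃ a, ψ a ≠ 0
  denselyDefined : Dense {a | ψ a < ∞}
  lowerSemicontinuous : ∀ r : ℝ, 0 ≤ r → IsClosed {a | ψ a ≤ ENNReal.ofReal r}

/-- The set `𝒩_ψ = {a ∈ A | ψ(a*a) < ∞}`. -/
def weightN (ψ : {a : A // 0 ≤ a} → ℝ≥0∞) : Set A :=
  {a | ψ ⟨star a * a, star_mul_self_nonneg a⟩ < ∞}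

/-- The linear span `𝒩_ψ* 𝒩_ψ` of the products `a*b` with `a, b ∈ 𝒩_ψ`. -/
def weightDomain (ψ : {a : A // 0 ≤ a} → ℝ≥0∞) : Submodule ℂ A :=
  Submodule.span ℂ {x | ∃ a ∈ weightN ψ, ∃ b ∈ weightN ψ, x = star a * b}

theorem mul_mem_weightDomain {ψ : {a : A // 0 ≤ a} → ℝ≥0∞} {a b : A} (ha : star a ∈ weightN ψ)
    (hb : b ∈ weightN ψ) : a * b ∈ weightDomain ψ :=
  Submodule.subset_span ⟨star a, ha, b, hb, by rw [star_star]⟩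

/-- Invariance of `ψ : A₊ → [0, ∞]` under all the automorphisms `α_t`. -/
def IsInvariantWeight (ψ : {a : A // 0 ≤ a} → ℝ≥0∞) (α : ℝ → A ≃⋆ₐ[ℂ] A) : Prop :=
  ∀ (t : ℝ) (a : {a : A // 0 ≤ a}), ψ ⟨α t a, map_nonneg (α t) a.2⟩ = ψ a

theorem IsInvariantWeight.apply_mem {ψ : {a : A // 0 ≤ a} → ℝ≥0∞} {α : ℝ → A ≃⋆ₐ[ℂ] A}
    (h : IsInvariantWeight ψ α) (t : ℝ) {b : A} (hb : b ∈ weightN ψ) : α t b ∈ weightN ψ := by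
  have h1 := h t ⟨star b * b, star_mul_self_nonneg b⟩
  simp only [map_mul, map_star] at h1
  exact (congrArg (· < ∞) h1).mpr hb

theorem IsInvariantWeight.star_apply_mem {ψ : {a : A // 0 ≤ a} → ℝ≥0∞} {α : ℝ → A ≃⋆ₐ[ℂ] A}
    (h : IsInvariantWeight ψ α) (t : ℝ) {b : A} (hb : star b ∈ weightN ψ) :
    star (α t b) ∈ weightN ψ := by
  rw [← map_star]
  exact h.apply_mem t hb

/-- `L` is the linear extension of `ψ` to `𝒩_ψ* 𝒩_ψ`: it is finite on and agrees with `ψ` at the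
positive elements of that space. -/
def IsWeightExtension (ψ : {a : A // 0 ≤ a} → ℝ≥0∞) (L : weightDomain ψ →ₗ[ℂ] ℂ) : Prop :=
  ∀ (x : weightDomain ψ) (hx : 0 ≤ (x : A)), ψ ⟨x, hx⟩ < ∞ ∧ L x = ((ψ ⟨x, hx⟩).toReal : ℂ)

/-- The closed strip of all `z ∈ ℂ` whose imaginary part lies between `0` and `β`. -/
def closedStrip (β : ℝ) : Set ℂ := {z | z.im ∈ Set.uIcc 0 β}

/-- `β`-KMS weights for a one-parameter group `α` of automorphisms of `A`: proper weights `ψ` that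
are `α`-invariant and such that for all `a, b ∈ 𝒩_ψ ∩ 𝒩_ψ*` there is a continuous bounded function
`F` on the closed strip between `0` and `iβ`, holomorphic in its interior, with
`F(t) = ψ(a α_t(b))` and `F(t + iβ) = ψ(α_t(b) a)` for all real `t`. Here `ψ` is extended linearly
to `𝒩_ψ* 𝒩_ψ`; this extension `L` exists and is unique for every proper weight. -/
structure IsKMSWeight (ψ : {a : A // 0 ≤ a} → ℝ≥0∞) (α : ℝ → A ≃⋆ₐ[ℂ] A) (β : ℝ) : Prop where
  proper : IsProperWeight ψ
  invariant : IsInvariantWeight ψ α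
  kms : ∃ L : weightDomain ψ →ₗ[ℂ] ℂ, IsWeightExtension ψ L ∧
    ∀ (a b : A) (ha : a ∈ weightN ψ) (ha' : star a ∈ weightN ψ) (hb : b ∈ weightN ψ)
      (hb' : star b ∈ weightN ψ),
      ∃ F : ℂ → ℂ, ContinuousOn F (closedStrip β) ∧ (∃ C : ℝ, ∀ z ∈ closedStrip β, ‖F z‖ ≤ C) ∧
        DifferentiableOn ℂ F (interior (closedStrip β)) ∧
        ∀ t : ℝ, F t = L ⟨a * α t b, mul_mem_weightDomain ha' (invariant.apply_mem t hb)⟩ ∧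
          F (t + Complex.I * β) =
            L ⟨α t b * a, mul_mem_weightDomain (invariant.star_apply_mem t hb') ha⟩

end Weights

end

/-!
A measure `m` on the unit space induces the measure `∫ ∑_{s(g) = x} δ_g dm(x)` on `G`, and `m`
is conformal exactly when the inversion carries this measure to its multiple by the density
`e^{-βc}`. In terms of matrix coefficients, `φ_m(a σ_t(b))` is the Fourier transform along `c`
of the function `conj(a*) · b` on `G`, and `φ_m(σ_t(b) a)` is the same integral after inversion.
Hence conformality allows a shift of `t` by `iβ`, which is the KMS condition; conversely, a
bounded holomorphic function on the strip is determined by its values on the real line, so the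
KMS condition forces the change of density, as the functions `conj(k) · k` with `k ∈ C_c(G)`
determine the measure.

Given a KMS weight `ψ`, the Riesz theorem yields `m` with `ψ = φ_m` on `C_c(X)`. As `ker c` is
open, `C_c(G)` splits into the functions supported in `ker c` and those supported where `c ≠ 0`.
The latter are killed by `ψ` since the averages of their orbits tend to `0`. A function with
support near a nonunit of `ker c` is killed too: by the isotropy condition its support has
disjoint range and source, so that `ψ(f) = ψ(p f) = ψ(f p) = 0` for a cutoff `p`. Thus `ψ = φ_m`
on `p C*_r(G) p`, and an approximate unit of elements `p` fixed by `σ` extends this to all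
positive elements, by lower semicontinuity and the estimate `ψ(p a p) ≤ ψ(a)`.
-/

noncomputable section

open Filter Topology MeasureTheory

section Strip

open Complex HadamardThreeLines

private lemma affine_im (β t : ℝ) (w : ℂ) : (t + I * β * w : ℂ).im = β * w.re := by simp

theorem mapsTo_affine_closedStrip (β t : ℝ) :
    Set.MapsTo (fun w : ℂ => t + I * β * w) (verticalClosedStrip 0 1) (closedStrip β) := by
  rintro w ⟨hw₀, hw₁⟩
  simp only [closedStrip, Set.mem_ofPred_eq, affine_im, Set.mem_uIcc]
  rcases le_total 0 β with hβ | hβ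
  · exact .inl ⟨by positivity, by nlinarith⟩
  · exact .inr ⟨by nlinarith, by nlinarith⟩

theorem mapsTo_affine_interior_closedStrip {β : ℝ} (hβ : β ≠ 0) (t : ℝ) :
    Set.MapsTo (fun w : ℂ => t + I * β * w) (verticalStrip 0 1) (interior (closedStrip β)) := by
  refine Set.MapsTo.mono_right (t₁ := {z : ℂ | z.im ∈ Set.Ioo (min 0 β) (max 0 β)}) ?_
    (interior_maximal (fun z hz => Set.Ioo_subset_Icc_self hz) (isOpen_Ioo.preimage continuous_im))
  rintro w ⟨hw₀, hw₁⟩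
  simp only [Set.mem_ofPred_eq, affine_im]
  rcases hβ.lt_or_gt with h | h
  · rw [min_eq_right h.le, max_eq_left h.le]
    exact ⟨by nlinarith, by nlinarith⟩
  · rw [min_eq_left h.le, max_eq_right h.le]
    exact ⟨by positivity, by nlinarith⟩

theorem closure_verticalStrip_zero_one : closure (verticalStrip 0 1) = verticalClosedStrip 0 1 := by
  rw [verticalClosedStrip, ← closure_Ioo zero_ne_one, ← closure_preimage_re]
  rfl

/- The three lines theorem with bound `0` on one edge gives `‖F‖ ≤ 0 ^ (1 - x) * C = 0` at real part
`x < 1`; the other edge is then reached by continuity. -/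
theorem eq_zero_of_re_eq_zero_eq_zero {F : ℂ → ℂ} {C : ℝ}
    (hF : DiffContOnCl ℂ F (verticalStrip 0 1)) (hC : ∀ z ∈ verticalClosedStrip 0 1, ‖F z‖ ≤ C)
    (h₀ : ∀ z : ℂ, z.re = 0 → F z = 0) : F 1 = 0 := by
  have hcont : ContinuousOn F (verticalClosedStrip 0 1) :=
    closure_verticalStrip_zero_one ▸ hF.continuousOn
  have hzero (x : ℝ) (hx : x ∈ Set.Ico (0 : ℝ) 1) : F x = 0 := by
    have h := norm_le_interp_of_mem_verticalClosedStrip₀₁' F (a := 0) (b := C) (z := x)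
      ⟨by simpa using hx.1, by simpa using hx.2.le⟩ hF
      ⟨C, by rintro _ ⟨w, hw, rfl⟩; exact hC w hw⟩
      (fun w hw => by rw [h₀ w hw, norm_zero])
      (fun w hw => hC w ⟨by simp [show w.re = 1 from hw], le_of_eq hw⟩)
    rw [ofReal_re, Real.zero_rpow (by linarith [hx.2]), zero_mul] at h
    exact norm_le_zero_iff.1 h
  have hreal : ContinuousOn (fun x : ℝ => F x) (Set.Icc 0 1) :=
    hcont.comp continuous_ofReal.continuousOn fun x hx => ⟨by simpa using hx.1, by simpa using hx.2⟩
  have hlim : Tendsto (fun x : ℝ => F x) (𝓝[Set.Ico 0 1] 1) (𝓝 (F (1 : ℝ))) :=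
    (hreal 1 (by simp)).mono Set.Ico_subset_Icc_self
  have : (𝓝[Set.Ico 0 1] (1 : ℝ)).NeBot := by
    rw [← mem_closure_iff_nhdsWithin_neBot, closure_Ico zero_ne_one]
    simp
  rw [← ofReal_one]
  exact tendsto_nhds_unique hlim (tendsto_const_nhds.congr' <| by
    filter_upwards [self_mem_nhdsWithin] with x hx using (hzero x hx).symm)

theorem eq_zero_on_edge_of_eq_zero_on_real {β : ℝ} {F : ℂ → ℂ}
    (hc : ContinuousOn F (closedStrip β)) (hb : ∃ C : ℝ, ∀ z ∈ closedStrip β, ‖F z‖ ≤ C)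
    (hd : DifferentiableOn ℂ F (interior (closedStrip β))) (h₀ : ∀ t : ℝ, F t = 0) (t : ℝ) :
    F (t + I * β) = 0 := by
  rcases eq_or_ne β 0 with rfl | hβ
  · simpa using h₀ t
  obtain ⟨C, hC⟩ := hb
  have hmaps := mapsTo_affine_closedStrip β t
  simpa using eq_zero_of_re_eq_zero_eq_zero (F := fun w => F (t + I * β * w)) (C := C)
    ⟨hd.comp (by fun_prop) (mapsTo_affine_interior_closedStrip hβ t), by
      rw [closure_verticalStrip_zero_one]
      exact hc.comp (by fun_prop) hmaps⟩
    (fun z hz => hC _ (hmaps hz))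
    (fun z hz => by
      rw [← h₀ (t - β * z.im)]
      congr 1
      apply Complex.ext <;> simp [hz, sub_eq_add_neg])

end Strip

section PosExt

variable {A : Type*} [NonUnitalCStarAlgebra A] [PartialOrder A] {ψ : {a : A // 0 ≤ a} → ℝ≥0∞}

open Classical in
/-- The extension of a weight to the whole algebra by the value `∞` off the positive cone, which
lets one write the value of the weight at an element without carrying a proof of positivity. -/
def posExt (ψ : {a : A // 0 ≤ a} → ℝ≥0∞) (a : A) : ℝ≥0∞ :=
  if h : 0 ≤ a then ψ ⟨a, h⟩ else ∞

theorem posExt_of_nonneg {a : A} (h : 0 ≤ a) : posExt ψ a = ψ ⟨a, h⟩ := dif_pos h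

theorem nonneg_of_posExt_lt {a : A} (h : posExt ψ a < ∞) : 0 ≤ a := by
  by_contra ha
  exact h.ne (dif_neg ha)

end PosExt

theorem star_smul_mul_smul {A : Type*} [NonUnitalCStarAlgebra A] (z : ℂ) (a : A) :
    star (z • a) * (z • a) = (‖z‖ ^ 2 : ℝ) • (star a * a) := by
  rw [star_smul, smul_mul_assoc, mul_smul_comm, smul_smul, ← Complex.coe_smul, Complex.ofReal_pow,
    ← Complex.conj_mul', Complex.star_def]

/- Expanding, the sum is `∑ k, (-i)^k (a*a + b*b) + i^k (-i)^k a*b + (-i)^(2k) b*a`, and the sums of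
`(-i)^k` and `(-i)^(2k)` over a period vanish. -/
theorem polarization {A : Type*} [NonUnitalCStarAlgebra A] (a b : A) :
    (4 : ℂ) • (star a * b) = ∑ k ∈ Finset.range 4,
      (-Complex.I) ^ k • (star (a + Complex.I ^ k • b) * (a + Complex.I ^ k • b)) := by
  simp only [Finset.sum_range_succ, Finset.sum_range_zero, star_add, star_smul, mul_add, add_mul,
    smul_mul_assoc, mul_smul_comm, smul_smul, smul_add]
  match_scalars <;> simp [pow_succ]
  ring

section Weights

variable {A : Type*} [NonUnitalCStarAlgebra A] [PartialOrder A] [StarOrderedRing A]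
  {ψ : {a : A // 0 ≤ a} → ℝ≥0∞}

theorem star_mul_self_mul_le (a b : A) :
    star (a * b) * (a * b) ≤ ‖star a * a‖ • (star b * b) := by
  simpa [mul_assoc] using CStarAlgebra.star_left_conjugate_le_norm_smul (a := b) (b := star a * a)
    (IsSelfAdjoint.star_mul_self a)

theorem star_add_mul_add_le (a b : A) :
    star (a + b) * (a + b) ≤ (2 : ℝ) • (star a * a + star b * b) := by
  rw [← sub_nonneg]
  convert star_mul_self_nonneg (a - b) using 1
  simp only [star_add, star_sub, mul_add, add_mul, mul_sub, sub_mul, two_smul]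
  abel

theorem mem_weightN {a : A} : a ∈ weightN ψ ↔ posExt ψ (star a * a) < ∞ := by
  rw [posExt_of_nonneg (star_mul_self_nonneg a)]
  rfl

theorem mem_weightDomain_of_posExt_lt {a : A} (ha : posExt ψ a < ∞) : a ∈ weightDomain ψ := by
  obtain ⟨b, rfl⟩ := CStarAlgebra.nonneg_iff_eq_star_mul_self.1 (nonneg_of_posExt_lt ha)
  exact Submodule.subset_span ⟨b, mem_weightN.2 ha, b, mem_weightN.2 ha, rfl⟩

namespace IsProperWeight

variable (hψ : IsProperWeight ψ)
include hψ

theorem posExt_add {a b : A} (ha : 0 ≤ a) (hb : 0 ≤ b) :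
    posExt ψ (a + b) = posExt ψ a + posExt ψ b := by
  rw [posExt_of_nonneg ha, posExt_of_nonneg hb, posExt_of_nonneg (add_nonneg ha hb)]
  exact hψ.map_add ⟨a, ha⟩ ⟨b, hb⟩

theorem posExt_smul_of_pos {r : ℝ} (hr : 0 < r) {a : A} (ha : 0 ≤ a) :
    posExt ψ (r • a) = ENNReal.ofReal r * posExt ψ a := by
  rw [posExt_of_nonneg ha, posExt_of_nonneg (smul_nonneg hr.le ha)]
  exact hψ.map_smul r hr ⟨a, ha⟩

theorem posExt_zero : posExt ψ 0 = 0 := by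
  have : Nonempty {a : A // 0 ≤ a} := ⟨⟨0, le_rfl⟩⟩
  obtain ⟨⟨a, ha⟩, hfin⟩ := hψ.denselyDefined.nonempty
  have h := hψ.posExt_add ha le_rfl
  rw [add_zero, posExt_of_nonneg ha] at h
  exact ((ENNReal.add_right_inj (ne_of_lt hfin)).1 (by rw [← h, add_zero]))

theorem posExt_smul {r : ℝ} (hr : 0 ≤ r) {a : A} (ha : 0 ≤ a) :
    posExt ψ (r • a) = ENNReal.ofReal r * posExt ψ a := by
  rcases hr.eq_or_lt with rfl | hr
  · rw [zero_smul, hψ.posExt_zero, ENNReal.ofReal_zero, zero_mul]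
  · exact hψ.posExt_smul_of_pos hr ha

theorem posExt_smul_lt {r : ℝ} (hr : 0 ≤ r) {a : A} (ha : posExt ψ a < ∞) :
    posExt ψ (r • a) < ∞ := by
  rw [hψ.posExt_smul hr (nonneg_of_posExt_lt ha)]
  exact ENNReal.mul_lt_top ENNReal.ofReal_lt_top ha

theorem posExt_sum {ι : Type*} (s : Finset ι) {f : ι → A} (hf : ∀ i ∈ s, 0 ≤ f i) :
    posExt ψ (∑ i ∈ s, f i) = ∑ i ∈ s, posExt ψ (f i) := by
  classical
  induction s using Finset.induction_on with
  | empty => exact hψ.posExt_zero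
  | insert i s his ih =>
    rw [Finset.forall_mem_insert] at hf
    rw [Finset.sum_insert his, Finset.sum_insert his,
      hψ.posExt_add hf.1 (Finset.sum_nonneg hf.2), ih hf.2]

theorem posExt_mono {a b : A} (ha : 0 ≤ a) (hab : a ≤ b) : posExt ψ a ≤ posExt ψ b := by
  rw [← add_sub_cancel a b, hψ.posExt_add ha (sub_nonneg.2 hab)]
  exact le_self_add

theorem isClosed_posExt_le {r : ℝ≥0∞} (hr : r ≠ ∞) : IsClosed {a : A | posExt ψ a ≤ r} := by
  have hsub := hψ.lowerSemicontinuous r.toReal ENNReal.toReal_nonneg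
  rw [ENNReal.ofReal_toReal hr] at hsub
  convert (CStarAlgebra.isClosed_nonneg (A := A)).isClosedEmbedding_subtypeVal.isClosedMap _ hsub
  ext a
  constructor
  · intro (h : posExt ψ a ≤ r)
    have ha := nonneg_of_posExt_lt (h.trans_lt hr.lt_top)
    exact ⟨⟨a, ha⟩, by rwa [posExt_of_nonneg ha] at h, rfl⟩
  · rintro ⟨⟨a, ha⟩, h, rfl⟩
    exact (posExt_of_nonneg ha).trans_le h

theorem posExt_le_of_tendsto {u : ℕ → A} {a : A} (hu : Tendsto u atTop (𝓝 a))
    {r : ℝ≥0∞} (h : ∀ n, posExt ψ (u n) ≤ r) : posExt ψ a ≤ r := by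
  rcases eq_or_ne r ∞ with rfl | hr
  · exact le_top
  · exact (hψ.isClosed_posExt_le hr).mem_of_tendsto hu (.of_forall h)

theorem posExt_star_mul_mul_le (a b : A) :
    posExt ψ (star (a * b) * (a * b)) ≤ ENNReal.ofReal ‖star a * a‖ * posExt ψ (star b * b) :=
  (hψ.posExt_mono (star_mul_self_nonneg _) (star_mul_self_mul_le a b)).trans_eq
    (hψ.posExt_smul (norm_nonneg _) (star_mul_self_nonneg b))

theorem mul_mem_weightN (a : A) {b : A} (hb : b ∈ weightN ψ) : a * b ∈ weightN ψ :=
  mem_weightN.2 <| (hψ.posExt_star_mul_mul_le a b).trans_lt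
    (ENNReal.mul_lt_top ENNReal.ofReal_lt_top (mem_weightN.1 hb))

theorem posExt_star_add_mul_add_le (a b : A) : posExt ψ (star (a + b) * (a + b)) ≤
    2 * (posExt ψ (star a * a) + posExt ψ (star b * b)) := by
  have ha := star_mul_self_nonneg a
  have hb := star_mul_self_nonneg b
  refine (hψ.posExt_mono (star_mul_self_nonneg _) (star_add_mul_add_le a b)).trans_eq ?_
  rw [hψ.posExt_smul two_pos.le (add_nonneg ha hb), hψ.posExt_add ha hb, ENNReal.ofReal_ofNat]

theorem add_mem_weightN {a b : A} (ha : a ∈ weightN ψ) (hb : b ∈ weightN ψ) :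
    a + b ∈ weightN ψ :=
  mem_weightN.2 <| (hψ.posExt_star_add_mul_add_le a b).trans_lt <|
    ENNReal.mul_lt_top (by simp) (ENNReal.add_lt_top.2 ⟨mem_weightN.1 ha, mem_weightN.1 hb⟩)

theorem smul_mem_weightN (z : ℂ) {a : A} (ha : a ∈ weightN ψ) : z • a ∈ weightN ψ := by
  rw [mem_weightN, star_smul_mul_smul]
  exact hψ.posExt_smul_lt (by positivity) (mem_weightN.1 ha)

theorem sub_mem_weightN {a b : A} (ha : a ∈ weightN ψ) (hb : b ∈ weightN ψ) :
    a - b ∈ weightN ψ := by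
  have := hψ.add_mem_weightN ha (hψ.smul_mem_weightN (-1) hb)
  rwa [neg_one_smul, ← sub_eq_add_neg] at this

theorem mem_weightN_of_posExt_lt {a : A} (ha : posExt ψ a < ∞) : a ∈ weightN ψ := by
  obtain ⟨b, rfl⟩ := CStarAlgebra.nonneg_iff_eq_star_mul_self.1 (nonneg_of_posExt_lt ha)
  exact hψ.mul_mem_weightN _ (mem_weightN.2 ha)

theorem weightDomain_eq_span : weightDomain ψ = Submodule.span ℂ {x | posExt ψ x < ∞} := by
  refine le_antisymm (Submodule.span_le.2 ?_)
    (Submodule.span_le.2 fun x hx => mem_weightDomain_of_posExt_lt hx)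
  rintro _ ⟨a, ha, b, hb, rfl⟩
  rw [← inv_smul_smul₀ (by norm_num : (4 : ℂ) ≠ 0) (star a * b), polarization,
    SetLike.mem_coe]
  exact Submodule.smul_mem _ _ <| Submodule.sum_mem _ fun k _ => Submodule.smul_mem _ _ <|
    Submodule.subset_span <| mem_weightN.1 <|
      hψ.add_mem_weightN ha (hψ.smul_mem_weightN _ hb)

end IsProperWeight

/-- A linear functional on the whole algebra that agrees with `ψ` at the positive elements of finite
weight, hence with the canonical extension of `ψ` on `𝒩_ψ* 𝒩_ψ`. Its values off that subspace carry
no information; being total, it needs no proofs of membership. -/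
def IsWeightFunctional (ψ : {a : A // 0 ≤ a} → ℝ≥0∞) (Λ : A →ₗ[ℂ] ℂ) : Prop :=
  ∀ x, posExt ψ x < ∞ → Λ x = ((posExt ψ x).toReal : ℂ)

namespace IsWeightFunctional

variable {Λ : A →ₗ[ℂ] ℂ} (hΛ : IsWeightFunctional ψ Λ) (hψ : IsProperWeight ψ)
include hΛ hψ

theorem norm_apply_star_mul_le {a b : A} (ha : a ∈ weightN ψ) (hb : b ∈ weightN ψ) :
    ‖Λ (star a * b)‖ ≤
      2 * ((posExt ψ (star a * a)).toReal + (posExt ψ (star b * b)).toReal) := by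
  have ha' := mem_weightN.1 ha
  have hb' := mem_weightN.1 hb
  set M := 2 * ((posExt ψ (star a * a)).toReal + (posExt ψ (star b * b)).toReal)
  have hterm (k : ℕ) : ‖Λ ((-Complex.I) ^ k •
      (star (a + Complex.I ^ k • b) * (a + Complex.I ^ k • b)))‖ ≤ M := by
    have hle := hψ.posExt_star_add_mul_add_le a (Complex.I ^ k • b)
    rw [star_smul_mul_smul, norm_pow, Complex.norm_I, one_pow, one_pow, one_smul] at hle
    have hfin := ENNReal.mul_lt_top (a := 2) (by simp) (ENNReal.add_lt_top.2 ⟨ha', hb'⟩)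
    rw [map_smul, norm_smul, norm_pow, norm_neg, Complex.norm_I, one_pow, one_mul,
      hΛ _ (hle.trans_lt hfin), Complex.norm_real, Real.norm_of_nonneg ENNReal.toReal_nonneg]
    refine (ENNReal.toReal_mono hfin.ne hle).trans_eq ?_
    rw [ENNReal.toReal_mul, ENNReal.toReal_add ha'.ne hb'.ne, ENNReal.toReal_ofNat]
  have hsum := norm_sum_le_of_le (Finset.range 4) fun k _ => hterm k
  rw [← map_sum, ← polarization, map_smul, norm_smul, Finset.sum_const, Finset.card_range,
    nsmul_eq_mul] at hsum
  norm_num at hsum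
  linarith

theorem continuous_apply_mul_mul {a b : A} (ha : star a ∈ weightN ψ) (hb : b ∈ weightN ψ) :
    Continuous fun x => Λ (a * x * b) := by
  let L : A →ₗ[ℂ] ℂ := Λ ∘ₗ LinearMap.mulRight ℂ b ∘ₗ LinearMap.mulLeft ℂ a
  have hbound (x : A) (hx : x ∈ Metric.ball (0 : A) 1) : ‖L x‖ ≤
      2 * ((posExt ψ (star (star a) * star a)).toReal + (posExt ψ (star b * b)).toReal) := by
    have hx' : ‖star x * x‖ ≤ 1 := by
      rw [CStarRing.norm_star_mul_self]
      exact mul_le_one₀ (mem_ball_zero_iff.1 hx).le (norm_nonneg _) (mem_ball_zero_iff.1 hx).le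
    have hxb : posExt ψ (star (x * b) * (x * b)) ≤ posExt ψ (star b * b) :=
      (hψ.posExt_star_mul_mul_le x b).trans (mul_le_of_le_one_left' (ENNReal.ofReal_le_one.2 hx'))
    have h := hΛ.norm_apply_star_mul_le hψ ha (hψ.mul_mem_weightN x hb)
    rw [star_star, ← mul_assoc] at h
    refine h.trans ?_
    rw [star_star]
    gcongr
    exact (mem_weightN.1 hb).ne
  obtain ⟨C, hC⟩ := LinearMap.bound_of_ball_bound one_pos _ L hbound
  exact AddMonoidHomClass.continuous_of_bound L C hC

end IsWeightFunctional

section KMS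

variable {α : ℝ → A ≃⋆ₐ[ℂ] A} {β : ℝ} {Λ : A →ₗ[ℂ] ℂ}

theorem IsInvariantWeight.posExt_apply (h : IsInvariantWeight ψ α) (t : ℝ) {a : A} (ha : 0 ≤ a) :
    posExt ψ (α t a) = posExt ψ a := by
  rw [posExt_of_nonneg ha, posExt_of_nonneg (map_nonneg (α t) ha)]
  exact h t ⟨a, ha⟩

theorem IsWeightFunctional.apply_invariant (hΛ : IsWeightFunctional ψ Λ) (hψ : IsProperWeight ψ)
    (h : IsInvariantWeight ψ α) (t : ℝ) {x : A} (hx : x ∈ weightDomain ψ) :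
    Λ (α t x) = Λ x := by
  rw [hψ.weightDomain_eq_span] at hx
  induction hx using Submodule.span_induction with
  | mem x hx =>
    have hinv := h.posExt_apply t (nonneg_of_posExt_lt hx)
    rw [hΛ _ (hinv.trans_lt hx), hΛ x hx, hinv]
  | zero => rw [map_zero]
  | add x y _ _ hx hy => rw [map_add, map_add, map_add, hx, hy]
  | smul z x _ hx => rw [map_smul, map_smul, map_smul, hx]

/-- A functional on the whole algebra that extends the proper weight `ψ` and satisfies the KMS
condition; `ψ` has one precisely when it is a KMS weight. -/
structure IsKMSFunctional (ψ : {a : A // 0 ≤ a} → ℝ≥0∞) (α : ℝ → A ≃⋆ₐ[ℂ] A) (β : ℝ)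
    (Λ : A →ₗ[ℂ] ℂ) : Prop where
  isWeightFunctional : IsWeightFunctional ψ Λ
  proper : IsProperWeight ψ
  invariant : IsInvariantWeight ψ α
  kms : ∀ a b : A, a ∈ weightN ψ → star a ∈ weightN ψ → b ∈ weightN ψ → star b ∈ weightN ψ →
    ∃ F : ℂ → ℂ, ContinuousOn F (closedStrip β) ∧ (∃ C : ℝ, ∀ z ∈ closedStrip β, ‖F z‖ ≤ C) ∧
      DifferentiableOn ℂ F (interior (closedStrip β)) ∧
      ∀ t : ℝ, F t = Λ (a * α t b) ∧ F (t + Complex.I * β) = Λ (α t b * a)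

theorem IsKMSWeight.exists_functional (h : IsKMSWeight ψ α β) : ∃ Λ, IsKMSFunctional ψ α β Λ := by
  obtain ⟨L, hL, hkms⟩ := h.kms
  obtain ⟨Λ, hΛ⟩ := LinearMap.exists_extend L
  replace hΛ (x : weightDomain ψ) : Λ x = L x := congrArg (fun f => f x) hΛ
  refine ⟨Λ, fun x hx => ?_, h.proper, h.invariant, fun a b ha ha' hb hb' => ?_⟩
  · have hx₀ := nonneg_of_posExt_lt hx
    rw [posExt_of_nonneg hx₀, ← (hL ⟨x, mem_weightDomain_of_posExt_lt hx⟩ hx₀).2, ← hΛ]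
  · obtain ⟨F, hcont, hbdd, hdiff, hF⟩ := hkms a b ha ha' hb hb'
    refine ⟨F, hcont, hbdd, hdiff, fun t => ?_⟩
    rw [(hF t).1, (hF t).2, ← hΛ, ← hΛ]
    exact ⟨rfl, rfl⟩

theorem IsKMSFunctional.apply_mul_comm (h : IsKMSFunctional ψ α β Λ) {a b : A}
    (ha : a ∈ weightN ψ) (ha' : star a ∈ weightN ψ) (hb : b ∈ weightN ψ) (hb' : star b ∈ weightN ψ)
    (hfix : ∀ t, α t b = b) : Λ (a * b) = Λ (b * a) := by
  obtain ⟨F, hcont, ⟨C, hC⟩, hdiff, hF⟩ := h.kms a b ha ha' hb hb'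
  simp only [hfix] at hF
  have hedge := eq_zero_on_edge_of_eq_zero_on_real (F := fun z => F z - Λ (a * b))
    (hcont.sub continuousOn_const)
    ⟨C + ‖Λ (a * b)‖, fun z hz => (norm_sub_le _ _).trans (by gcongr; exact hC z hz)⟩
    (hdiff.sub (differentiableOn_const _)) (fun t => by simp [(hF t).1]) 0
  simp only [(hF 0).2] at hedge
  exact (sub_eq_zero.1 hedge).symm

end KMS

end Weights

section OrbitAverage

variable {A : Type*} [NonUnitalCStarAlgebra A] {α : ℝ → A ≃⋆ₐ[ℂ] A}

/-- The average of an orbit over the points `j / (n + 1)`, `j < (n + 1)²`; both the length of the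
interval covered and the density of the points grow with `n`. -/
def orbitAvg (α : ℝ → A ≃⋆ₐ[ℂ] A) (n : ℕ) (a : A) : A :=
  ((n + 1 : ℝ) ^ 2)⁻¹ • ∑ j ∈ Finset.range ((n + 1) ^ 2), α (j / (n + 1)) a

/-- Mean ergodicity of a family of automorphisms, with respect to the averages `orbitAvg`. -/
def IsMeanErgodic (α : ℝ → A ≃⋆ₐ[ℂ] A) : Prop :=
  ∀ a, ∃ e, Tendsto (orbitAvg α · a) atTop (𝓝 e) ∧ ∀ t, α t e = e

theorem orbitAvg_sub (n : ℕ) (a b : A) :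
    orbitAvg α n (a - b) = orbitAvg α n a - orbitAvg α n b := by
  simp only [orbitAvg, map_sub, Finset.sum_sub_distrib, smul_sub]

theorem inv_smul_sum_const (n : ℕ) {E : Type*} [AddCommGroup E] [Module ℝ E] (a : E) :
    ((n + 1 : ℝ) ^ 2)⁻¹ • ∑ _j ∈ Finset.range ((n + 1) ^ 2), a = a := by
  rw [Finset.sum_const, Finset.card_range, ← Nat.cast_smul_eq_nsmul ℝ, smul_smul, Nat.cast_pow,
    Nat.cast_succ, inv_mul_cancel₀ (by positivity), one_smul]

theorem orbitAvg_eq_self (n : ℕ) {a : A} (ha : ∀ t, α t a = a) : orbitAvg α n a = a := by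
  simp only [orbitAvg, ha, inv_smul_sum_const]

theorem norm_orbitAvg_le (n : ℕ) (a : A) : ‖orbitAvg α n a‖ ≤ ‖a‖ := by
  have hsum := norm_sum_le (Finset.range ((n + 1) ^ 2)) fun j => α (j / (n + 1)) a
  simp only [StarAlgEquiv.norm_map] at hsum
  rw [orbitAvg, norm_smul, Real.norm_of_nonneg (by positivity)]
  refine (mul_le_mul_of_nonneg_left hsum (by positivity)).trans_eq ?_
  exact inv_smul_sum_const n ‖a‖

theorem norm_orbitAvg_sub_le (n : ℕ) (a b : A) :
    ‖orbitAvg α n a - orbitAvg α n b‖ ≤ ‖a - b‖ := by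
  rw [← orbitAvg_sub]
  exact norm_orbitAvg_le n _

theorem orbitAvg_mul_mul {p q : A} (hp : ∀ t, α t p = p) (hq : ∀ t, α t q = q) (n : ℕ) (a : A) :
    orbitAvg α n (p * a * q) = p * orbitAvg α n a * q := by
  simp only [orbitAvg, map_mul, hp, hq, mul_smul_comm, smul_mul_assoc, Finset.mul_sum,
    Finset.sum_mul]

/- The averaging operators are uniformly Lipschitz, so limits in `a` and in `n` may be interchanged.
-/
theorem isMeanErgodic_of_dense {s : Set A} (hs : Dense s)
    (h : ∀ a ∈ s, ∃ e, Tendsto (orbitAvg α · a) atTop (𝓝 e) ∧ ∀ t, α t e = e) :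
    IsMeanErgodic α := by
  intro a
  obtain ⟨u, hus, hu⟩ := mem_closure_iff_seq_limit.1 (hs a)
  choose e he hfix using fun k => h (u k) (hus k)
  have hdist (k l : ℕ) : dist (e k) (e l) ≤ dist (u k) (u l) := by
    rw [dist_eq_norm, dist_eq_norm]
    exact le_of_tendsto ((he k).sub (he l)).norm (.of_forall fun n => norm_orbitAvg_sub_le n _ _)
  have hcauchy : CauchySeq e := by
    rw [Metric.cauchySeq_iff]
    intro ε hε
    obtain ⟨N, hN⟩ := Metric.cauchySeq_iff.1 hu.cauchySeq ε hε
    exact ⟨N, fun k hk l hl => (hdist k l).trans_lt (hN k hk l hl)⟩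
  obtain ⟨b, hb⟩ := cauchySeq_tendsto_of_complete hcauchy
  have hunif : TendstoUniformly (fun k n => orbitAvg α n (u k)) (orbitAvg α · a) atTop := by
    rw [Metric.tendstoUniformly_iff]
    intro ε hε
    filter_upwards [Metric.tendsto_nhds.1 hu ε hε] with k hk n
    rw [dist_comm, dist_eq_norm] at hk
    rw [dist_eq_norm]
    exact (norm_orbitAvg_sub_le n _ _).trans_lt hk
  refine ⟨b, hunif.tendsto_of_eventually_tendsto (.of_forall he) hb, fun t => ?_⟩
  have himage := ((StarAlgEquiv.isometry (α t)).continuous.tendsto b).comp hb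
  exact tendsto_nhds_unique (himage.congr fun k => hfix k t) hb

end OrbitAverage

section FixedElements

variable {A : Type*} [NonUnitalCStarAlgebra A] [PartialOrder A] [StarOrderedRing A]
  {ψ : {a : A // 0 ≤ a} → ℝ≥0∞} {α : ℝ → A ≃⋆ₐ[ℂ] A} {β : ℝ} {Λ : A →ₗ[ℂ] ℂ}

/- With `a = u * a + (e - u) * a`, the second summand contributes at most `(1/2) a*a`. -/
theorem star_mul_self_le_of_norm_sub_le {e u a : A} (ha : e * a = a) (hu : ‖e - u‖ ≤ 1 / 2) :
    star a * a ≤ (4 : ℝ) • (star (u * a) * (u * a)) := by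
  have hsplit : u * a + (e - u) * a = a := by rw [sub_mul, ha, add_sub_cancel]
  have hsmall : star ((e - u) * a) * ((e - u) * a) ≤ (1 / 4 : ℝ) • (star a * a) := by
    refine (star_mul_self_mul_le (e - u) a).trans
      (smul_le_smul_of_nonneg_right ?_ (star_mul_self_nonneg a))
    rw [CStarRing.norm_star_mul_self]
    nlinarith [norm_nonneg (e - u)]
  have hle : star a * a ≤ (2 : ℝ) • (star (u * a) * (u * a)) + (1 / 2 : ℝ) • (star a * a) := by
    calc star a * a = star (u * a + (e - u) * a) * (u * a + (e - u) * a) := by rw [hsplit]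
      _ ≤ (2 : ℝ) • (star (u * a) * (u * a) + star ((e - u) * a) * ((e - u) * a)) :=
        star_add_mul_add_le _ _
      _ ≤ (2 : ℝ) • (star (u * a) * (u * a) + (1 / 4 : ℝ) • (star a * a)) := by gcongr
      _ = _ := by rw [smul_add, smul_smul]; norm_num
  rw [← sub_nonneg] at hle ⊢
  convert smul_nonneg (zero_le_two (α := ℝ)) hle using 1
  match_scalars <;> norm_num

namespace IsProperWeight

variable (hψ : IsProperWeight ψ)
include hψ

theorem posExt_mul_mul_lt {p a : A} (hp : IsSelfAdjoint p) (hpN : p ∈ weightN ψ) (ha : 0 ≤ a) :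
    posExt ψ (p * a * p) < ∞ := by
  obtain ⟨b, rfl⟩ := CStarAlgebra.nonneg_iff_eq_star_mul_self.1 ha
  have h := mem_weightN.1 (hψ.mul_mem_weightN b hpN)
  rw [star_mul, hp.star_eq] at h
  simpa only [mul_assoc] using h

theorem posExt_orbitAvg (hinv : IsInvariantWeight ψ α) (n : ℕ) {a : A} (ha : 0 ≤ a) :
    posExt ψ (orbitAvg α n a) = posExt ψ a := by
  have hα (t : ℝ) : 0 ≤ α t a := map_nonneg (α t) ha
  rw [orbitAvg, hψ.posExt_smul (by positivity) (Finset.sum_nonneg fun j _ => hα _),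
    hψ.posExt_sum _ fun j _ => hα _]
  simp only [hinv.posExt_apply _ ha, Finset.sum_const, Finset.card_range, nsmul_eq_mul]
  rw [← mul_assoc, ← ENNReal.ofReal_natCast, ← ENNReal.ofReal_mul (by positivity), Nat.cast_pow,
    Nat.cast_succ, inv_mul_cancel₀ (by positivity), ENNReal.ofReal_one, one_mul]

theorem exists_tendsto_fixed_of_fixed (hinv : IsInvariantWeight ψ α) (hα : IsMeanErgodic α) {e : A}
    (he : 0 ≤ e) (hfix : ∀ t, α t e = e) :
    ∃ u : ℕ → A, (∀ n t, α t (u n) = u n) ∧ (∀ n, posExt ψ (u n) < ∞) ∧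
      Tendsto u atTop (𝓝 e) := by
  suffices e ∈ closure {u | (∀ t, α t u = u) ∧ posExt ψ u < ∞} by
    obtain ⟨u, hu, hlim⟩ := mem_closure_iff_seq_limit.1 this
    exact ⟨u, fun n => (hu n).1, fun n => (hu n).2, hlim⟩
  rw [Metric.mem_closure_iff]
  intro ε hε
  obtain ⟨⟨a, ha⟩, hafin, hae⟩ := Metric.mem_closure_iff.1 (hψ.denselyDefined ⟨e, he⟩) ε hε
  obtain ⟨u, hu, hufix⟩ := hα a
  have hfin : posExt ψ u ≤ posExt ψ a :=
    hψ.posExt_le_of_tendsto hu fun n => (hψ.posExt_orbitAvg hinv n ha).le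
  refine ⟨u, ⟨hufix, hfin.trans_lt ((posExt_of_nonneg ha).trans_lt hafin)⟩, lt_of_le_of_lt ?_ hae⟩
  refine le_of_tendsto (tendsto_const_nhds.dist hu) (.of_forall fun n => ?_)
  rw [Subtype.dist_eq, dist_eq_norm, dist_eq_norm]
  simpa only [orbitAvg_eq_self n hfix] using norm_orbitAvg_sub_le (α := α) n e a

end IsProperWeight

namespace IsKMSFunctional

variable (h : IsKMSFunctional ψ α β Λ)
include h

theorem posExt_mul_star_of_fixed {x : A} (hx : x ∈ weightN ψ) (hx' : star x ∈ weightN ψ)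
    (hfix : ∀ t, α t x = x) : posExt ψ (x * star x) = posExt ψ (star x * x) := by
  have hfin := mem_weightN.1 hx
  have hfin' := mem_weightN.1 hx'
  rw [star_star] at hfin'
  have hcomm := h.apply_mul_comm hx' (by rwa [star_star]) hx hx' hfix
  rw [h.isWeightFunctional _ hfin, h.isWeightFunctional _ hfin'] at hcomm
  exact ((ENNReal.toReal_eq_toReal_iff' hfin.ne hfin'.ne).1 (by exact_mod_cast hcomm)).symm

theorem star_mem_weightN_of_fixed {u : ℕ → A} {e x : A} (hufix : ∀ n t, α t (u n) = u n)
    (hufin : ∀ n, posExt ψ (u n) < ∞) (hu : Tendsto u atTop (𝓝 e)) (hx : x ∈ weightN ψ)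
    (hxfix : ∀ t, α t x = x) (hex : e * x = x) : star x ∈ weightN ψ := by
  have hψ := h.proper
  obtain ⟨C, hC⟩ := (hu.star.mul hu).norm.bddAbove_range
  have hbound (n : ℕ) : posExt ψ (u n * x * star (u n * x)) ≤
      ENNReal.ofReal C * posExt ψ (star x * x) := by
    have hus := (IsSelfAdjoint.of_nonneg (nonneg_of_posExt_lt (hufin n))).star_eq
    have hstar : star (u n * x) ∈ weightN ψ := by
      rw [star_mul, hus]
      exact hψ.mul_mem_weightN _ (hψ.mem_weightN_of_posExt_lt (hufin n))
    rw [h.posExt_mul_star_of_fixed (hψ.mul_mem_weightN _ hx) hstar fun t => by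
      rw [map_mul, hufix, hxfix]]
    exact (hψ.posExt_star_mul_mul_le _ _).trans (by gcongr; exact hC ⟨n, rfl⟩)
  have hlim := (hu.mul_const x).mul (hu.mul_const x).star
  rw [hex] at hlim
  rw [mem_weightN, star_star]
  exact (hψ.posExt_le_of_tendsto hlim hbound).trans_lt
    (ENNReal.mul_lt_top ENNReal.ofReal_lt_top (mem_weightN.1 hx))

theorem mem_weightN_of_fixed (hα : IsMeanErgodic α) {d e : A} (hd : IsSelfAdjoint d)
    (hdfix : ∀ t, α t d = d) (he : 0 ≤ e) (hefix : ∀ t, α t e = e) (hed : e * d = d) :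
    d ∈ weightN ψ := by
  have hψ := h.proper
  obtain ⟨u, hufix, hufin, hu⟩ := hψ.exists_tendsto_fixed_of_fixed h.invariant hα he hefix
  obtain ⟨k, hk⟩ := ((tendsto_const_nhds.sub hu).norm.eventually_le_const
    (by simp : ‖e - e‖ < 1 / 2)).exists
  have hud : u k * d ∈ weightN ψ := by
    have := h.star_mem_weightN_of_fixed (x := d * u k) hufix hufin hu
      (hψ.mul_mem_weightN _ (hψ.mem_weightN_of_posExt_lt (hufin k)))
      (fun t => by rw [map_mul, hdfix, hufix]) (by rw [← mul_assoc, hed])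
    rwa [star_mul, hd.star_eq,
      (IsSelfAdjoint.of_nonneg (nonneg_of_posExt_lt (hufin k))).star_eq] at this
  rw [mem_weightN] at hud ⊢
  exact (hψ.posExt_mono (star_mul_self_nonneg d) (star_mul_self_le_of_norm_sub_le hed hk)).trans_lt
    (hψ.posExt_smul_lt zero_le_four hud)

/- In the unitization `1 - p² = (1 - r)²`, and as `p` and `r` lie in the centralizer,
`ψ(a) - ψ(pap) = Λ((1 - r) a (1 - r)) ≥ 0`. -/
theorem posExt_mul_mul_le_of_fixed {p r a : A} (hp : IsSelfAdjoint p) (hpN : p ∈ weightN ψ)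
    (hpfix : ∀ t, α t p = p) (hr : IsSelfAdjoint r) (hrN : r ∈ weightN ψ)
    (hrfix : ∀ t, α t r = r) (hpr : p * p = r + r - r * r) (ha : 0 ≤ a) :
    posExt ψ (p * a * p) ≤ posExt ψ a := by
  have hψ := h.proper
  rcases eq_or_ne (posExt ψ a) ∞ with hinf | hfin
  · exact hinf ▸ le_top
  replace hfin : posExt ψ a < ∞ := hfin.lt_top
  have haN := hψ.mem_weightN_of_posExt_lt hfin
  have has := IsSelfAdjoint.of_nonneg ha
  have hcomm {q x : A} (hq : IsSelfAdjoint q) (hqN : q ∈ weightN ψ) (hqfix : ∀ t, α t q = q)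
      (hx : x ∈ weightN ψ) (hx' : star x ∈ weightN ψ) : Λ (x * q) = Λ (q * x) :=
    h.apply_mul_comm hx hx' hqN (hq.star_eq.symm ▸ hqN) hqfix
  have hmul {q : A} (hq : IsSelfAdjoint q) (hqN : q ∈ weightN ψ) (hqfix : ∀ t, α t q = q) :
      Λ (q * a * q) = Λ (q * q * a) := by
    rw [hcomm hq hqN hqfix (hψ.mul_mem_weightN _ haN), mul_assoc]
    rw [star_mul, has.star_eq, hq.star_eq]
    exact hψ.mul_mem_weightN _ hqN
  obtain ⟨b, hb⟩ := CStarAlgebra.nonneg_iff_eq_star_mul_self.1 ha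
  have hbN : b ∈ weightN ψ := mem_weightN.2 (hb ▸ hfin)
  have hw := mem_weightN.1 (hψ.sub_mem_weightN hbN (hψ.mul_mem_weightN b hrN))
  have hexpand : star (b - b * r) * (b - b * r) = a - a * r - r * a + r * a * r := by
    rw [hb, star_sub, star_mul, hr.star_eq]
    noncomm_ring
  have hdiff : Λ (star (b - b * r) * (b - b * r)) = Λ a - Λ (p * a * p) := by
    rw [hexpand, hmul hp hpN hpfix, hpr, map_add, map_sub, map_sub, hmul hr hrN hrfix,
      hcomm hr hrN hrfix haN (has.star_eq.symm ▸ haN), sub_mul, add_mul, map_sub, map_add]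
    ring
  have hpap := hψ.posExt_mul_mul_lt hp hpN ha
  rw [h.isWeightFunctional _ hw, h.isWeightFunctional _ hfin, h.isWeightFunctional _ hpap] at hdiff
  have hreal : (posExt ψ (star (b - b * r) * (b - b * r))).toReal =
      (posExt ψ a).toReal - (posExt ψ (p * a * p)).toReal := by exact_mod_cast hdiff
  rw [← ENNReal.toReal_le_toReal hpap.ne hfin.ne, ← sub_nonneg, ← hreal]
  exact ENNReal.toReal_nonneg

theorem apply_orbitAvg (n : ℕ) {x : A} (hx : x ∈ weightDomain ψ) : Λ (orbitAvg α n x) = Λ x := by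
  simp only [orbitAvg, ← Complex.coe_smul, map_smul, map_sum,
    h.isWeightFunctional.apply_invariant h.proper h.invariant _ hx]
  rw [Complex.coe_smul, inv_smul_sum_const]

theorem apply_mul_mul_eq_zero {p a : A} (hp : IsSelfAdjoint p) (hpN : p ∈ weightN ψ)
    (hpfix : ∀ t, α t p = p) (ha : Tendsto (orbitAvg α · a) atTop (𝓝 0)) : Λ (p * a * p) = 0 := by
  have hpN' : star p ∈ weightN ψ := by rwa [hp.star_eq]
  have hlim := ((h.isWeightFunctional.continuous_apply_mul_mul h.proper hpN' hpN).tendsto 0).comp ha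
  simp only [mul_zero, zero_mul, map_zero] at hlim
  refine tendsto_nhds_unique (tendsto_const_nhds.congr fun n => ?_) hlim
  rw [Function.comp_apply, ← orbitAvg_mul_mul hpfix hpfix, h.apply_orbitAvg]
  rw [mul_assoc]
  exact mul_mem_weightDomain hpN' (h.proper.mul_mem_weightN a hpN)

end IsKMSFunctional

end FixedElements

section StripTransform

open Complex

theorem norm_cexp_I_mul_le {β : ℝ} {z : ℂ} (hz : z ∈ closedStrip β) (x : ℝ) :
    ‖cexp (I * z * x)‖ ≤ 1 + Real.exp (-β * x) := by
  have hre : (I * z * x).re = -z.im * x := by simp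
  rw [norm_exp, hre]
  have hedge : -z.im * x ≤ 0 ∨ -z.im * x ≤ -β * x := by
    rcases Set.mem_uIcc.1 (show z.im ∈ Set.uIcc 0 β from hz) with ⟨h₀, h₁⟩ | ⟨h₀, h₁⟩ <;>
      rcases le_total 0 x with hx | hx
    · exact Or.inl (by nlinarith)
    · exact Or.inr (by nlinarith)
    · exact Or.inr (by nlinarith)
    · exact Or.inl (by nlinarith)
  rcases hedge with h | h
  · linarith [Real.exp_le_one_iff.2 h, Real.exp_pos (-β * x)]
  · linarith [Real.exp_le_exp.2 h]

theorem norm_cexp_I_mul_mul_le {β : ℝ} {z : ℂ} (hz : z ∈ closedStrip β) (x : ℝ) (w : ℂ) :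
    ‖cexp (I * z * x) * w‖ ≤ (1 + Real.exp (-β * x)) * ‖w‖ := by
  rw [norm_mul]
  gcongr
  exact norm_cexp_I_mul_le hz x

theorem norm_cexp_I_mul_mul_exp_le {β δ : ℝ} {z : ℂ} (hδ : 0 ≤ δ)
    (hz : Metric.closedBall z δ ⊆ closedStrip β) (x : ℝ) :
    ‖cexp (I * z * x)‖ * Real.exp (δ * |x|) ≤ 1 + Real.exp (-β * x) := by
  have hshift (s : ℝ) (hs : |s| ≤ δ) :
      ‖cexp (I * z * x)‖ * Real.exp (-s * x) ≤ 1 + Real.exp (-β * x) := by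
    have hmem : z + s * I ∈ closedStrip β := hz (by simpa using hs)
    have hre : (I * (z + s * I) * x).re = (I * z * x).re + -s * x := by
      simp
      ring
    simpa only [norm_exp, hre, Real.exp_add] using norm_cexp_I_mul_le hmem x
  rcases abs_cases x with ⟨hx, -⟩ | ⟨hx, -⟩
  · simpa [hx] using hshift (-δ) (by rw [abs_neg, abs_of_nonneg hδ])
  · simpa [hx] using hshift δ (abs_of_nonneg hδ).le

theorem norm_mul_cexp_I_mul_le {β δ : ℝ} {z : ℂ} (hδ : 0 < δ)
    (hz : Metric.closedBall z δ ⊆ closedStrip β) (x : ℝ) :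
    ‖(x : ℂ) * cexp (I * z * x)‖ ≤ δ⁻¹ * (1 + Real.exp (-β * x)) := by
  have hx : δ * |x| ≤ Real.exp (δ * |x|) := by linarith [Real.add_one_le_exp (δ * |x|)]
  calc ‖(x : ℂ) * cexp (I * z * x)‖
      = δ⁻¹ * (‖cexp (I * z * x)‖ * (δ * |x|)) := by
        rw [norm_mul, norm_real, Real.norm_eq_abs]
        field_simp
    _ ≤ δ⁻¹ * (‖cexp (I * z * x)‖ * Real.exp (δ * |x|)) := by gcongr
    _ ≤ δ⁻¹ * (1 + Real.exp (-β * x)) := by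
        gcongr
        exact norm_cexp_I_mul_mul_exp_le hδ.le hz x

variable {Γ : Type*} [MeasurableSpace Γ] {μ : Measure Γ} {c : Γ → ℝ} {h : Γ → ℂ} {β : ℝ}

/-- The Fourier-Laplace transform of `h dμ` along `c`. It interpolates holomorphically between
`∫ h dμ` at `0` and `∫ exp (-β c) h dμ` at `iβ`. -/
def stripTransform (μ : Measure Γ) (c : Γ → ℝ) (h : Γ → ℂ) (z : ℂ) : ℂ :=
  ∫ g, cexp (I * z * c g) * h g ∂μ

theorem integrable_strip_bound (hh : Integrable h μ)
    (hβ : Integrable (fun g => Real.exp (-β * c g) • h g) μ) :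
    Integrable (fun g => (1 + Real.exp (-β * c g)) * ‖h g‖) μ := by
  refine (hh.norm.add hβ.norm).congr (Eventually.of_forall fun g => ?_)
  simp only [Pi.add_apply, norm_smul, Real.norm_eq_abs, Real.abs_exp]
  ring

theorem norm_stripTransform_le (hh : Integrable h μ)
    (hβ : Integrable (fun g => Real.exp (-β * c g) • h g) μ) {z : ℂ} (hz : z ∈ closedStrip β) :
    ‖stripTransform μ c h z‖ ≤ ∫ g, (1 + Real.exp (-β * c g)) * ‖h g‖ ∂μ :=
  norm_integral_le_of_norm_le (integrable_strip_bound hh hβ)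
    (Eventually.of_forall fun _ => norm_cexp_I_mul_mul_le hz _ _)

theorem aestronglyMeasurable_cexp_I_mul_mul (hc : Measurable c)
    (hh : AEStronglyMeasurable h μ) (z : ℂ) :
    AEStronglyMeasurable (fun g => cexp (I * z * c g) * h g) μ :=
  (by fun_prop : Measurable fun g => cexp (I * z * c g)).aestronglyMeasurable.mul hh

theorem continuousOn_stripTransform (hc : Measurable c) (hh : Integrable h μ)
    (hβ : Integrable (fun g => Real.exp (-β * c g) • h g) μ) :
    ContinuousOn (stripTransform μ c h) (closedStrip β) :=
  continuousOn_of_dominated (fun z _ => aestronglyMeasurable_cexp_I_mul_mul hc hh.1 z)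
    (fun _ hz => Eventually.of_forall fun _ => norm_cexp_I_mul_mul_le hz _ _)
    (integrable_strip_bound hh hβ) (Eventually.of_forall fun g => by fun_prop)

theorem differentiableOn_stripTransform (hc : Measurable c) (hh : Integrable h μ)
    (hβ : Integrable (fun g => Real.exp (-β * c g) • h g) μ) :
    DifferentiableOn ℂ (stripTransform μ c h) (interior (closedStrip β)) := by
  intro z hz
  obtain ⟨ε, hε, hball⟩ := Metric.mem_nhds_iff.1 (mem_interior_iff_mem_nhds.1 hz)
  have hδ : 0 < ε / 2 := half_pos hε
  have hderiv (g : Γ) (w : ℂ) : HasDerivAt (fun w => cexp (I * w * c g) * h g)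
      (I * c g * cexp (I * w * c g) * h g) w := by
    have hlin : HasDerivAt (fun w : ℂ => I * w * c g) (I * c g) w := by
      simpa using ((hasDerivAt_id w).const_mul I).mul_const (c g : ℂ)
    simpa only [mul_comm (cexp _) (I * _)] using hlin.cexp.mul_const (h g)
  have hbound (g : Γ) (w : ℂ) (hw : w ∈ Metric.ball z (ε / 2)) :
      ‖I * c g * cexp (I * w * c g) * h g‖ ≤
        (ε / 2)⁻¹ * ((1 + Real.exp (-β * c g)) * ‖h g‖) := by
    have hsub : Metric.closedBall w (ε / 2) ⊆ closedStrip β :=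
      (Metric.closedBall_subset_ball' (by linarith [Metric.mem_ball.1 hw])).trans hball
    rw [norm_mul, mul_assoc I, norm_mul I, norm_I, one_mul, ← mul_assoc]
    gcongr
    exact norm_mul_cexp_I_mul_le hδ hsub (c g)
  have hmeas : AEStronglyMeasurable (fun g => I * c g * cexp (I * z * c g) * h g) μ :=
    (by fun_prop : Measurable fun g => I * c g * cexp (I * z * c g)).aestronglyMeasurable.mul hh.1
  exact (hasDerivAt_integral_of_dominated_loc_of_deriv_le (Metric.ball_mem_nhds z hδ)
    (Eventually.of_forall fun w => aestronglyMeasurable_cexp_I_mul_mul hc hh.1 w)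
    ((integrable_strip_bound hh hβ).mono' (aestronglyMeasurable_cexp_I_mul_mul hc hh.1 z)
      (Eventually.of_forall fun _ => norm_cexp_I_mul_mul_le (interior_subset hz) _ _))
    hmeas (Eventually.of_forall hbound) ((integrable_strip_bound hh hβ).const_mul _)
    (Eventually.of_forall fun g w _ => hderiv g w)).2.differentiableAt
    |>.differentiableWithinAt

end StripTransform

theorem exists_bump {X : Type*} [TopologicalSpace X] [T2Space X] [LocallyCompactSpace X]
    {K U : Set X} (hK : IsCompact K) (hU : IsOpen U) (hKU : K ⊆ U) :
    ∃ p : C_c(X, ℝ), (∀ x ∈ K, p x = 1) ∧ tsupport p ⊆ U ∧ ∀ x, 0 ≤ p x ∧ p x ≤ 1 := by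
  obtain ⟨f, hone, hcomp, hsupp, hf⟩ :=
    exists_continuousMap_one_of_isCompact_subset_isOpen hK hU hKU
  exact ⟨⟨f, hcomp⟩, hone, hsupp, hf⟩

section Bounds

theorem exists_pos_le_abs_le_of_isCompact {Y : Type*} [TopologicalSpace Y] {K : Set Y} {f : Y → ℝ}
    (hK : IsCompact K) (hf : ContinuousOn f K) (h₀ : ∀ y ∈ K, f y ≠ 0) :
    ∃ δ > 0, ∃ R, ∀ y ∈ K, δ ≤ |f y| ∧ |f y| ≤ R := by
  obtain ⟨R, hR⟩ := hK.exists_bound_of_continuousOn hf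
  rcases K.eq_empty_or_nonempty with rfl | hne
  · exact ⟨1, one_pos, 0, by simp⟩
  · obtain ⟨y₀, hy₀, hmin⟩ := hK.exists_isMinOn hne hf.abs
    exact ⟨|f y₀|, abs_pos.2 (h₀ y₀ hy₀), R, fun y hy => ⟨hmin hy, hR y hy⟩⟩

theorem sum_norm_sum_sq_le {ι κ : Type*} [DecidableEq κ] {M : ℝ} {N N' : ℕ} (F : ι → Finset κ)
    {a : ι → κ → ℂ} (ha : ∀ i j, ‖a i j‖ ≤ M) (hrow : ∀ i, (F i).card ≤ N)
    (hcol : ∀ j (S : Finset ι), (∀ i ∈ S, j ∈ F i) → S.card ≤ N') (v : κ → ℂ) (S : Finset ι) :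
    ∑ i ∈ S, ‖∑ j ∈ F i, a i j * v j‖ ^ 2 ≤ N * N' * M ^ 2 * ∑ j ∈ S.biUnion F, ‖v j‖ ^ 2 := by
  have hterm (i : ι) : ‖∑ j ∈ F i, a i j * v j‖ ^ 2 ≤ N * M ^ 2 * ∑ j ∈ F i, ‖v j‖ ^ 2 :=
    calc ‖∑ j ∈ F i, a i j * v j‖ ^ 2
        ≤ (∑ j ∈ F i, M * ‖v j‖) ^ 2 := by
          gcongr
          refine (norm_sum_le _ _).trans (Finset.sum_le_sum fun j _ => ?_)
          rw [norm_mul]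
          gcongr
          exact ha i j
      _ ≤ (F i).card * ∑ j ∈ F i, (M * ‖v j‖) ^ 2 := sq_sum_le_card_mul_sum_sq
      _ ≤ N * ∑ j ∈ F i, (M * ‖v j‖) ^ 2 := by
          gcongr
          exact hrow i
      _ = N * M ^ 2 * ∑ j ∈ F i, ‖v j‖ ^ 2 := by
          simp only [mul_pow, ← Finset.mul_sum]
          ring
  calc ∑ i ∈ S, ‖∑ j ∈ F i, a i j * v j‖ ^ 2
      ≤ N * M ^ 2 * ∑ i ∈ S, ∑ j ∈ F i, ‖v j‖ ^ 2 := by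
        rw [Finset.mul_sum]
        exact Finset.sum_le_sum fun i _ => hterm i
    _ = N * M ^ 2 * ∑ j ∈ S.biUnion F, ∑ i ∈ S with j ∈ F i, ‖v j‖ ^ 2 := by
        congr 1
        refine Finset.sum_comm' fun i j => ?_
        simp only [Finset.mem_filter, Finset.mem_biUnion]
        tauto
    _ ≤ N * M ^ 2 * ∑ j ∈ S.biUnion F, N' * ‖v j‖ ^ 2 := by
        gcongr with j _
        rw [Finset.sum_const, nsmul_eq_mul]
        gcongr
        exact hcol j _ fun i hi => (Finset.mem_filter.1 hi).2
    _ = N * N' * M ^ 2 * ∑ j ∈ S.biUnion F, ‖v j‖ ^ 2 := by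
        rw [← Finset.mul_sum]
        ring

theorem norm_sum_exp_le {x : ℝ} (hx : x ≠ 0) (hπ : |x| ≤ Real.pi) (N : ℕ) :
    ‖∑ j ∈ Finset.range N, Complex.exp (Complex.I * x) ^ j‖ ≤ Real.pi / |x| := by
  have hx' : 0 < |x| := abs_pos.2 hx
  have hlow : 2 / Real.pi * |x| ≤ ‖Complex.exp (Complex.I * x) - 1‖ := by
    rw [Complex.norm_exp_I_mul_ofReal_sub_one, norm_mul, Real.norm_eq_abs, Real.norm_eq_abs,
      abs_two, Real.abs_sin_eq_sin_abs_of_abs_le_pi, abs_div, abs_two]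
    · have hsin := Real.mul_le_sin (x := |x| / 2) (by positivity) (by linarith)
      calc 2 / Real.pi * |x| = 2 * (2 / Real.pi * (|x| / 2)) := by ring
        _ ≤ 2 * Real.sin (|x| / 2) := by gcongr
    · rw [abs_div, abs_two]
      linarith
  have hpos : 0 < ‖Complex.exp (Complex.I * x) - 1‖ :=
    lt_of_lt_of_le (by have := Real.pi_pos; positivity) hlow
  have hnum : ‖Complex.exp (Complex.I * x) ^ N - 1‖ ≤ 2 := by
    refine (norm_sub_le _ _).trans ?_
    rw [norm_pow, mul_comm, Complex.norm_exp_ofReal_mul_I, one_pow, norm_one]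
    norm_num
  rw [geom_sum_eq (by rw [Ne, ← sub_eq_zero]; exact norm_pos_iff.1 hpos), norm_div,
    div_le_div_iff₀ hpos hx']
  calc ‖Complex.exp (Complex.I * x) ^ N - 1‖ * |x| ≤ 2 * |x| := by gcongr
    _ = Real.pi * (2 / Real.pi * |x|) := by field_simp
    _ ≤ Real.pi * ‖Complex.exp (Complex.I * x) - 1‖ := by
        have := Real.pi_pos
        gcongr

end Bounds

theorem exists_seq_openPartialHomeomorph {G X : Type*} [TopologicalSpace G] [TopologicalSpace X]
    [SecondCountableTopology G] [Nonempty G] {f : G → X} (hf : IsLocalHomeomorph f) :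
    ∃ e : ℕ → OpenPartialHomeomorph G X, (∀ n, f = e n) ∧ ⋃ n, (e n).source = Set.univ := by
  choose e hmem hfe using hf
  obtain ⟨T, hT, hcover⟩ := TopologicalSpace.countable_cover_nhds fun g =>
    (e g).open_source.mem_nhds (hmem g)
  have hne : T.Nonempty := Set.nonempty_iff_ne_empty.2 fun h =>
    Set.empty_ne_univ (by simpa [h] using hcover)
  obtain ⟨u, rfl⟩ := hT.exists_eq_range hne
  exact ⟨fun n => e (u n), fun n => hfe (u n), by rwa [Set.biUnion_range] at hcover⟩

theorem norm_conj_mul_le (z w : ℂ) : ‖starRingEnd ℂ z * w‖ ≤ ‖z‖ ^ 2 + ‖w‖ ^ 2 := by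
  rw [norm_mul, RCLike.norm_conj]
  nlinarith [two_mul_le_add_sq ‖z‖ ‖w‖, sq_nonneg ‖z‖, sq_nonneg ‖w‖]

section ChangeOfVariables

variable {Y : Type*} [MeasurableSpace Y] {μ : Measure Y} {e : Y → Y} {w : Y → ℝ}
  {E : Type*} [NormedAddCommGroup E] [NormedSpace ℝ E]

theorem integral_smul_of_map_eq_withDensity (he : MeasurableEmbedding e) (hw : Measurable w)
    (hw₀ : ∀ y, 0 ≤ w y) (hμ : μ.map e = μ.withDensity fun y => ENNReal.ofReal (w y)) (f : Y → E) :
    ∫ y, w y • f y ∂μ = ∫ y, f (e y) ∂μ := by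
  have h := integral_withDensity_eq_integral_toReal_smul (μ := μ) hw.ennreal_ofReal
    (.of_forall fun y => ENNReal.ofReal_lt_top) f
  simp only [ENNReal.toReal_ofReal (hw₀ _)] at h
  rw [← h, ← hμ, he.integral_map]

theorem integrable_smul_of_map_eq_withDensity (he : MeasurableEmbedding e) (hw : Measurable w)
    (hw₀ : ∀ y, 0 ≤ w y) (hμ : μ.map e = μ.withDensity fun y => ENNReal.ofReal (w y)) {f : Y → E}
    (hf : Integrable (fun y => f (e y)) μ) : Integrable (fun y => w y • f y) μ := by
  have h := integrable_withDensity_iff_integrable_smul' (μ := μ) hw.ennreal_ofReal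
    (.of_forall fun y => ENNReal.ofReal_lt_top) (g := f)
  simp only [ENNReal.toReal_ofReal (hw₀ _)] at h
  rw [← h, ← hμ, he.integrable_map_iff]
  exact hf

end ChangeOfVariables

section CompactlySupported

theorem exists_mul_self_eq {X : Type*} [TopologicalSpace X] {p : C_c(X, ℝ)} (hp : ∀ x, 0 ≤ p x) :
    ∃ q : C_c(X, ℝ), p = q * q := by
  refine ⟨p.compLeft ⟨Real.sqrt, Real.continuous_sqrt⟩,
    CompactlySupportedContinuousMap.ext fun x => ?_⟩
  rw [CompactlySupportedContinuousMap.mul_apply,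
    CompactlySupportedContinuousMap.compLeft_apply (by simp)]
  exact (Real.mul_self_sqrt (hp x)).symm

/- The witness is `q = 1 - √(1 - p²)`. -/
theorem exists_mul_self_add_mul_self_eq {X : Type*} [TopologicalSpace X] {p : C_c(X, ℝ)}
    (hp : ∀ x, 0 ≤ p x ∧ p x ≤ 1) : ∃ q : C_c(X, ℝ), p * p + q * q = q + q := by
  refine ⟨p.compLeft ⟨fun t => 1 - Real.sqrt (1 - t ^ 2), by fun_prop⟩,
    CompactlySupportedContinuousMap.ext fun x => ?_⟩
  have hsqrt : Real.sqrt (1 - p x ^ 2) ^ 2 = 1 - p x ^ 2 :=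
    Real.sq_sqrt (sub_nonneg.2 (pow_le_one₀ (hp x).1 (hp x).2))
  simp only [CompactlySupportedContinuousMap.add_apply, CompactlySupportedContinuousMap.mul_apply]
  rw [CompactlySupportedContinuousMap.compLeft_apply (by simp)]
  change p x * p x + (1 - Real.sqrt (1 - p x ^ 2)) * (1 - Real.sqrt (1 - p x ^ 2)) =
    1 - Real.sqrt (1 - p x ^ 2) + (1 - Real.sqrt (1 - p x ^ 2))
  linear_combination hsqrt

theorem exists_mul_eq_self {X : Type*} [TopologicalSpace X] [T2Space X] [LocallyCompactSpace X]
    (p : C_c(X, ℝ)) : ∃ q : C_c(X, ℝ), q * p = p := by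
  obtain ⟨q, hone, -, -⟩ :=
    exists_bump p.hasCompactSupport.isCompact isOpen_univ (Set.subset_univ _)
  refine ⟨q, CompactlySupportedContinuousMap.ext fun x => ?_⟩
  rw [CompactlySupportedContinuousMap.mul_apply]
  by_cases hx : x ∈ tsupport p
  · rw [hone x hx, one_mul]
  · rw [image_eq_zero_of_notMem_tsupport hx, mul_zero]

theorem compactlySupported_induction {G : Type*} [TopologicalSpace G] [T2Space G]
    [LocallyCompactSpace G] {P : C_c(G, ℂ) → Prop} (zero : P 0)
    (add : ∀ f h, P f → P h → P (f + h))
    (local_support : ∀ g, ∃ U, IsOpen U ∧ g ∈ U ∧ ∀ f : C_c(G, ℂ), tsupport f ⊆ U → P f)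
    (f : C_c(G, ℂ)) : P f := by
  choose U hU hgU hP using local_support
  have hK : IsCompact (tsupport f) := f.hasCompactSupport
  obtain ⟨t, ht⟩ := hK.elim_finite_subcover U hU fun g _ => Set.mem_iUnion.2 ⟨g, hgU g⟩
  have hcover : tsupport f ⊆ ⋃ i : Fin t.card, U (t.equivFin.symm i) := by
    intro h hh
    obtain ⟨g, hg, hgh⟩ := Set.mem_iUnion₂.1 (ht hh)
    refine Set.mem_iUnion.2 ⟨t.equivFin ⟨g, hg⟩, ?_⟩
    rwa [Equiv.symm_apply_apply]
  obtain ⟨ρ, hρsupp, hρ, -, -⟩ := exists_continuous_sum_one_of_isOpen_isCompact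
    (fun i : Fin t.card => hU (t.equivFin.symm i)) hK hcover
  let F (i : Fin t.card) : C_c(G, ℂ) := (⟨fun g => (ρ i g : ℂ), by fun_prop⟩ : C(G, ℂ)) • f
  have hF (i : Fin t.card) (g : G) : F i g = ρ i g * f g := rfl
  have hsum : f = ∑ i, F i := by
    refine CompactlySupportedContinuousMap.ext fun g => ?_
    rw [CompactlySupportedContinuousMap.sum_apply]
    simp only [hF]
    rw [← Finset.sum_mul]
    by_cases hg : f g = 0
    · rw [hg, mul_zero]
    · have hone := hρ (subset_tsupport f hg)
      rw [Finset.sum_apply, Pi.one_apply] at hone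
      rw [← Complex.ofReal_sum, hone, Complex.ofReal_one, one_mul]
  rw [hsum]
  refine Finset.sum_induction _ P add zero fun i _ => hP (t.equivFin.symm i) _ ?_
  have hle : Function.support (F i) ⊆ Function.support (ρ i) :=
    Function.support_subset_iff'.2 fun g hg => by
      rw [hF, Function.notMem_support.1 hg, Complex.ofReal_zero, zero_mul]
  exact (closure_mono hle).trans (hρsupp i)

theorem exists_conj_mul_self_eq {G : Type*} [TopologicalSpace G] (f : C_c(G, NNReal)) :
    ∃ k : C_c(G, ℂ), ∀ g, starRingEnd ℂ (k g) * k g = ((f g : ℝ) : ℂ) := by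
  refine ⟨f.compLeft ⟨fun t : NNReal => ((Real.sqrt t : ℝ) : ℂ), by fun_prop⟩, fun g => ?_⟩
  rw [CompactlySupportedContinuousMap.compLeft_apply (by simp)]
  change starRingEnd ℂ ((Real.sqrt (f g) : ℝ) : ℂ) * ((Real.sqrt (f g) : ℝ) : ℂ) = _
  rw [Complex.conj_ofReal, ← Complex.ofReal_mul, Real.mul_self_sqrt (f g).coe_nonneg]

end CompactlySupported

namespace EtaleGroupoid

section Units

variable {G X : Type*} [TopologicalSpace G] [TopologicalSpace X] (𝒢 : EtaleGroupoid G X)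

theorem mem_range_unit_iff {g : G} : g ∈ Set.range 𝒢.unit ↔ 𝒢.unit (𝒢.r g) = g :=
  ⟨by rintro ⟨x, rfl⟩; exact congrArg _ (𝒢.r_unit x), fun h => ⟨_, h⟩⟩

theorem isOpen_range_unit : IsOpen (Set.range 𝒢.unit) := by
  rw [isOpen_iff_mem_nhds]
  rintro _ ⟨x, rfl⟩
  obtain ⟨e, he, her⟩ := 𝒢.isLocalHomeomorph_r (𝒢.unit x)
  have hsource : e.source ∈ 𝓝 (𝒢.unit x) := e.open_source.mem_nhds he
  have hunit : (fun g => 𝒢.unit (𝒢.r g)) ⁻¹' e.source ∈ 𝓝 (𝒢.unit x) := by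
    refine (𝒢.continuous_unit.comp 𝒢.continuous_r).continuousAt ?_
    simpa only [Function.comp, 𝒢.r_unit] using hsource
  filter_upwards [hsource, hunit] with g hg hg'
  refine 𝒢.mem_range_unit_iff.2 (e.injOn hg' hg ?_)
  rw [← her, 𝒢.r_unit]

theorem unit_mul_unit (x : X) : 𝒢.mul (𝒢.unit x) (𝒢.unit x) = 𝒢.unit x := by
  simpa only [𝒢.r_unit] using 𝒢.unit_mul (𝒢.unit x)

theorem unit_inv (x : X) : 𝒢.inv (𝒢.unit x) = 𝒢.unit x :=
  (𝒢.inv_unique (by rw [𝒢.s_unit, 𝒢.r_unit]) (by rw [𝒢.unit_mul_unit, 𝒢.s_unit])).symm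

theorem mul_unit_inv (x : X) {g : G} (h : 𝒢.s g = x) : 𝒢.mul g (𝒢.inv (𝒢.unit x)) = g := by
  rw [𝒢.unit_inv, ← h, 𝒢.mul_unit]

theorem inv_bijective : Function.Bijective 𝒢.inv :=
  Function.Involutive.bijective 𝒢.inv_inv

/-- The inversion as a homeomorphism. -/
def invHomeo : G ≃ₜ G where
  toFun := 𝒢.inv
  invFun := 𝒢.inv
  left_inv := 𝒢.inv_inv
  right_inv := 𝒢.inv_inv
  continuous_toFun := 𝒢.continuous_inv
  continuous_invFun := 𝒢.continuous_inv

variable {𝒢} (c : 𝒢.RealHom)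

theorem RealHom.map_unit (x : X) : c (𝒢.unit x) = 0 := by
  have h := c.map_mul (𝒢.unit x) (𝒢.unit x) (by rw [𝒢.s_unit, 𝒢.r_unit])
  rw [𝒢.unit_mul_unit] at h
  linarith

theorem RealHom.map_inv (g : G) : c (𝒢.inv g) = -c g := by
  have h := c.map_mul (𝒢.inv g) g (𝒢.s_inv g)
  rw [𝒢.inv_mul, c.map_unit] at h
  linarith

theorem phase_unit (t : ℝ) (x : X) : phase c t (𝒢.unit x) = 1 := by
  simp [phase, c.map_unit]

end Units

section Diag

variable {G X : Type*} [TopologicalSpace G] [TopologicalSpace X] [T2Space G]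

theorem locallyCompactSpace_units [LocallyCompactSpace G] (𝒢 : EtaleGroupoid G X) :
    LocallyCompactSpace X :=
  𝒢.isClosedEmbedding_unit.locallyCompactSpace

theorem secondCountableTopology_units [SecondCountableTopology G] (𝒢 : EtaleGroupoid G X) :
    SecondCountableTopology X :=
  𝒢.isClosedEmbedding_unit.isEmbedding.secondCountableTopology

variable (𝒢 : EtaleGroupoid G X)

theorem isClopen_range_unit : IsClopen (Set.range 𝒢.unit) :=
  ⟨𝒢.isClosedEmbedding_unit.isClosed_range, 𝒢.isOpen_range_unit⟩

/-- A compactly supported function on the unit space, extended by zero to the groupoid. -/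
def diag (p : C_c(X, ℝ)) : C_c(G, ℂ) where
  toFun := (Set.range 𝒢.unit).indicator fun g => (p (𝒢.r g) : ℂ)
  continuous_toFun :=
    (Complex.continuous_ofReal.comp (p.continuous.comp 𝒢.continuous_r)).indicator
      fun _ hg => by simp [𝒢.isClopen_range_unit.frontier_eq] at hg
  hasCompactSupport' := by
    refine HasCompactSupport.intro (p.hasCompactSupport.isCompact.image 𝒢.continuous_unit)
      fun g hg => ?_
    by_cases h : g ∈ Set.range 𝒢.unit
    · obtain ⟨x, rfl⟩ := h
      rw [Set.indicator_of_mem (Set.mem_range_self x), 𝒢.r_unit,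
        image_eq_zero_of_notMem_tsupport (fun hx => hg ⟨x, hx, rfl⟩), Complex.ofReal_zero]
    · exact Set.indicator_of_notMem h _

theorem diag_unit (p : C_c(X, ℝ)) (x : X) : 𝒢.diag p (𝒢.unit x) = p x := by
  change (Set.range 𝒢.unit).indicator (fun g => (p (𝒢.r g) : ℂ)) _ = _
  rw [Set.indicator_of_mem (Set.mem_range_self x), 𝒢.r_unit]

theorem diag_of_notMem (p : C_c(X, ℝ)) {g : G} (hg : g ∉ Set.range 𝒢.unit) : 𝒢.diag p g = 0 :=
  Set.indicator_of_notMem hg fun g => (p (𝒢.r g) : ℂ)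

theorem regFun_diag (p : C_c(X, ℝ)) (x : X) (ψ : {g : G // 𝒢.s g = x} → ℂ)
    (g : {g : G // 𝒢.s g = x}) : 𝒢.regFun (𝒢.diag p) x ψ g = p (𝒢.r g) * ψ g := by
  rw [regFun, tsum_eq_single ⟨𝒢.unit (𝒢.r g), 𝒢.r_unit _⟩]
  · simp only [𝒢.diag_unit]
    congr 2
    exact Subtype.ext ((congrArg (𝒢.mul · g) (𝒢.unit_inv _)).trans (𝒢.unit_mul _))
  · rintro ⟨h, hh⟩ hne
    rw [𝒢.diag_of_notMem, zero_mul]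
    rw [𝒢.mem_range_unit_iff, hh]
    exact fun hu => hne (Subtype.ext hu.symm)

theorem invol_diag (p : C_c(X, ℝ)) : 𝒢.invol (𝒢.diag p) = 𝒢.diag p := by
  refine CompactlySupportedContinuousMap.ext fun g => ?_
  change starRingEnd ℂ (𝒢.diag p (𝒢.inv g)) = _
  by_cases hg : g ∈ Set.range 𝒢.unit
  · obtain ⟨x, rfl⟩ := hg
    rw [𝒢.unit_inv, 𝒢.diag_unit, Complex.conj_ofReal]
  · rw [𝒢.diag_of_notMem p hg, 𝒢.diag_of_notMem p, map_zero]
    rintro ⟨x, hx⟩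
    exact hg ⟨x, by rw [← 𝒢.inv_inv g, ← hx, 𝒢.unit_inv]⟩

theorem twist_diag (c : 𝒢.RealHom) (t : ℝ) (p : C_c(X, ℝ)) :
    twist c t (𝒢.diag p) = 𝒢.diag p := by
  refine CompactlySupportedContinuousMap.ext fun g => ?_
  change phase c t g * 𝒢.diag p g = _
  by_cases hg : g ∈ Set.range 𝒢.unit
  · obtain ⟨x, rfl⟩ := hg
    rw [phase_unit, one_mul]
  · rw [𝒢.diag_of_notMem p hg, mul_zero]

end Diag

section DiagElt

variable {G X : Type*} [TopologicalSpace G] [TopologicalSpace X] [T2Space G] [LocallyCompactSpace G]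
  {𝒢 : EtaleGroupoid G X}

theorem reducedCStar_ext {a b : 𝒢.ReducedCStar}
    (h : ∀ x (ψ : 𝒢.Ell2 x) g, (𝒢.toFam a).op x ψ g = (𝒢.toFam b).op x ψ g) : a = b :=
  𝒢.toFam_injective (BddFam.ext fun x => ContinuousLinearMap.ext fun ψ =>
    lp.ext (funext fun g => h x ψ g))

variable (𝒢)

theorem toFam_mul_apply (a b : 𝒢.ReducedCStar) (x : X) (ψ : 𝒢.Ell2 x) :
    (𝒢.toFam (a * b)).op x ψ = (𝒢.toFam a).op x ((𝒢.toFam b).op x ψ) := rfl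

theorem norm_le_of_forall_op {a : 𝒢.ReducedCStar} {M : ℝ} (hM : 0 ≤ M)
    (h : ∀ x, ‖(𝒢.toFam a).op x‖ ≤ M) : ‖a‖ ≤ M := by
  rw [← norm_toFam, BddFam.norm_eq]
  exact Real.iSup_le h hM

theorem ofCc_add (f₁ f₂ : C_c(G, ℂ)) : 𝒢.ofCc (f₁ + f₂) = 𝒢.ofCc f₁ + 𝒢.ofCc f₂ :=
  𝒢.toFam_injective (𝒢.regFam_add f₁ f₂)

theorem ofCc_smul (z : ℂ) (f : C_c(G, ℂ)) : 𝒢.ofCc (z • f) = z • 𝒢.ofCc f :=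
  𝒢.toFam_injective (𝒢.regFam_smul z f)

/-- The canonical map of `C_c(G)` to `C*_r(G)` as a linear map. -/
def ofCcLin : C_c(G, ℂ) →ₗ[ℂ] 𝒢.ReducedCStar where
  toFun := 𝒢.ofCc
  map_add' := 𝒢.ofCc_add
  map_smul' := 𝒢.ofCc_smul

/-- The embedding of `C_c(X)` in `C*_r(G)`, on real-valued functions. -/
def diagElt (p : C_c(X, ℝ)) : 𝒢.ReducedCStar := 𝒢.ofCc (𝒢.diag p)

theorem toFam_diagElt_apply (p : C_c(X, ℝ)) (x : X) (ψ : 𝒢.Ell2 x) (g : {g : G // 𝒢.s g = x}) :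
    (𝒢.toFam (𝒢.diagElt p)).op x ψ g = p (𝒢.r g) * ψ g :=
  𝒢.regFun_diag p x ψ g

theorem diagElt_mul (p q : C_c(X, ℝ)) : 𝒢.diagElt (p * q) = 𝒢.diagElt p * 𝒢.diagElt q := by
  refine reducedCStar_ext fun x ψ g => ?_
  rw [toFam_mul_apply, toFam_diagElt_apply, toFam_diagElt_apply, toFam_diagElt_apply,
    CompactlySupportedContinuousMap.mul_apply]
  push_cast
  ring

theorem diagElt_add (p q : C_c(X, ℝ)) : 𝒢.diagElt (p + q) = 𝒢.diagElt p + 𝒢.diagElt q := by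
  refine reducedCStar_ext fun x ψ g => ?_
  change _ = (𝒢.toFam (𝒢.diagElt p)).op x ψ g + (𝒢.toFam (𝒢.diagElt q)).op x ψ g
  rw [toFam_diagElt_apply, toFam_diagElt_apply, toFam_diagElt_apply,
    CompactlySupportedContinuousMap.add_apply]
  push_cast
  ring

theorem diagElt_smul (r : ℝ) (p : C_c(X, ℝ)) : 𝒢.diagElt (r • p) = (r : ℂ) • 𝒢.diagElt p := by
  refine reducedCStar_ext fun x ψ g => ?_
  change _ = (r : ℂ) * (𝒢.toFam (𝒢.diagElt p)).op x ψ g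
  rw [toFam_diagElt_apply, toFam_diagElt_apply,
    CompactlySupportedContinuousMap.smul_apply, smul_eq_mul]
  push_cast
  ring

theorem isSelfAdjoint_diagElt (p : C_c(X, ℝ)) : IsSelfAdjoint (𝒢.diagElt p) := by
  rw [isSelfAdjoint_iff, diagElt, ← ofCc_invol, invol_diag]

theorem sigma_diagElt (c : 𝒢.RealHom) (t : ℝ) (p : C_c(X, ℝ)) :
    sigma c t (𝒢.diagElt p) = 𝒢.diagElt p := by
  rw [diagElt, sigma_ofCc, twist_diag]

theorem norm_diagElt_le (p : C_c(X, ℝ)) {M : ℝ} (hM : 0 ≤ M) (h : ∀ x, |p x| ≤ M) :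
    ‖𝒢.diagElt p‖ ≤ M := by
  refine 𝒢.norm_le_of_forall_op hM fun x => ContinuousLinearMap.opNorm_le_bound _ hM fun ψ => ?_
  refine lp.norm_le_of_forall_sum_le (by simp) (by positivity) fun S => ?_
  rw [Real.mul_rpow hM (norm_nonneg _)]
  calc ∑ g ∈ S, ‖(𝒢.toFam (𝒢.diagElt p)).op x ψ g‖ ^ (2 : ℝ≥0∞).toReal
      ≤ ∑ g ∈ S, M ^ (2 : ℝ≥0∞).toReal * ‖ψ g‖ ^ (2 : ℝ≥0∞).toReal := by
        refine Finset.sum_le_sum fun g _ => ?_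
        rw [toFam_diagElt_apply, norm_mul, Complex.norm_real, Real.norm_eq_abs,
          Real.mul_rpow (abs_nonneg _) (norm_nonneg _)]
        gcongr
        exact h _
    _ ≤ M ^ (2 : ℝ≥0∞).toReal * ‖ψ‖ ^ (2 : ℝ≥0∞).toReal := by
        rw [← Finset.mul_sum]
        gcongr
        exact lp.sum_rpow_le_norm_rpow (by simp) ψ S

end DiagElt

section Coef

variable {G X : Type*} [TopologicalSpace G] [TopologicalSpace X] [T2Space G] [LocallyCompactSpace G]
  (𝒢 : EtaleGroupoid G X)

/-- The matrix coefficient `⟨δ_g, a δ_{s(g)}⟩` of an element of `C*_r(G)`, as a function on `G`. -/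
def coef (a : 𝒢.ReducedCStar) (g : G) : ℂ :=
  (𝒢.toFam a).op (𝒢.s g) (𝒢.delta (𝒢.s g) (𝒢.unitPt (𝒢.s g))) ⟨g, rfl⟩

theorem coef_eq (a : 𝒢.ReducedCStar) (x : X) (g : {g : G // 𝒢.s g = x}) :
    𝒢.coef a g = (𝒢.toFam a).op x (𝒢.delta x (𝒢.unitPt x)) g := by
  obtain ⟨g, rfl⟩ := g
  rfl

theorem coef_ofCc (f : C_c(G, ℂ)) (g : G) : 𝒢.coef (𝒢.ofCc f) g = f g := by
  rw [coef, toFam_ofCc, regFam_op, regRep_delta, unitPt, 𝒢.mul_unit_inv _ rfl]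

theorem coef_sub (a b : 𝒢.ReducedCStar) (g : G) :
    𝒢.coef (a - b) g = 𝒢.coef a g - 𝒢.coef b g := rfl

theorem norm_coef_le (a : 𝒢.ReducedCStar) (g : G) : ‖𝒢.coef a g‖ ≤ ‖a‖ := by
  refine (lp.norm_apply_le_norm (by simp) _ _).trans ?_
  refine (((𝒢.toFam a).op _).le_opNorm _).trans ?_
  rw [norm_delta, mul_one]
  exact BddFam.norm_op_le _ _

theorem lipschitzWith_coef (g : G) : LipschitzWith 1 fun a => 𝒢.coef a g :=
  LipschitzWith.of_dist_le_mul fun a b => by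
    simpa only [dist_eq_norm, ← coef_sub, NNReal.coe_one, one_mul] using 𝒢.norm_coef_le (a - b) g

theorem continuous_coef_left (g : G) : Continuous fun a => 𝒢.coef a g :=
  (𝒢.lipschitzWith_coef g).continuous

theorem continuous_coef (a : 𝒢.ReducedCStar) : Continuous (𝒢.coef a) := by
  refine continuous_of_uniform_approx_of_continuous fun u hu => ?_
  obtain ⟨ε, hε, hu⟩ := Metric.mem_uniformity_dist.1 hu
  obtain ⟨_, ⟨f, rfl⟩, hf⟩ := Metric.mem_closure_iff.1 (𝒢.denseRange_ofCc a) ε hε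
  refine ⟨f, f.continuous, fun g => hu ?_⟩
  rw [← 𝒢.coef_ofCc f]
  simpa using ((𝒢.lipschitzWith_coef g).dist_le_mul a (𝒢.ofCc f)).trans_lt (by simpa using hf)

theorem coef_star (a : 𝒢.ReducedCStar) (g : G) :
    𝒢.coef (star a) g = starRingEnd ℂ (𝒢.coef a (𝒢.inv g)) := by
  refine congrFun (𝒢.denseRange_ofCc.equalizer
    ((𝒢.continuous_coef_left g).comp continuous_star)
    (Complex.continuous_conj.comp (𝒢.continuous_coef_left _)) (funext fun f => ?_)) a
  simp only [Function.comp_apply]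
  rw [← 𝒢.ofCc_invol, coef_ofCc, coef_ofCc]
  rfl

theorem continuous_sigma (c : 𝒢.RealHom) (t : ℝ) : Continuous (sigma c t) :=
  AddMonoidHomClass.continuous_of_bound (sigma c t) 1 fun a => by
    rw [StarAlgEquiv.norm_map, one_mul]

theorem coef_sigma (c : 𝒢.RealHom) (t : ℝ) (a : 𝒢.ReducedCStar) (g : G) :
    𝒢.coef (sigma c t a) g = phase c t g * 𝒢.coef a g := by
  refine congrFun (𝒢.denseRange_ofCc.equalizer
    ((𝒢.continuous_coef_left g).comp (𝒢.continuous_sigma c t))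
    (continuous_const.mul (𝒢.continuous_coef_left g)) (funext fun f => ?_)) a
  change 𝒢.coef (sigma c t (𝒢.ofCc f)) g = phase c t g * 𝒢.coef (𝒢.ofCc f) g
  rw [sigma_ofCc, coef_ofCc, coef_ofCc]
  rfl

theorem coef_diagElt_mul (p : C_c(X, ℝ)) (a : 𝒢.ReducedCStar) (g : G) :
    𝒢.coef (𝒢.diagElt p * a) g = p (𝒢.r g) * 𝒢.coef a g := by
  rw [coef, toFam_mul_apply, toFam_diagElt_apply]
  rfl

theorem coef_mul_diagElt (p : C_c(X, ℝ)) (a : 𝒢.ReducedCStar) (g : G) :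
    𝒢.coef (a * 𝒢.diagElt p) g = 𝒢.coef a g * p (𝒢.s g) := by
  have h : a * 𝒢.diagElt p = star (𝒢.diagElt p * star a) := by
    rw [star_mul, star_star, (𝒢.isSelfAdjoint_diagElt p).star_eq]
  rw [h, coef_star, coef_diagElt_mul, coef_star, 𝒢.inv_inv, 𝒢.r_inv, map_mul, Complex.conj_conj,
    Complex.conj_ofReal, mul_comm]

theorem diagElt_mul_ofCc {p : C_c(X, ℝ)} {f h : C_c(G, ℂ)} (e : ∀ g, p (𝒢.r g) * f g = h g) :
    𝒢.diagElt p * 𝒢.ofCc f = 𝒢.ofCc h := by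
  rw [diagElt, ← ofCc_conv]
  congr 1
  refine CompactlySupportedContinuousMap.ext fun g => ?_
  rw [← 𝒢.coef_ofCc (𝒢.conv _ _), ofCc_conv, ← diagElt, coef_diagElt_mul, coef_ofCc, e]

theorem ofCc_mul_diagElt {p : C_c(X, ℝ)} {f h : C_c(G, ℂ)} (e : ∀ g, f g * p (𝒢.s g) = h g) :
    𝒢.ofCc f * 𝒢.diagElt p = 𝒢.ofCc h := by
  rw [diagElt, ← ofCc_conv]
  congr 1
  refine CompactlySupportedContinuousMap.ext fun g => ?_
  rw [← 𝒢.coef_ofCc (𝒢.conv _ _), ofCc_conv, ← diagElt, coef_mul_diagElt, coef_ofCc, e]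

end Coef

section CondExp

variable {G X : Type*} [TopologicalSpace G] [TopologicalSpace X] [T2Space G] [LocallyCompactSpace G]
  (𝒢 : EtaleGroupoid G X)

theorem condExp_eq_coef (a : 𝒢.ReducedCStar) (x : X) : 𝒢.condExp a x = 𝒢.coef a (𝒢.unit x) := by
  change 𝒢.diagCoeff (𝒢.toFam a) x = _
  rw [diagCoeff, inner_delta]
  exact (𝒢.coef_eq a x (𝒢.unitPt x)).symm

theorem condExp_add (a b : 𝒢.ReducedCStar) (x : X) :
    𝒢.condExp (a + b) x = 𝒢.condExp a x + 𝒢.condExp b x := by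
  simp only [condExp_eq_coef]
  rfl

theorem condExp_smul (z : ℂ) (a : 𝒢.ReducedCStar) (x : X) :
    𝒢.condExp (z • a) x = z * 𝒢.condExp a x := by
  simp only [condExp_eq_coef]
  rfl

theorem condExp_sigma (c : 𝒢.RealHom) (t : ℝ) (a : 𝒢.ReducedCStar) (x : X) :
    𝒢.condExp (sigma c t a) x = 𝒢.condExp a x := by
  rw [condExp_eq_coef, coef_sigma, phase_unit, one_mul, condExp_eq_coef]

theorem condExp_diagElt (p : C_c(X, ℝ)) (x : X) : 𝒢.condExp (𝒢.diagElt p) x = p x := by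
  rw [diagElt, condExp_ofCc, diag_unit]

theorem condExp_diagElt_mul_mul (p q : C_c(X, ℝ)) (a : 𝒢.ReducedCStar) (x : X) :
    𝒢.condExp (𝒢.diagElt p * a * 𝒢.diagElt q) x = p x * q x * 𝒢.condExp a x := by
  rw [condExp_eq_coef, coef_mul_diagElt, coef_diagElt_mul, condExp_eq_coef, 𝒢.r_unit, 𝒢.s_unit]
  ring

theorem hasSum_condExp_star_mul (a b : 𝒢.ReducedCStar) (x : X) :
    HasSum (fun g : {g : G // 𝒢.s g = x} => starRingEnd ℂ (𝒢.coef a g) * 𝒢.coef b g)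
      (𝒢.condExp (star a * b) x) := by
  have hinner : 𝒢.condExp (star a * b) x =
      inner ℂ ((𝒢.toFam a).op x (𝒢.delta x (𝒢.unitPt x)))
        ((𝒢.toFam b).op x (𝒢.delta x (𝒢.unitPt x))) := by
    change inner ℂ _ ((ContinuousLinearMap.adjoint ((𝒢.toFam a).op x)) ((𝒢.toFam b).op x _)) = _
    rw [ContinuousLinearMap.adjoint_inner_right]
  have hsum := lp.hasSum_inner (𝕜 := ℂ) ((𝒢.toFam a).op x (𝒢.delta x (𝒢.unitPt x)))
    ((𝒢.toFam b).op x (𝒢.delta x (𝒢.unitPt x)))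
  simp only [← 𝒢.coef_eq, RCLike.inner_apply, mul_comm (𝒢.coef b _)] at hsum
  rwa [hinner]

theorem hasSum_condExp_star_mul_self (a : 𝒢.ReducedCStar) (x : X) :
    HasSum (fun g : {g : G // 𝒢.s g = x} => ‖𝒢.coef a g‖ ^ 2) (𝒢.condExp (star a * a) x).re := by
  have hsum := Complex.hasSum_re (𝒢.hasSum_condExp_star_mul a a x)
  simp only [Complex.conj_mul', ← Complex.ofReal_pow, Complex.ofReal_re] at hsum
  exact hsum

open scoped ComplexOrder in
theorem condExp_nonneg {a : 𝒢.ReducedCStar} (ha : 0 ≤ a) (x : X) : 0 ≤ 𝒢.condExp a x := by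
  obtain ⟨b, rfl⟩ := CStarAlgebra.nonneg_iff_eq_star_mul_self.1 ha
  refine (𝒢.hasSum_condExp_star_mul b b x).nonneg fun g => ?_
  rw [Complex.conj_mul']
  positivity

end CondExp

section LocalUnits

variable {G X : Type*} [TopologicalSpace G] [TopologicalSpace X] [T2Space G] [LocallyCompactSpace G]
  (𝒢 : EtaleGroupoid G X)

theorem exists_norm_ofCc_le (f : C_c(G, ℂ)) : ∃ C : ℝ, 0 ≤ C ∧ ∀ (h : C_c(G, ℂ)) (M : ℝ), 0 ≤ M →
    (∀ g, f g = 0 → h g = 0) → (∀ g, ‖h g‖ ≤ M) → ‖𝒢.ofCc h‖ ≤ C * M := by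
  classical
  obtain ⟨N, hN⟩ := 𝒢.exists_row_bound f
  obtain ⟨N', hN'⟩ := 𝒢.exists_col_bound f
  refine ⟨√(N * N'), Real.sqrt_nonneg _, fun h M hM₀ hfh hM => ?_⟩
  have hCM : 0 ≤ √(N * N') * M := by positivity
  refine 𝒢.norm_le_of_forall_op hCM fun x => ContinuousLinearMap.opNorm_le_bound _ hCM fun ψ => ?_
  refine lp.norm_le_of_forall_sum_le (by simp) (by positivity) fun S => ?_
  have hsum (g : {g : G // 𝒢.s g = x}) : 𝒢.regFun h x ψ g =
      ∑ k ∈ (𝒢.finite_row f x g).toFinset, h (𝒢.mul g (𝒢.inv k)) * ψ k := by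
    rw [𝒢.regFun_eq]
    refine tsum_eq_sum fun k hk => ?_
    simp only [Set.Finite.mem_toFinset, Set.mem_ofPred_eq, not_not] at hk
    rw [hfh _ hk, zero_mul]
  have hψ (T : Finset {g : G // 𝒢.s g = x}) : ∑ k ∈ T, ‖ψ k‖ ^ 2 ≤ ‖ψ‖ ^ 2 := by
    simpa using lp.sum_rpow_le_norm_rpow (p := 2) (by simp) ψ T
  simp only [ENNReal.toReal_ofNat, Real.rpow_ofNat, mul_pow]
  rw [Real.sq_sqrt (by positivity)]
  calc ∑ g ∈ S, ‖𝒢.regFun h x ψ g‖ ^ 2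
      ≤ N * N' * M ^ 2 * ∑ k ∈ S.biUnion fun g => (𝒢.finite_row f x g).toFinset, ‖ψ k‖ ^ 2 := by
        simp only [hsum]
        exact sum_norm_sum_sq_le _ (fun _ _ => hM _) (hN x)
          (fun k T hT => hN' x k T fun g hg => by simpa using hT g hg) _ S
    _ ≤ N * N' * M ^ 2 * ‖ψ‖ ^ 2 := by
        gcongr
        exact hψ _

theorem exists_local_unit (f : C_c(G, ℂ)) : ∃ p : C_c(X, ℝ), (∀ x, 0 ≤ p x ∧ p x ≤ 1) ∧
    𝒢.diagElt p * 𝒢.ofCc f = 𝒢.ofCc f ∧ 𝒢.ofCc f * 𝒢.diagElt p = 𝒢.ofCc f := by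
  have := 𝒢.t2Space_units
  have := 𝒢.locallyCompactSpace_units
  have hf : IsCompact (tsupport f) := f.hasCompactSupport
  obtain ⟨p, hone, -, hp⟩ := exists_bump
    ((hf.image 𝒢.continuous_r).union (hf.image 𝒢.continuous_s)) isOpen_univ (Set.subset_univ _)
  refine ⟨p, hp, 𝒢.diagElt_mul_ofCc fun g => ?_, 𝒢.ofCc_mul_diagElt fun g => ?_⟩ <;>
    by_cases hg : g ∈ tsupport f
  · rw [hone _ (Or.inl ⟨g, hg, rfl⟩), Complex.ofReal_one, one_mul]
  · rw [image_eq_zero_of_notMem_tsupport hg, mul_zero]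
  · rw [hone _ (Or.inr ⟨g, hg, rfl⟩), Complex.ofReal_one, mul_one]
  · rw [image_eq_zero_of_notMem_tsupport hg, zero_mul]

theorem exists_approx_unit (a : 𝒢.ReducedCStar) {ε : ℝ} (hε : 0 < ε) :
    ∃ p : C_c(X, ℝ), (∀ x, 0 ≤ p x ∧ p x ≤ 1) ∧ ‖𝒢.diagElt p * a * 𝒢.diagElt p - a‖ < ε := by
  obtain ⟨_, ⟨f, rfl⟩, hf⟩ := Metric.mem_closure_iff.1 (𝒢.denseRange_ofCc a) (ε / 2) (half_pos hε)
  rw [dist_eq_norm] at hf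
  obtain ⟨p, hp, hleft, hright⟩ := 𝒢.exists_local_unit f
  refine ⟨p, hp, ?_⟩
  have hnorm : ‖𝒢.diagElt p‖ ≤ 1 := 𝒢.norm_diagElt_le p zero_le_one fun x => by
    rw [abs_of_nonneg (hp x).1]
    exact (hp x).2
  calc ‖𝒢.diagElt p * a * 𝒢.diagElt p - a‖
      = ‖𝒢.diagElt p * (a - 𝒢.ofCc f) * 𝒢.diagElt p - (a - 𝒢.ofCc f)‖ := by
        rw [mul_sub, sub_mul, hleft, hright]
        congr 1
        abel
    _ ≤ ‖𝒢.diagElt p‖ * ‖a - 𝒢.ofCc f‖ * ‖𝒢.diagElt p‖ + ‖a - 𝒢.ofCc f‖ := by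
        refine (norm_sub_le _ _).trans ?_
        gcongr
        exact (norm_mul_le _ _).trans (by gcongr; exact norm_mul_le _ _)
    _ ≤ 1 * ‖a - 𝒢.ofCc f‖ * 1 + ‖a - 𝒢.ofCc f‖ := by gcongr
    _ < ε := by linarith

end LocalUnits

section AvgMult

variable {G X : Type*} [TopologicalSpace G] [TopologicalSpace X]
  {𝒢 : EtaleGroupoid G X} (c : 𝒢.RealHom)

/-- The function on `G` by which `orbitAvg (sigma c) n` multiplies the elements of `C_c(G)`. -/
def avgMult (n : ℕ) : C(G, ℂ) where
  toFun g := ((n + 1 : ℂ) ^ 2)⁻¹ * ∑ j ∈ Finset.range ((n + 1) ^ 2), phase c (j / (n + 1)) g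
  continuous_toFun := by
    have := c.continuous_toFun
    unfold phase
    fun_prop

theorem avgMult_apply (n : ℕ) (g : G) : avgMult c n g =
    ((n + 1 : ℂ) ^ 2)⁻¹ * ∑ j ∈ Finset.range ((n + 1) ^ 2), phase c (j / (n + 1)) g := rfl

theorem norm_avgMult_le (n : ℕ) {g : G} (hg : c g ≠ 0) (hn : |c g| ≤ n) :
    ‖avgMult c n g‖ ≤ Real.pi / ((n + 1) * |c g|) := by
  have hn₁ : (0 : ℝ) < n + 1 := by positivity
  have habs : |c g / (n + 1)| = |c g| / (n + 1) := by rw [abs_div, abs_of_pos hn₁]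
  have hpow (j : ℕ) : phase c (j / (n + 1)) g =
      Complex.exp (Complex.I * ((c g / (n + 1) : ℝ) : ℂ)) ^ j := by
    rw [phase, ← Complex.exp_nat_mul]
    congr 1
    push_cast
    ring
  have hgeom := norm_sum_exp_le (x := c g / (n + 1)) (div_ne_zero hg hn₁.ne') (by
    rw [habs, div_le_iff₀ hn₁]
    nlinarith [Real.pi_gt_three]) ((n + 1) ^ 2)
  have hnorm : ‖((n + 1 : ℂ) ^ 2)⁻¹‖ = ((n + 1 : ℝ) ^ 2)⁻¹ := by
    rw [norm_inv, norm_pow]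
    norm_cast
  rw [avgMult_apply, norm_mul, hnorm]
  simp only [hpow]
  have := abs_pos.2 hg
  calc _ ≤ ((n + 1 : ℝ) ^ 2)⁻¹ * (Real.pi / |c g / (n + 1)|) := by gcongr
    _ = Real.pi / ((n + 1) * |c g|) := by rw [habs]; field_simp

theorem exists_add_eq_of_isOpen_ker (hopen : IsOpen {g | c g = 0}) (f : C_c(G, ℂ)) :
    ∃ f₀ f₁ : C_c(G, ℂ), f = f₀ + f₁ ∧ (∀ g, c g ≠ 0 → f₀ g = 0) ∧
      tsupport f₁ ⊆ {g | c g ≠ 0} := by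
  have hclopen : IsClopen {g | c g = 0} :=
    ⟨isClosed_eq c.continuous_toFun continuous_const, hopen⟩
  let χ : C(G, ℂ) := ⟨LocallyConstant.charFn ℂ hclopen,
    (LocallyConstant.charFn ℂ hclopen).continuous⟩
  have hχ (g : G) : χ g = {g | c g = 0}.indicator 1 g :=
    congrFun (LocallyConstant.coe_charFn ℂ hclopen) g
  refine ⟨χ • f, (1 - χ) • f, ?_, fun g hg => ?_, ?_⟩
  · refine CompactlySupportedContinuousMap.ext fun g => ?_
    change f g = χ g * f g + (1 - χ g) * f g
    ring
  · change χ g * f g = 0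
    rw [hχ, Set.indicator_of_notMem (by exact hg), zero_mul]
  · refine closure_minimal (fun g hg h₀ => hg ?_) hopen.isClosed_compl
    change (1 - χ g) * f g = 0
    rw [hχ, Set.indicator_of_mem (by exact h₀), Pi.one_apply, sub_self, zero_mul]

end AvgMult

section MeanErgodic

variable {G X : Type*} [TopologicalSpace G] [TopologicalSpace X] [T2Space G] [LocallyCompactSpace G]
  {𝒢 : EtaleGroupoid G X} (c : 𝒢.RealHom)

theorem orbitAvg_ofCc (n : ℕ) (f : C_c(G, ℂ)) :
    orbitAvg (sigma c) n (𝒢.ofCc f) = 𝒢.ofCc (avgMult c n • f) := by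
  have hf : avgMult c n • f = ((n + 1 : ℂ) ^ 2)⁻¹ •
      ∑ j ∈ Finset.range ((n + 1) ^ 2), twist c (j / (n + 1)) f := by
    refine CompactlySupportedContinuousMap.ext fun g => ?_
    rw [CompactlySupportedContinuousMap.smul_apply, CompactlySupportedContinuousMap.sum_apply]
    change (_ * _) * f g = _ * ∑ j ∈ _, _ * f g
    rw [_root_.mul_assoc, Finset.sum_mul]
  have hofCc : 𝒢.ofCc (avgMult c n • f) = ((n + 1 : ℂ) ^ 2)⁻¹ •
      ∑ j ∈ Finset.range ((n + 1) ^ 2), 𝒢.ofCc (twist c (j / (n + 1)) f) := by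
    rw [hf]
    exact (map_smul 𝒢.ofCcLin _ _).trans (congrArg _ (map_sum 𝒢.ofCcLin _ _))
  rw [hofCc, orbitAvg, ← Complex.coe_smul]
  simp only [sigma_ofCc]
  push_cast
  rfl

/- On `tsupport f` the cocycle satisfies `δ ≤ |c| ≤ R`, so that the multipliers `avgMult c n` are
bounded by `π / ((n + 1) δ)` there as soon as `R ≤ n`. -/
theorem tendsto_orbitAvg_zero {f : C_c(G, ℂ)} (hf : tsupport f ⊆ {g | c g ≠ 0}) :
    Tendsto (fun n => orbitAvg (sigma c) n (𝒢.ofCc f)) atTop (𝓝 0) := by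
  obtain ⟨C, -, hC⟩ := 𝒢.exists_norm_ofCc_le f
  obtain ⟨M, hM⟩ := f.hasCompactSupport.exists_bound_of_continuous f.continuous
  obtain ⟨δ, hδ, R, hδR⟩ := exists_pos_le_abs_le_of_isCompact f.hasCompactSupport.isCompact
    c.continuous_toFun.continuousOn hf
  have hlim : Tendsto (fun n : ℕ => C * (Real.pi / ((n + 1) * δ) * max M 0)) atTop (𝓝 0) := by
    have h := (tendsto_one_div_add_atTop_nhds_zero_nat (𝕜 := ℝ)).const_mul
      (C * (Real.pi / δ * max M 0))
    rw [mul_zero] at h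
    refine h.congr fun n => ?_
    have : (n : ℝ) + 1 ≠ 0 := by positivity
    field_simp
  refine squeeze_zero_norm' ?_ hlim
  filter_upwards [eventually_ge_atTop ⌈R⌉₊] with n hn
  rw [orbitAvg_ofCc]
  refine hC _ _ (by positivity) (fun g hg => ?_) fun g => ?_
  · change _ * f g = 0
    rw [hg, mul_zero]
  · change ‖avgMult c n g * f g‖ ≤ _
    rw [norm_mul]
    by_cases hg : g ∈ tsupport f
    · obtain ⟨hδg, hgR⟩ := hδR g hg
      have hgn : |c g| ≤ n := hgR.trans ((Nat.le_ceil R).trans (by exact_mod_cast hn))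
      have hmult : ‖avgMult c n g‖ ≤ Real.pi / ((n + 1) * δ) :=
        (norm_avgMult_le c n (hf hg) hgn).trans (by gcongr)
      exact mul_le_mul hmult ((hM g).trans (le_max_left _ _)) (norm_nonneg _) (by positivity)
    · rw [image_eq_zero_of_notMem_tsupport hg, norm_zero, mul_zero]
      positivity

theorem sigma_ofCc_eq_self {f : C_c(G, ℂ)} (hf : ∀ g, c g ≠ 0 → f g = 0) (t : ℝ) :
    sigma c t (𝒢.ofCc f) = 𝒢.ofCc f := by
  rw [sigma_ofCc]
  congr 1
  refine CompactlySupportedContinuousMap.ext fun g => ?_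
  change phase c t g * f g = f g
  by_cases hg : c g = 0
  · simp [phase, hg]
  · rw [hf g hg, mul_zero]

theorem isMeanErgodic_sigma (hopen : IsOpen {g | c g = 0}) : IsMeanErgodic (sigma c) := by
  refine isMeanErgodic_of_dense 𝒢.denseRange_ofCc ?_
  rintro _ ⟨f, rfl⟩
  obtain ⟨f₀, f₁, rfl, hf₀, hf₁⟩ := exists_add_eq_of_isOpen_ker c hopen f
  have hfix : ∀ t, sigma c t (𝒢.ofCc f₀) = 𝒢.ofCc f₀ :=
    sigma_ofCc_eq_self c hf₀
  refine ⟨𝒢.ofCc f₀, ?_, hfix⟩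
  have hlim := (tendsto_orbitAvg_zero c hf₁).add_const (𝒢.ofCc f₀)
  rw [zero_add] at hlim
  refine hlim.congr fun n => ?_
  have hsub : 𝒢.ofCc f₁ = 𝒢.ofCc (f₀ + f₁) - 𝒢.ofCc f₀ := by
    rw [ofCc_add, add_sub_cancel_left]
  rw [hsub, orbitAvg_sub, orbitAvg_eq_self n hfix, sub_add_cancel]

end MeanErgodic

section Bisections

variable {G X : Type*} [TopologicalSpace G] [TopologicalSpace X] (𝒢 : EtaleGroupoid G X)

theorem exists_bisection_subset {g : G} {U : Set G} (hU : U ∈ 𝓝 g) :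
    ∃ W ⊆ U, IsOpen W ∧ g ∈ W ∧ Set.InjOn 𝒢.r W ∧ Set.InjOn 𝒢.s W := by
  obtain ⟨V, hVU, hV, hgV⟩ := mem_nhds_iff.1 hU
  obtain ⟨e, he, hr⟩ := 𝒢.isLocalHomeomorph_r g
  obtain ⟨e', he', hs⟩ := 𝒢.isLocalHomeomorph_s g
  refine ⟨V ∩ (e.source ∩ e'.source), Set.inter_subset_left.trans hVU,
    hV.inter (e.open_source.inter e'.open_source), ⟨hgV, he, he'⟩, ?_, ?_⟩
  · rw [hr]
    exact e.injOn.mono fun w hw => hw.2.1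
  · rw [hs]
    exact e'.injOn.mono fun w hw => hw.2.2

theorem injOn_s_preimage_inv {W : Set G} (hr : Set.InjOn 𝒢.r W) :
    Set.InjOn 𝒢.s (𝒢.inv ⁻¹' W) := fun g hg g' hg' h =>
  𝒢.inv_bijective.1 (hr hg hg' (by rw [𝒢.r_inv, 𝒢.r_inv, h]))

theorem injOn_r_preimage_inv {W : Set G} (hs : Set.InjOn 𝒢.s W) :
    Set.InjOn 𝒢.r (𝒢.inv ⁻¹' W) := fun g hg g' hg' h =>
  𝒢.inv_bijective.1 (hs hg hg' (by rw [𝒢.s_inv, 𝒢.s_inv, h]))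

theorem preimage_inv_preimage_inv (W : Set G) : 𝒢.inv ⁻¹' (𝒢.inv ⁻¹' W) = W :=
  Function.Involutive.preimage 𝒢.inv_inv W

theorem measure_ext_of_bisections [SecondCountableTopology G] [MeasurableSpace G] [BorelSpace G]
    {μ ν : Measure G} [IsLocallyFiniteMeasure μ]
    (h : ∀ W, IsOpen W → Set.InjOn 𝒢.r W → Set.InjOn 𝒢.s W → μ W = ν W) : μ = ν := by
  let S : Set (Set G) := {W | (IsOpen W ∧ Set.InjOn 𝒢.r W ∧ Set.InjOn 𝒢.s W) ∧ μ W < ∞}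
  have hbasis : TopologicalSpace.IsTopologicalBasis S := by
    refine TopologicalSpace.isTopologicalBasis_of_isOpen_of_nhds (fun W hW => hW.1.1) ?_
    intro g U hg hU
    obtain ⟨V, hgV, hV, hVfin⟩ := μ.exists_isOpen_measure_lt_top g
    obtain ⟨W, hWV, hW, hgW, hr, hs⟩ :=
      𝒢.exists_bisection_subset ((hU.inter hV).mem_nhds ⟨hg, hgV⟩)
    exact ⟨W, ⟨⟨hW, hr, hs⟩, (measure_mono fun w hw => (hWV hw).2).trans_lt hVfin⟩, hgW,
      fun w hw => (hWV hw).1⟩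
  obtain ⟨T, hT, hTS, hcover⟩ :=
    TopologicalSpace.isOpen_sUnion_countable S fun W hW => hW.1.1
  refine Measure.ext_of_generateFrom_of_cover_subset ?_ ?_ hTS hT
    (hcover.trans hbasis.sUnion_eq) (fun W hW => (hTS hW).2.ne)
    fun W ⟨⟨hW, hr, hs⟩, _⟩ => h W hW hr hs
  · rw [BorelSpace.measurable_eq (α := G), hbasis.borel_eq_generateFrom]
  · rintro V ⟨⟨hV, hr, hs⟩, hfin⟩ W ⟨⟨hW, -, -⟩, -⟩ -
    exact ⟨⟨hV.inter hW, hr.mono Set.inter_subset_left, hs.mono Set.inter_subset_left⟩,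
      (measure_mono Set.inter_subset_left).trans_lt hfin⟩

theorem measurable_exp_cocycle [MeasurableSpace G] [OpensMeasurableSpace G] {𝒢 : EtaleGroupoid G X}
    (c : 𝒢.RealHom) (β : ℝ) : Measurable fun g => ENNReal.ofReal (Real.exp (-β * c g)) := by
  have := c.continuous_toFun.measurable
  fun_prop

end Bisections

section FibreMeasure

variable {G X : Type*} [TopologicalSpace G] [TopologicalSpace X] [SecondCountableTopology G]
  [MeasurableSpace G] [BorelSpace G] [MeasurableSpace X] [BorelSpace X] (𝒢 : EtaleGroupoid G X)

/- Make the domains of countably many charts of `s` disjoint. -/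
theorem exists_sections : ∃ (D : ℕ → Set X) (τ : ℕ → X → G), (∀ n, MeasurableSet (D n)) ∧
    (∀ n, Measurable (τ n)) ∧
    ∀ x, Set.BijOn (fun n => τ n x) {n | x ∈ D n} {g | 𝒢.s g = x} := by
  classical
  rcases isEmpty_or_nonempty G with hG | ⟨⟨g₀⟩⟩
  · have : IsEmpty X := ⟨fun x => hG.false (𝒢.unit x)⟩
    exact ⟨fun _ => ∅, fun _ => isEmptyElim, by simp, fun _ => measurable_of_empty _, isEmptyElim⟩
  have : Nonempty G := ⟨g₀⟩
  obtain ⟨e, hse, hcover⟩ := exists_seq_openPartialHomeomorph 𝒢.isLocalHomeomorph_s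
  let U : ℕ → Set G := disjointed fun n => (e n).source
  have hU (n : ℕ) : U n ⊆ (e n).source := disjointed_subset _ n
  let τ (n : ℕ) : X → G := (e n).target.piecewise (e n).symm fun _ => g₀
  have hτ (n : ℕ) : Measurable (τ n) :=
    ContinuousOn.measurable_piecewise (e n).continuousOn_symm continuousOn_const
      (e n).open_target.measurableSet
  have hsymm {n : ℕ} {x : X} (hx : x ∈ (e n).target) : τ n x = (e n).symm x :=
    Set.piecewise_eq_of_mem _ _ _ hx
  refine ⟨fun n => (e n).target ∩ τ n ⁻¹' U n, τ, fun n => ?_, hτ, fun x => ⟨?_, ?_, ?_⟩⟩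
  · exact (e n).open_target.measurableSet.inter
      (hτ n (.disjointed (fun n => (e n).open_source.measurableSet) n))
  · rintro n ⟨hx, -⟩
    change 𝒢.s (τ n x) = x
    rw [hsymm hx, hse n]
    exact (e n).right_inv hx
  · rintro n ⟨-, hn⟩ k ⟨-, hk⟩ (h : τ n x = τ k x)
    by_contra hne
    refine Set.disjoint_left.1 (disjoint_disjointed (fun n => (e n).source) hne) hn ?_
    rw [h]
    exact hk
  · rintro g rfl
    obtain ⟨n, hn⟩ : ∃ n, g ∈ U n := by
      rw [← Set.mem_iUnion, iUnion_disjointed, hcover]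
      trivial
    have hx : 𝒢.s g ∈ (e n).target := by
      rw [hse n]
      exact (e n).map_source (hU n hn)
    have hg : τ n (𝒢.s g) = g := by
      rw [hsymm hx, hse n]
      exact (e n).left_inv (hU n hn)
    exact ⟨n, ⟨hx, by rwa [Set.mem_preimage, hg]⟩, hg⟩

/-- The domains of a sequence of Borel sections of the source map which together run through each
of its fibres exactly once. -/
def sectionDomain : ℕ → Set X := 𝒢.exists_sections.choose

/-- The sections that belong to the domains `sectionDomain`; the values outside of these domains
are irrelevant. -/
def sectionMap : ℕ → X → G := 𝒢.exists_sections.choose_spec.choose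

theorem measurableSet_sectionDomain (n : ℕ) : MeasurableSet (𝒢.sectionDomain n) :=
  𝒢.exists_sections.choose_spec.choose_spec.1 n

theorem measurable_sectionMap (n : ℕ) : Measurable (𝒢.sectionMap n) :=
  𝒢.exists_sections.choose_spec.choose_spec.2.1 n

theorem bijOn_sectionMap (x : X) :
    Set.BijOn (fun n => 𝒢.sectionMap n x) {n | x ∈ 𝒢.sectionDomain n} {g | 𝒢.s g = x} :=
  𝒢.exists_sections.choose_spec.choose_spec.2.2 x

/-- The measure `∫ ∑_{s(g) = x} δ_g dm(x)` on `G` obtained by integrating the counting measures on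
the fibres of the source map. It is assembled from Borel sections of that map; by
`lintegral_fibreMeasure` it does not depend on them. -/
def fibreMeasure (m : Measure X) : Measure G :=
  Measure.sum fun n => (m.restrict (𝒢.sectionDomain n)).map (𝒢.sectionMap n)

theorem tsum_fibre_eq {α : Type*} [AddCommMonoid α] [TopologicalSpace α] (F : G → α) (x : X) :
    ∑' g : {g : G // 𝒢.s g = x}, F g =
      ∑' n, (𝒢.sectionDomain n).indicator (F ∘ 𝒢.sectionMap n) x := by
  classical
  let e : {n | x ∈ 𝒢.sectionDomain n} ≃ {g : G // 𝒢.s g = x} := (𝒢.bijOn_sectionMap x).equiv _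
  refine (e.tsum_eq fun g => F g).symm.trans ?_
  refine (tsum_subtype {n | x ∈ 𝒢.sectionDomain n} fun n => F (𝒢.sectionMap n x)).trans ?_
  exact tsum_congr fun n => by
    simp only [Set.indicator_apply]
    rfl

theorem lintegral_fibreMeasure (m : Measure X) {f : G → ℝ≥0∞} (hf : Measurable f) :
    ∫⁻ g, f g ∂(𝒢.fibreMeasure m) = ∫⁻ x, ∑' g : {g : G // 𝒢.s g = x}, f g ∂m := by
  simp only [tsum_fibre_eq]
  rw [lintegral_tsum fun n => ((hf.comp (𝒢.measurable_sectionMap n)).indicator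
    (𝒢.measurableSet_sectionDomain n)).aemeasurable, fibreMeasure, lintegral_sum_measure]
  refine tsum_congr fun n => ?_
  rw [lintegral_map hf (𝒢.measurable_sectionMap n),
    ← lintegral_indicator (𝒢.measurableSet_sectionDomain n)]
  rfl

theorem integral_fibreMeasure (m : Measure X) {f : G → ℂ} (hf : Measurable f)
    (hi : Integrable f (𝒢.fibreMeasure m)) :
    ∫ g, f g ∂(𝒢.fibreMeasure m) = ∫ x, ∑' g : {g : G // 𝒢.s g = x}, f g ∂m := by
  simp only [tsum_fibre_eq]
  rw [integral_tsum fun n => ((hf.comp (𝒢.measurable_sectionMap n)).indicator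
    (𝒢.measurableSet_sectionDomain n)).aestronglyMeasurable, fibreMeasure, integral_sum_measure hi]
  · refine tsum_congr fun n => ?_
    rw [integral_map (𝒢.measurable_sectionMap n).aemeasurable hf.aestronglyMeasurable,
      ← integral_indicator (𝒢.measurableSet_sectionDomain n)]
    rfl
  · have hfin : ∫⁻ g, ‖f g‖ₑ ∂(𝒢.fibreMeasure m) ≠ ∞ := hi.2.ne
    rw [𝒢.lintegral_fibreMeasure m hf.enorm] at hfin
    simp only [𝒢.tsum_fibre_eq fun g => ‖f g‖ₑ] at hfin
    rw [lintegral_tsum fun n => ((hf.enorm.comp (𝒢.measurable_sectionMap n)).indicator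
      (𝒢.measurableSet_sectionDomain n)).aemeasurable] at hfin
    convert hfin using 3 with n
    refine lintegral_congr fun x => ?_
    rw [enorm_indicator_eq_indicator_enorm]
    rfl

theorem fibreMeasure_apply (m : Measure X) {W : Set G} (hW : IsOpen W) (hs : Set.InjOn 𝒢.s W) :
    𝒢.fibreMeasure m W = m (𝒢.s '' W) := by
  rw [← lintegral_indicator_one hW.measurableSet, 𝒢.lintegral_fibreMeasure m
    (measurable_one.indicator hW.measurableSet), ← lintegral_indicator_one
    (𝒢.isLocalHomeomorph_s.isOpenMap W hW).measurableSet]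
  refine lintegral_congr fun x => ?_
  by_cases hx : x ∈ 𝒢.s '' W
  · obtain ⟨w, hw, rfl⟩ := hx
    rw [tsum_eq_single ⟨w, rfl⟩, Set.indicator_of_mem hw,
      Set.indicator_of_mem (Set.mem_image_of_mem _ hw)]
    · rfl
    · rintro ⟨g, hg⟩ hne
      exact Set.indicator_of_notMem (fun hgW => hne (Subtype.ext (hs hgW hw hg))) _
  · rw [Set.indicator_of_notMem hx, ENNReal.tsum_eq_zero]
    rintro ⟨g, rfl⟩
    exact Set.indicator_of_notMem (fun hgW => hx ⟨g, hgW, rfl⟩) _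

instance isLocallyFiniteMeasure_fibreMeasure (m : Measure X) [IsLocallyFiniteMeasure m] :
    IsLocallyFiniteMeasure (𝒢.fibreMeasure m) := by
  refine ⟨fun g => ?_⟩
  obtain ⟨V, hgV, hV, hVfin⟩ := m.exists_isOpen_measure_lt_top (𝒢.s g)
  obtain ⟨W, hWV, hW, hgW, -, hs⟩ :=
    𝒢.exists_bisection_subset ((hV.preimage 𝒢.continuous_s).mem_nhds hgV)
  refine ⟨W, hW.mem_nhds hgW, ?_⟩
  rw [𝒢.fibreMeasure_apply m hW hs]
  exact (measure_mono (Set.image_subset_iff.2 hWV)).trans_lt hVfin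

variable {𝒢} (c : 𝒢.RealHom) (β : ℝ)

theorem withDensity_fibreMeasure_apply (m : Measure X) {W : Set G} (hW : IsOpen W)
    (hr : Set.InjOn 𝒢.r W) :
    (𝒢.fibreMeasure m).withDensity (fun g => ENNReal.ofReal (Real.exp (-β * c g))) (𝒢.inv ⁻¹' W) =
      ∫⁻ x in 𝒢.r '' W, ENNReal.ofReal (Real.exp (β * c (𝒢.rInv W x))) ∂m := by
  have hW' : MeasurableSet (𝒢.inv ⁻¹' W) := (hW.preimage 𝒢.continuous_inv).measurableSet
  rw [withDensity_apply _ hW', ← lintegral_indicator hW', 𝒢.lintegral_fibreMeasure m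
    ((measurable_exp_cocycle c β).indicator hW'),
    ← lintegral_indicator (𝒢.isLocalHomeomorph_r.isOpenMap W hW).measurableSet]
  refine lintegral_congr fun x => ?_
  by_cases hx : x ∈ 𝒢.r '' W
  · obtain ⟨w, hw, rfl⟩ := hx
    have hmem : 𝒢.inv w ∈ 𝒢.inv ⁻¹' W := by
      rwa [Set.mem_preimage, 𝒢.inv_inv]
    rw [tsum_eq_single ⟨𝒢.inv w, 𝒢.s_inv w⟩, Set.indicator_of_mem hmem,
      Set.indicator_of_mem (Set.mem_image_of_mem _ hw), 𝒢.rInv_apply hr hw, c.map_inv,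
      neg_mul_neg]
    rintro ⟨g, hg⟩ hne
    refine Set.indicator_of_notMem (fun hgW => hne (Subtype.ext ?_)) _
    exact 𝒢.injOn_s_preimage_inv hr hgW hmem (hg.trans (𝒢.s_inv w).symm)
  · rw [Set.indicator_of_notMem hx, ENNReal.tsum_eq_zero]
    rintro ⟨g, rfl⟩
    exact Set.indicator_of_notMem (s := 𝒢.inv ⁻¹' W) (fun hgW => hx ⟨𝒢.inv g, hgW, 𝒢.r_inv g⟩) _

theorem map_inv_fibreMeasure_apply (m : Measure X) {W : Set G} (hW : IsOpen W)
    (hs : Set.InjOn 𝒢.s W) : (𝒢.fibreMeasure m).map 𝒢.inv (𝒢.inv ⁻¹' W) = m (𝒢.s '' W) := by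
  rw [Measure.map_apply 𝒢.continuous_inv.measurable
    (hW.preimage 𝒢.continuous_inv).measurableSet, preimage_inv_preimage_inv,
    𝒢.fibreMeasure_apply m hW hs]

theorem isConformal_iff (m : Measure X) [IsLocallyFiniteMeasure m] : IsConformal c β m ↔
    (𝒢.fibreMeasure m).map 𝒢.inv =
      (𝒢.fibreMeasure m).withDensity (fun g => ENNReal.ofReal (Real.exp (-β * c g))) := by
  constructor
  · intro hm
    have hcont := c.continuous_toFun
    have : IsLocallyFiniteMeasure ((𝒢.fibreMeasure m).withDensity
        fun g => ENNReal.ofReal (Real.exp (-β * c g))) :=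
      IsLocallyFiniteMeasure.withDensity_ofReal (by fun_prop)
    refine (𝒢.measure_ext_of_bisections fun W hW hr hs => ?_).symm
    have hW' := hW.preimage 𝒢.continuous_inv
    have hr' := 𝒢.injOn_r_preimage_inv hs
    have hs' := 𝒢.injOn_s_preimage_inv hr
    rw [← 𝒢.preimage_inv_preimage_inv W, withDensity_fibreMeasure_apply c β m hW' hr',
      map_inv_fibreMeasure_apply m hW' hs', hm _ hW' hr' hs']
  · intro hm W hW hr hs
    rw [← withDensity_fibreMeasure_apply c β m hW hr, ← hm, map_inv_fibreMeasure_apply m hW hs]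

end FibreMeasure

section CondExpEstimates

variable {G X : Type*} [TopologicalSpace G] [TopologicalSpace X] [T2Space G] [LocallyCompactSpace G]
  (𝒢 : EtaleGroupoid G X)

theorem continuous_condExp (a : 𝒢.ReducedCStar) : Continuous fun x => 𝒢.condExp a x :=
  (𝒢.condExp a).continuous

theorem continuous_condExp_left (x : X) : Continuous fun a => 𝒢.condExp a x := by
  simp only [condExp_eq_coef]
  exact 𝒢.continuous_coef_left _

theorem condExp_re_nonneg {a : 𝒢.ReducedCStar} (ha : 0 ≤ a) (x : X) : 0 ≤ (𝒢.condExp a x).re :=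
  (Complex.nonneg_iff.1 (𝒢.condExp_nonneg ha x)).1

theorem condExp_eq_re {a : 𝒢.ReducedCStar} (ha : 0 ≤ a) (x : X) :
    𝒢.condExp a x = ((𝒢.condExp a x).re : ℂ) :=
  Complex.eq_re_of_ofReal_le (r := 0) (by rw [Complex.ofReal_zero]; exact 𝒢.condExp_nonneg ha x)

theorem condExp_diagElt_conj_re (p : C_c(X, ℝ)) (a : 𝒢.ReducedCStar) (x : X) :
    (𝒢.condExp (𝒢.diagElt p * a * 𝒢.diagElt p) x).re = p x ^ 2 * (𝒢.condExp a x).re := by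
  rw [condExp_diagElt_mul_mul, ← Complex.ofReal_mul, Complex.re_ofReal_mul]
  ring

theorem norm_condExp_star_mul_le (a b : 𝒢.ReducedCStar) (x : X) :
    ‖𝒢.condExp (star a * b) x‖ ≤
      (𝒢.condExp (star a * a) x).re + (𝒢.condExp (star b * b) x).re :=
  (𝒢.hasSum_condExp_star_mul a b x).norm_le_of_bounded
    ((𝒢.hasSum_condExp_star_mul_self a x).add (𝒢.hasSum_condExp_star_mul_self b x))
    fun _ => norm_conj_mul_le _ _

end CondExpEstimates

section MeasureWeight

variable {G X : Type*} [TopologicalSpace G] [TopologicalSpace X] [T2Space G] [LocallyCompactSpace G]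
  [MeasurableSpace X] (𝒢 : EtaleGroupoid G X) (m : Measure X)

theorem posExt_weightOf {a : 𝒢.ReducedCStar} (ha : 0 ≤ a) :
    posExt (𝒢.weightOf m) a = ∫⁻ x, ENNReal.ofReal (𝒢.condExp a x).re ∂m :=
  posExt_of_nonneg ha

theorem isInvariantWeight_weightOf (c : 𝒢.RealHom) :
    IsInvariantWeight (𝒢.weightOf m) (sigma c) := fun t a =>
  lintegral_congr fun x => by rw [condExp_sigma]

end MeasureWeight

section ProperWeight

variable {G X : Type*} [TopologicalSpace G] [TopologicalSpace X] [T2Space G] [LocallyCompactSpace G]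
  [MeasurableSpace X] [BorelSpace X] (𝒢 : EtaleGroupoid G X) (m : Measure X)

theorem measurable_condExp (a : 𝒢.ReducedCStar) :
    Measurable fun x => ENNReal.ofReal (𝒢.condExp a x).re := by
  have := (𝒢.continuous_condExp a).measurable
  fun_prop

theorem weightOf_ne_zero [SecondCountableTopology G] (hm : m ≠ 0) : ∃ a, 𝒢.weightOf m a ≠ 0 := by
  have := 𝒢.t2Space_units
  have := 𝒢.locallyCompactSpace_units
  have := 𝒢.secondCountableTopology_units
  obtain ⟨n, hn⟩ : ∃ n, 0 < m (compactCovering X n) := by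
    refine exists_measure_pos_of_not_measure_iUnion_null fun h => hm ?_
    rwa [iUnion_compactCovering, Measure.measure_univ_eq_zero] at h
  have hK := isCompact_compactCovering X n
  obtain ⟨p, hone, -, -⟩ := exists_bump hK isOpen_univ (Set.subset_univ _)
  have hpos : 0 ≤ 𝒢.diagElt p * 𝒢.diagElt p := (𝒢.isSelfAdjoint_diagElt p).mul_self_nonneg
  refine ⟨⟨_, hpos⟩, (hn.trans_le ?_).ne'⟩
  change _ ≤ ∫⁻ x, ENNReal.ofReal (𝒢.condExp (𝒢.diagElt p * 𝒢.diagElt p) x).re ∂m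
  rw [← lintegral_indicator_one hK.measurableSet]
  refine lintegral_mono fun x => ?_
  by_cases hx : x ∈ compactCovering X n
  · rw [Set.indicator_of_mem hx, ← diagElt_mul, condExp_diagElt,
      CompactlySupportedContinuousMap.mul_apply, hone x hx]
    simp
  · rw [Set.indicator_of_notMem hx]
    exact zero_le

theorem weightOf_diagElt_conj_lt_top [IsFiniteMeasureOnCompacts m] (p : C_c(X, ℝ))
    (a : 𝒢.ReducedCStar) :
    ∫⁻ x, ENNReal.ofReal (𝒢.condExp (𝒢.diagElt p * a * 𝒢.diagElt p) x).re ∂m < ∞ := by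
  have := 𝒢.t2Space_units
  simp only [condExp_diagElt_conj_re]
  have hcont : Continuous fun x => p x ^ 2 * (𝒢.condExp a x).re := by
    have := 𝒢.continuous_condExp a
    fun_prop
  have hsupp : HasCompactSupport fun x => p x ^ 2 * (𝒢.condExp a x).re :=
    HasCompactSupport.intro p.hasCompactSupport fun x hx => by
      rw [image_eq_zero_of_notMem_tsupport hx]
      simp
  exact (hcont.integrable_of_hasCompactSupport hsupp).lintegral_lt_top

theorem weightOf_le_of_tendsto {u : ℕ → {a : 𝒢.ReducedCStar // 0 ≤ a}}
    {a : {a : 𝒢.ReducedCStar // 0 ≤ a}} (hu : Tendsto u atTop (𝓝 a)) {r : ℝ≥0∞}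
    (hr : ∀ n, 𝒢.weightOf m (u n) ≤ r) : 𝒢.weightOf m a ≤ r := by
  have hlim (x : X) : Tendsto (fun n => ENNReal.ofReal (𝒢.condExp (u n) x).re) atTop
      (𝓝 (ENNReal.ofReal (𝒢.condExp a x).re)) := by
    have hcont : Continuous fun a : {a : 𝒢.ReducedCStar // 0 ≤ a} =>
        ENNReal.ofReal (𝒢.condExp a x).re :=
      ENNReal.continuous_ofReal.comp
        (Complex.continuous_re.comp ((𝒢.continuous_condExp_left x).comp continuous_subtype_val))
    exact (hcont.tendsto a).comp hu
  calc 𝒢.weightOf m a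
      = ∫⁻ x, Filter.liminf (fun n => ENNReal.ofReal (𝒢.condExp (u n) x).re) atTop ∂m :=
        lintegral_congr fun x => (hlim x).liminf_eq.symm
    _ ≤ Filter.liminf (fun n => 𝒢.weightOf m (u n)) atTop :=
        lintegral_liminf_le fun n => 𝒢.measurable_condExp _
    _ ≤ r := Filter.liminf_le_of_frequently_le' (Filter.Frequently.of_forall hr)

theorem isProperWeight_weightOf [SecondCountableTopology G] [IsFiniteMeasureOnCompacts m]
    (hm : m ≠ 0) : IsProperWeight (𝒢.weightOf m) where
  map_add a b := by
    change ∫⁻ x, ENNReal.ofReal (𝒢.condExp (a + b : 𝒢.ReducedCStar) x).re ∂m = _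
    rw [weightOf, weightOf, ← lintegral_add_left (𝒢.measurable_condExp a)]
    refine lintegral_congr fun x => ?_
    rw [condExp_add, Complex.add_re, ENNReal.ofReal_add (𝒢.condExp_re_nonneg a.2 x)
      (𝒢.condExp_re_nonneg b.2 x)]
  map_smul r hr a := by
    change ∫⁻ x, ENNReal.ofReal (𝒢.condExp (r • (a : 𝒢.ReducedCStar)) x).re ∂m = _
    rw [weightOf, ← lintegral_const_mul _ (𝒢.measurable_condExp a)]
    refine lintegral_congr fun x => ?_
    rw [← Complex.coe_smul, condExp_smul, Complex.re_ofReal_mul, ENNReal.ofReal_mul hr.le]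
  nonzero := 𝒢.weightOf_ne_zero m hm
  denselyDefined := by
    rintro ⟨a, ha⟩
    rw [Metric.mem_closure_iff]
    intro ε hε
    obtain ⟨p, -, hp⟩ := 𝒢.exists_approx_unit a hε
    refine ⟨⟨_, (𝒢.isSelfAdjoint_diagElt p).conjugate_nonneg ha⟩,
      𝒢.weightOf_diagElt_conj_lt_top m p a, ?_⟩
    rwa [dist_comm, Subtype.dist_eq, dist_eq_norm]
  lowerSemicontinuous _ _ :=
    IsSeqClosed.isClosed fun _ _ hr hu => 𝒢.weightOf_le_of_tendsto m hu hr

variable {m} {𝒢}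

theorem integrable_condExp_re {a : 𝒢.ReducedCStar} (ha : a ∈ weightN (𝒢.weightOf m)) :
    Integrable (fun x => (𝒢.condExp (star a * a) x).re) m := by
  refine ⟨(Complex.continuous_re.comp (𝒢.continuous_condExp _)).measurable.aestronglyMeasurable, ?_⟩
  rw [hasFiniteIntegral_iff_ofReal
    (.of_forall (𝒢.condExp_re_nonneg (star_mul_self_nonneg a)))]
  exact ha

theorem integrable_condExp {a : 𝒢.ReducedCStar} (ha : a ∈ weightDomain (𝒢.weightOf m)) :
    Integrable (fun x => 𝒢.condExp a x) m := by
  induction ha using Submodule.span_induction with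
  | mem x hx =>
    obtain ⟨a, ha, b, hb, rfl⟩ := hx
    exact ((integrable_condExp_re ha).add (integrable_condExp_re hb)).mono'
      (𝒢.continuous_condExp _).measurable.aestronglyMeasurable
      (.of_forall (𝒢.norm_condExp_star_mul_le a b))
  | zero =>
    have hzero (x : X) : 𝒢.condExp 0 x = 0 := by simpa using 𝒢.condExp_smul 0 0 x
    simp only [hzero]
    exact integrable_zero _ _ _
  | add a b _ _ ha hb =>
    simp only [condExp_add]
    exact ha.add hb
  | smul z a _ ha =>
    simp only [condExp_smul]
    exact ha.const_mul z

variable (m 𝒢) in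
/-- The linear extension `a ↦ ∫ P(a) dm` of the weight `φ_m`. -/
def weightFunctional : weightDomain (𝒢.weightOf m) →ₗ[ℂ] ℂ where
  toFun a := ∫ x, 𝒢.condExp a x ∂m
  map_add' a b := by
    rw [← integral_add (integrable_condExp a.2) (integrable_condExp b.2)]
    exact integral_congr_ae (.of_forall (𝒢.condExp_add a b))
  map_smul' z a := by
    rw [RingHom.id_apply, smul_eq_mul, ← integral_const_mul]
    exact integral_congr_ae (.of_forall (𝒢.condExp_smul z a))

theorem isWeightExtension_weightFunctional :
    IsWeightExtension (𝒢.weightOf m) (𝒢.weightFunctional m) := by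
  rintro ⟨a, hdom⟩ ha
  have hint := integrable_condExp hdom
  refine ⟨hint.re.lintegral_lt_top, ?_⟩
  calc ∫ x, 𝒢.condExp a x ∂m = ∫ x, ((𝒢.condExp a x).re : ℂ) ∂m :=
        integral_congr_ae (.of_forall (𝒢.condExp_eq_re ha))
    _ = ((∫ x, (𝒢.condExp a x).re ∂m : ℝ) : ℂ) := integral_ofReal
    _ = _ := congrArg _ (integral_eq_lintegral_of_nonneg_ae
        (.of_forall (𝒢.condExp_re_nonneg ha)) hint.re.1)

end ProperWeight

section Phase

variable {G X : Type*} [TopologicalSpace G] [TopologicalSpace X] {𝒢 : EtaleGroupoid G X}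

theorem cexp_I_mul_add_I_mul (c : 𝒢.RealHom) (t β : ℝ) (g : G) :
    Complex.exp (Complex.I * (t + Complex.I * β) * c g) =
      (Real.exp (-β * c g) : ℂ) * phase c t g := by
  rw [phase, Complex.ofReal_exp, ← Complex.exp_add]
  congr 1
  push_cast
  linear_combination (β : ℂ) * c g * Complex.I_mul_I

end Phase

section KMSWeight

variable {G X : Type*} [TopologicalSpace G] [TopologicalSpace X] [T2Space G] [LocallyCompactSpace G]
  {𝒢 : EtaleGroupoid G X}

theorem phase_mul_conj_coef_mul_coef (c : 𝒢.RealHom) (t : ℝ) (a b : 𝒢.ReducedCStar) (g : G) :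
    phase c t g * (starRingEnd ℂ (𝒢.coef a g) * 𝒢.coef b g) =
      starRingEnd ℂ (𝒢.coef a g) * 𝒢.coef (sigma c t b) g := by
  rw [coef_sigma]
  ring

theorem conj_coef_star_inv_mul_coef_inv (a b : 𝒢.ReducedCStar) (g : G) :
    starRingEnd ℂ (𝒢.coef (star a) (𝒢.inv g)) * 𝒢.coef b (𝒢.inv g) =
      starRingEnd ℂ (𝒢.coef (star b) g) * 𝒢.coef a g := by
  simp only [coef_star, Complex.conj_conj, 𝒢.inv_inv]
  ring

theorem continuous_conj_coef_mul_coef (a b : 𝒢.ReducedCStar) :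
    Continuous fun g => starRingEnd ℂ (𝒢.coef a g) * 𝒢.coef b g :=
  (Complex.continuous_conj.comp (𝒢.continuous_coef a)).mul (𝒢.continuous_coef b)

variable [SecondCountableTopology G] [MeasurableSpace X] [BorelSpace X] {m : Measure X}

section

variable [MeasurableSpace G] [BorelSpace G]

theorem integrable_norm_coef_sq {a : 𝒢.ReducedCStar} (ha : a ∈ weightN (𝒢.weightOf m)) :
    Integrable (fun g => ‖𝒢.coef a g‖ ^ 2) (𝒢.fibreMeasure m) := by
  have hmeas : Measurable fun g => ‖𝒢.coef a g‖ ^ 2 := ((𝒢.continuous_coef a).norm.pow 2).measurable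
  refine ⟨hmeas.aestronglyMeasurable, ?_⟩
  rw [hasFiniteIntegral_iff_ofReal (.of_forall fun g => by positivity),
    𝒢.lintegral_fibreMeasure m hmeas.ennreal_ofReal]
  refine lt_of_eq_of_lt (lintegral_congr fun x => ?_) ha
  have hsum := 𝒢.hasSum_condExp_star_mul_self a x
  rw [← hsum.tsum_eq, ENNReal.ofReal_tsum_of_nonneg (fun _ => by positivity) hsum.summable]

theorem integrable_conj_coef_mul_coef {a b : 𝒢.ReducedCStar} (ha : a ∈ weightN (𝒢.weightOf m))
    (hb : b ∈ weightN (𝒢.weightOf m)) :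
    Integrable (fun g => starRingEnd ℂ (𝒢.coef a g) * 𝒢.coef b g) (𝒢.fibreMeasure m) :=
  ((integrable_norm_coef_sq ha).add (integrable_norm_coef_sq hb)).mono'
    (continuous_conj_coef_mul_coef a b).measurable.aestronglyMeasurable
    (.of_forall fun _ => norm_conj_mul_le _ _)

theorem integral_conj_coef_mul_coef {a b : 𝒢.ReducedCStar} (ha : a ∈ weightN (𝒢.weightOf m))
    (hb : b ∈ weightN (𝒢.weightOf m)) :
    ∫ g, starRingEnd ℂ (𝒢.coef a g) * 𝒢.coef b g ∂(𝒢.fibreMeasure m) =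
      ∫ x, 𝒢.condExp (star a * b) x ∂m := by
  rw [𝒢.integral_fibreMeasure m (continuous_conj_coef_mul_coef a b).measurable
    (integrable_conj_coef_mul_coef ha hb)]
  exact integral_congr_ae (.of_forall fun x => (𝒢.hasSum_condExp_star_mul a b x).tsum_eq)

theorem integral_phase_mul (c : 𝒢.RealHom) (t : ℝ) {a b : 𝒢.ReducedCStar}
    (ha : star a ∈ weightN (𝒢.weightOf m)) (hb : b ∈ weightN (𝒢.weightOf m)) :
    ∫ g, phase c t g * (starRingEnd ℂ (𝒢.coef (star a) g) * 𝒢.coef b g) ∂(𝒢.fibreMeasure m) =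
      ∫ x, 𝒢.condExp (a * sigma c t b) x ∂m := by
  simp only [phase_mul_conj_coef_mul_coef]
  rw [integral_conj_coef_mul_coef ha ((𝒢.isInvariantWeight_weightOf m c).apply_mem t hb), star_star]

theorem integral_phase_inv_mul (c : 𝒢.RealHom) (t : ℝ) {a b : 𝒢.ReducedCStar}
    (ha : a ∈ weightN (𝒢.weightOf m)) (hb : star b ∈ weightN (𝒢.weightOf m)) :
    ∫ g, phase c t (𝒢.inv g) * (starRingEnd ℂ (𝒢.coef (star a) (𝒢.inv g)) * 𝒢.coef b (𝒢.inv g))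
        ∂(𝒢.fibreMeasure m) = ∫ x, 𝒢.condExp (sigma c t b * a) x ∂m := by
  simp only [phase_mul_conj_coef_mul_coef]
  simp only [conj_coef_star_inv_mul_coef_inv]
  rw [integral_conj_coef_mul_coef
    ((𝒢.isInvariantWeight_weightOf m c).star_apply_mem t hb) ha, star_star]

end

theorem isKMSWeight_weightOf [IsLocallyFiniteMeasure m] {c : 𝒢.RealHom} {β : ℝ} (hm : m ≠ 0)
    (hconf : IsConformal c β m) : IsKMSWeight (𝒢.weightOf m) (sigma c) β := by
  borelize G
  refine ⟨𝒢.isProperWeight_weightOf m hm, 𝒢.isInvariantWeight_weightOf m c,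
    𝒢.weightFunctional m, isWeightExtension_weightFunctional, fun a b ha ha' hb hb' => ?_⟩
  let h (g : G) : ℂ := starRingEnd ℂ (𝒢.coef (star a) g) * 𝒢.coef b g
  have hinv := (isConformal_iff c β m).1 hconf
  have hemb : MeasurableEmbedding 𝒢.inv := 𝒢.invHomeo.measurableEmbedding
  have hc : Measurable c := c.continuous_toFun.measurable
  have hexp : Measurable fun g => Real.exp (-β * c g) := by fun_prop
  have hexp₀ (g : G) : 0 ≤ Real.exp (-β * c g) := (Real.exp_pos _).le
  have hh : Integrable h (𝒢.fibreMeasure m) := integrable_conj_coef_mul_coef ha' hb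
  have hh' : Integrable (fun g => h (𝒢.inv g)) (𝒢.fibreMeasure m) := by
    simp only [h, conj_coef_star_inv_mul_coef_inv]
    exact integrable_conj_coef_mul_coef hb' ha
  have hβ := integrable_smul_of_map_eq_withDensity hemb hexp hexp₀ hinv hh'
  refine ⟨stripTransform (𝒢.fibreMeasure m) c h, continuousOn_stripTransform hc hh hβ,
    ⟨_, fun z hz => norm_stripTransform_le hh hβ hz⟩, differentiableOn_stripTransform hc hh hβ,
    fun t => ⟨integral_phase_mul c t ha' hb, ?_⟩⟩
  calc stripTransform (𝒢.fibreMeasure m) c h (t + Complex.I * β)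
      = ∫ g, Real.exp (-β * c g) • (phase c t g * h g) ∂(𝒢.fibreMeasure m) := by
        simp only [stripTransform, cexp_I_mul_add_I_mul, Complex.real_smul]
        simp only [_root_.mul_assoc]
    _ = ∫ g, phase c t (𝒢.inv g) * h (𝒢.inv g) ∂(𝒢.fibreMeasure m) :=
        integral_smul_of_map_eq_withDensity hemb hexp hexp₀ hinv fun g => phase c t g * h g
    _ = ∫ x, 𝒢.condExp (sigma c t b * a) x ∂m := integral_phase_inv_mul c t ha hb'

end KMSWeight

section KMSFunctional

variable {G X : Type*} [TopologicalSpace G] [TopologicalSpace X] [T2Space G] [LocallyCompactSpace G]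
  {𝒢 : EtaleGroupoid G X} {c : 𝒢.RealHom} {β : ℝ} {ψ : {a : 𝒢.ReducedCStar // 0 ≤ a} → ℝ≥0∞}
  {Λ : 𝒢.ReducedCStar →ₗ[ℂ] ℂ}

theorem diagElt_mul_self_nonneg (p : C_c(X, ℝ)) : 0 ≤ 𝒢.diagElt p * 𝒢.diagElt p :=
  (𝒢.isSelfAdjoint_diagElt p).mul_self_nonneg

theorem diagElt_mem_weightN (hopen : IsOpen {g | c g = 0})
    (h : IsKMSFunctional ψ (sigma c) β Λ) (p : C_c(X, ℝ)) : 𝒢.diagElt p ∈ weightN ψ := by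
  have := 𝒢.t2Space_units
  have := 𝒢.locallyCompactSpace_units
  obtain ⟨q, hqp⟩ := exists_mul_eq_self p
  have hunit : 𝒢.diagElt q * 𝒢.diagElt p = 𝒢.diagElt p := by rw [← diagElt_mul, hqp]
  refine h.mem_weightN_of_fixed (isMeanErgodic_sigma c hopen) (𝒢.isSelfAdjoint_diagElt p)
    (fun t => 𝒢.sigma_diagElt c t p) (diagElt_mul_self_nonneg q) (fun t => ?_) ?_
  · rw [map_mul, sigma_diagElt]
  · rw [_root_.mul_assoc, hunit, hunit]

theorem star_diagElt_mem_weightN (hopen : IsOpen {g | c g = 0})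
    (h : IsKMSFunctional ψ (sigma c) β Λ) (p : C_c(X, ℝ)) : star (𝒢.diagElt p) ∈ weightN ψ := by
  rw [(𝒢.isSelfAdjoint_diagElt p).star_eq]
  exact diagElt_mem_weightN hopen h p

theorem ofCc_mem_weightN (hopen : IsOpen {g | c g = 0}) (h : IsKMSFunctional ψ (sigma c) β Λ)
    (f : C_c(G, ℂ)) : 𝒢.ofCc f ∈ weightN ψ := by
  obtain ⟨p, -, -, hp⟩ := 𝒢.exists_local_unit f
  rw [← hp]
  exact h.proper.mul_mem_weightN _ (diagElt_mem_weightN hopen h p)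

theorem star_ofCc_mem_weightN (hopen : IsOpen {g | c g = 0}) (h : IsKMSFunctional ψ (sigma c) β Λ)
    (f : C_c(G, ℂ)) : star (𝒢.ofCc f) ∈ weightN ψ := by
  rw [← ofCc_invol]
  exact ofCc_mem_weightN hopen h _

theorem posExt_diagElt_lt (hopen : IsOpen {g | c g = 0}) (h : IsKMSFunctional ψ (sigma c) β Λ)
    {p : C_c(X, ℝ)} (hp : ∀ x, 0 ≤ p x) : posExt ψ (𝒢.diagElt p) < ∞ := by
  obtain ⟨q, rfl⟩ := exists_mul_self_eq hp
  have hq := mem_weightN.1 (diagElt_mem_weightN hopen h q)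
  rwa [(𝒢.isSelfAdjoint_diagElt q).star_eq, ← diagElt_mul] at hq

theorem apply_diagElt_im (hopen : IsOpen {g | c g = 0}) (h : IsKMSFunctional ψ (sigma c) β Λ)
    (p : C_c(X, ℝ)) : (Λ (𝒢.diagElt p)).im = 0 := by
  have hpos {q : C_c(X, ℝ)} (hq : 0 ≤ q) : (Λ (𝒢.diagElt q)).im = 0 := by
    rw [h.isWeightFunctional _ (posExt_diagElt_lt hopen h fun x => hq x), Complex.ofReal_im]
  have hparts := congrArg (fun q => (Λ (𝒢.diagElt q)).im)
    (sub_eq_iff_eq_add.1 (posPart_sub_negPart p))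
  simpa only [diagElt_add, map_add, Complex.add_im, hpos (negPart_nonneg p),
    hpos (posPart_nonneg p), add_zero, eq_comm] using hparts

theorem exists_measure [MeasurableSpace X] [BorelSpace X] (hopen : IsOpen {g | c g = 0})
    (h : IsKMSFunctional ψ (sigma c) β Λ) :
    ∃ m : Measure X, m.Regular ∧ ∀ p : C_c(X, ℝ), Λ (𝒢.diagElt p) = ∫ x, (p x : ℂ) ∂m := by
  have := 𝒢.t2Space_units
  have := 𝒢.locallyCompactSpace_units
  let Φ : C_c(X, ℝ) →ₗ[ℝ] ℝ :=
    { toFun := fun p => (Λ (𝒢.diagElt p)).re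
      map_add' := fun p q => by rw [diagElt_add, map_add, Complex.add_re]
      map_smul' := fun r p => by
        rw [diagElt_smul, map_smul, smul_eq_mul, Complex.re_ofReal_mul, RingHom.id_apply,
          smul_eq_mul] }
  let Φ₀ : C_c(X, ℝ) →ₚ[ℝ] ℝ := PositiveLinearMap.mk₀ Φ fun p hp => by
    change 0 ≤ (Λ (𝒢.diagElt p)).re
    rw [h.isWeightFunctional _ (posExt_diagElt_lt hopen h fun x => hp x), Complex.ofReal_re]
    exact ENNReal.toReal_nonneg
  refine ⟨RealRMK.rieszMeasure Φ₀, inferInstance, fun p => ?_⟩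
  rw [integral_complex_ofReal, RealRMK.integral_rieszMeasure]
  exact Complex.ext rfl (apply_diagElt_im hopen h p)

end KMSFunctional

section UnitSpaceFunctions

variable {G X : Type*} [TopologicalSpace G] [TopologicalSpace X] [T2Space G]
  {𝒢 : EtaleGroupoid G X}

theorem exists_eq_diag_add {f : C_c(G, ℂ)} (hf : tsupport f ⊆ Set.range 𝒢.unit) :
    ∃ p q : C_c(X, ℝ), f = 𝒢.diag p + Complex.I • 𝒢.diag q := by
  have hsupp : HasCompactSupport fun x => f (𝒢.unit x) :=
    f.hasCompactSupport.comp_isClosedEmbedding 𝒢.isClosedEmbedding_unit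
  have hcont : Continuous fun x => f (𝒢.unit x) := f.continuous.comp 𝒢.continuous_unit
  refine ⟨⟨⟨fun x => (f (𝒢.unit x)).re, Complex.continuous_re.comp hcont⟩,
      hsupp.comp_left (g := Complex.re) rfl⟩,
    ⟨⟨fun x => (f (𝒢.unit x)).im, Complex.continuous_im.comp hcont⟩,
      hsupp.comp_left (g := Complex.im) rfl⟩,
    CompactlySupportedContinuousMap.ext fun g => ?_⟩
  rw [CompactlySupportedContinuousMap.add_apply, CompactlySupportedContinuousMap.smul_apply]
  by_cases hg : g ∈ Set.range 𝒢.unit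
  · obtain ⟨x, rfl⟩ := hg
    rw [diag_unit, diag_unit, smul_eq_mul, mul_comm]
    exact (Complex.re_add_im _).symm
  · rw [diag_of_notMem _ _ hg, diag_of_notMem _ _ hg, smul_zero, add_zero,
      image_eq_zero_of_notMem_tsupport fun h => hg (hf h)]

variable [MeasurableSpace X] (m : Measure X)

theorem integrable_unit [BorelSpace X] [IsFiniteMeasureOnCompacts m] (f : C_c(G, ℂ)) :
    Integrable (fun x => f (𝒢.unit x)) m :=
  (f.continuous.comp 𝒢.continuous_unit).integrable_of_hasCompactSupport
    (f.hasCompactSupport.comp_isClosedEmbedding 𝒢.isClosedEmbedding_unit)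

end UnitSpaceFunctions

section Disintegration

variable {G X : Type*} [TopologicalSpace G] [TopologicalSpace X] [T2Space G] [LocallyCompactSpace G]
  {𝒢 : EtaleGroupoid G X} {c : 𝒢.RealHom} {β : ℝ} {ψ : {a : 𝒢.ReducedCStar // 0 ≤ a} → ℝ≥0∞}
  {Λ : 𝒢.ReducedCStar →ₗ[ℂ] ℂ}

theorem apply_ofCc_zero : Λ (𝒢.ofCc 0) = 0 := (Λ ∘ₗ 𝒢.ofCcLin).map_zero

/- A function `p` on the unit space that is `1` on `r (supp f)` and `0` on `s (supp f)` is fixed by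
the action, so `Λ f = Λ (p f) = Λ (f p) = 0`. -/
theorem apply_ofCc_eq_zero_of_disjoint (hopen : IsOpen {g | c g = 0})
    (h : IsKMSFunctional ψ (sigma c) β Λ) {V V' : Set X} (hV : IsOpen V) (hd : Disjoint V V')
    {f : C_c(G, ℂ)} (hf : tsupport f ⊆ 𝒢.r ⁻¹' V ∩ 𝒢.s ⁻¹' V') : Λ (𝒢.ofCc f) = 0 := by
  have := 𝒢.t2Space_units
  have := 𝒢.locallyCompactSpace_units
  obtain ⟨p, hone, hpV, -⟩ := exists_bump (f.hasCompactSupport.isCompact.image 𝒢.continuous_r) hV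
    (Set.image_subset_iff.2 fun g hg => (hf hg).1)
  have hleft : 𝒢.diagElt p * 𝒢.ofCc f = 𝒢.ofCc f := 𝒢.diagElt_mul_ofCc fun g => by
    by_cases hg : f g = 0
    · rw [hg, mul_zero]
    · rw [hone _ ⟨g, subset_tsupport f hg, rfl⟩, Complex.ofReal_one, one_mul]
  have hright : 𝒢.ofCc f * 𝒢.diagElt p = 𝒢.ofCc 0 := 𝒢.ofCc_mul_diagElt fun g => by
    rw [CompactlySupportedContinuousMap.zero_apply]
    by_cases hg : f g = 0
    · rw [hg, zero_mul]
    · have hpg : p (𝒢.s g) = 0 := image_eq_zero_of_notMem_tsupport fun hp =>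
        Set.disjoint_left.1 hd (hpV hp) (hf (subset_tsupport f hg)).2
      rw [hpg, Complex.ofReal_zero, mul_zero]
  rw [← hleft, ← h.apply_mul_comm (ofCc_mem_weightN hopen h f) (star_ofCc_mem_weightN hopen h f)
    (diagElt_mem_weightN hopen h p) (star_diagElt_mem_weightN hopen h p)
    fun t => 𝒢.sigma_diagElt c t p, hright, apply_ofCc_zero]

theorem apply_ofCc_eq_zero_of_ne (hopen : IsOpen {g | c g = 0})
    (h : IsKMSFunctional ψ (sigma c) β Λ) {f : C_c(G, ℂ)} (hf : tsupport f ⊆ {g | c g ≠ 0}) :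
    Λ (𝒢.ofCc f) = 0 := by
  obtain ⟨p, -, hleft, hright⟩ := 𝒢.exists_local_unit f
  have hzero := h.apply_mul_mul_eq_zero (𝒢.isSelfAdjoint_diagElt p) (diagElt_mem_weightN hopen h p)
    (fun t => 𝒢.sigma_diagElt c t p) (tendsto_orbitAvg_zero c hf)
  rwa [hleft, hright] at hzero

variable [MeasurableSpace X] [BorelSpace X] {m : Measure X} [IsFiniteMeasureOnCompacts m]

theorem apply_ofCc_eq_integral_of_units
    (hm : ∀ p : C_c(X, ℝ), Λ (𝒢.diagElt p) = ∫ x, (p x : ℂ) ∂m) {f : C_c(G, ℂ)}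
    (hf : tsupport f ⊆ Set.range 𝒢.unit) : Λ (𝒢.ofCc f) = ∫ x, f (𝒢.unit x) ∂m := by
  obtain ⟨p, q, rfl⟩ := exists_eq_diag_add hf
  have hint := integral_add (integrable_unit (𝒢 := 𝒢) m (𝒢.diag p))
    ((integrable_unit (𝒢 := 𝒢) m (𝒢.diag q)).smul Complex.I)
  simp only [Pi.smul_apply, integral_smul, diag_unit] at hint
  simp only [CompactlySupportedContinuousMap.add_apply, CompactlySupportedContinuousMap.smul_apply,
    diag_unit, hint, ofCc_add, ofCc_smul, map_add, map_smul]
  rw [← hm, ← hm, diagElt, diagElt]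

/- The support of `f` is localised at a single `g`: if `r g ≠ s g` or `c g ≠ 0`, both sides vanish,
and otherwise `g` is a unit. -/
theorem apply_ofCc_eq_integral
    (htriv : ∀ x : X, {g : G | c g = 0} ∩ {g : G | 𝒢.r g = x ∧ 𝒢.s g = x} = {𝒢.unit x})
    (hopen : IsOpen {g | c g = 0}) (h : IsKMSFunctional ψ (sigma c) β Λ)
    (hm : ∀ p : C_c(X, ℝ), Λ (𝒢.diagElt p) = ∫ x, (p x : ℂ) ∂m) (f : C_c(G, ℂ)) :
    Λ (𝒢.ofCc f) = ∫ x, f (𝒢.unit x) ∂m := by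
  have := 𝒢.t2Space_units
  have hvanish {f : C_c(G, ℂ)} (hΛ : Λ (𝒢.ofCc f) = 0) (hf : ∀ x, 𝒢.unit x ∉ tsupport f) :
      Λ (𝒢.ofCc f) = ∫ x, f (𝒢.unit x) ∂m := by
    simp only [hΛ, fun x => image_eq_zero_of_notMem_tsupport (hf x), integral_zero]
  refine compactlySupported_induction (P := fun f => Λ (𝒢.ofCc f) = ∫ x, f (𝒢.unit x) ∂m)
    (hvanish apply_ofCc_zero fun x hx => ?_) (fun f k hf hk => ?_) (fun g => ?_) f
  · rw [CompactlySupportedContinuousMap.coe_zero, tsupport_zero] at hx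
    exact hx
  · simp only [CompactlySupportedContinuousMap.add_apply]
    rw [integral_add (integrable_unit m f) (integrable_unit m k), ofCc_add, map_add, hf, hk]
  by_cases hrs : 𝒢.r g = 𝒢.s g
  · by_cases hc : c g = 0
    · have hg : g ∈ ({𝒢.unit (𝒢.r g)} : Set G) := by
        rw [← htriv]
        exact ⟨hc, rfl, hrs.symm⟩
      exact ⟨Set.range 𝒢.unit, 𝒢.isOpen_range_unit, ⟨_, hg.symm⟩, fun f hf =>
        apply_ofCc_eq_integral_of_units hm hf⟩
    · exact ⟨{g | c g ≠ 0}, isOpen_ne.preimage c.continuous_toFun, hc, fun f hf =>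
        hvanish (apply_ofCc_eq_zero_of_ne hopen h hf) fun x hx => hf hx (c.map_unit x)⟩
  · obtain ⟨V, V', hV, hV', hgV, hgV', hd⟩ := t2_separation hrs
    refine ⟨𝒢.r ⁻¹' V ∩ 𝒢.s ⁻¹' V', (hV.preimage 𝒢.continuous_r).inter
      (hV'.preimage 𝒢.continuous_s), ⟨hgV, hgV'⟩, fun f hf =>
        hvanish (apply_ofCc_eq_zero_of_disjoint hopen h hV hd hf) fun x hx => ?_⟩
    obtain ⟨hxV, hxV'⟩ := hf hx
    rw [Set.mem_preimage, 𝒢.r_unit] at hxV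
    rw [Set.mem_preimage, 𝒢.s_unit] at hxV'
    exact Set.disjoint_left.1 hd hxV hxV'

variable (m) in
theorem continuous_integral_condExp_diagElt_mul_mul (p : C_c(X, ℝ)) :
    Continuous fun a => ∫ x, 𝒢.condExp (𝒢.diagElt p * a * 𝒢.diagElt p) x ∂m := by
  have hcont : Continuous fun x => (p x : ℂ) * p x :=
    (Complex.continuous_ofReal.comp p.continuous).mul (Complex.continuous_ofReal.comp p.continuous)
  have hsupp : HasCompactSupport fun x => (p x : ℂ) * p x :=
    (p.hasCompactSupport.comp_left (g := Complex.ofReal) rfl).mul_right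
  have hint := (hcont.integrable_of_hasCompactSupport (μ := m) hsupp).norm
  refine continuous_iff_continuousAt.2 fun a => ?_
  refine continuousAt_of_dominated (bound := fun x => ‖(p x : ℂ) * p x‖ * (‖a‖ + 1))
    (.of_forall fun b => (𝒢.continuous_condExp _).measurable.aestronglyMeasurable) ?_
    (hint.mul_const _) (.of_forall fun x => ?_)
  · filter_upwards [continuous_norm.continuousAt.eventually_lt continuousAt_const
      (lt_add_one ‖a‖)] with b hb
    refine .of_forall fun x => ?_
    rw [condExp_diagElt_mul_mul, norm_mul]
    exact mul_le_mul_of_nonneg_left ((𝒢.norm_condExp_apply_le b x).trans hb.le) (norm_nonneg _)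
  · simp only [condExp_diagElt_mul_mul]
    exact ((𝒢.continuous_condExp_left x).const_mul _).continuousAt

theorem apply_mul_mul_eq_integral
    (htriv : ∀ x : X, {g : G | c g = 0} ∩ {g : G | 𝒢.r g = x ∧ 𝒢.s g = x} = {𝒢.unit x})
    (hopen : IsOpen {g | c g = 0}) (h : IsKMSFunctional ψ (sigma c) β Λ)
    (hm : ∀ p : C_c(X, ℝ), Λ (𝒢.diagElt p) = ∫ x, (p x : ℂ) ∂m) (p : C_c(X, ℝ))
    (a : 𝒢.ReducedCStar) :
    Λ (𝒢.diagElt p * a * 𝒢.diagElt p) =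
      ∫ x, 𝒢.condExp (𝒢.diagElt p * a * 𝒢.diagElt p) x ∂m := by
  refine congrFun (𝒢.denseRange_ofCc.equalizer
    (h.isWeightFunctional.continuous_apply_mul_mul h.proper
      (star_diagElt_mem_weightN hopen h p) (diagElt_mem_weightN hopen h p))
    (continuous_integral_condExp_diagElt_mul_mul m p) (funext fun f => ?_)) a
  have hconv : 𝒢.diagElt p * 𝒢.ofCc f * 𝒢.diagElt p =
      𝒢.ofCc (𝒢.conv (𝒢.conv (𝒢.diag p) f) (𝒢.diag p)) := by
    rw [ofCc_conv, ofCc_conv, diagElt]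
  simp only [Function.comp_apply, hconv, condExp_ofCc]
  exact apply_ofCc_eq_integral htriv hopen h hm _

end Disintegration

section Identification

variable {G X : Type*} [TopologicalSpace G] [TopologicalSpace X] [T2Space G] [LocallyCompactSpace G]
  {𝒢 : EtaleGroupoid G X}

theorem exists_seq_approx_unit (a : 𝒢.ReducedCStar) : ∃ p : ℕ → C_c(X, ℝ),
    (∀ n x, 0 ≤ p n x ∧ p n x ≤ 1) ∧ Tendsto
      (fun n => 𝒢.diagElt (p n) * a * 𝒢.diagElt (p n)) atTop (𝓝 a) := by
  choose p hp hpa using fun n : ℕ =>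
    𝒢.exists_approx_unit a (ε := 1 / ((n : ℝ) + 1)) (by positivity)
  refine ⟨p, hp, tendsto_iff_norm_sub_tendsto_zero.2 ?_⟩
  exact squeeze_zero (fun _ => norm_nonneg _) (fun n => (hpa n).le)
    tendsto_one_div_add_atTop_nhds_zero_nat

theorem posExt_weightOf_mul_mul_le [MeasurableSpace X] {m : Measure X} {p : C_c(X, ℝ)}
    (hp : ∀ x, 0 ≤ p x ∧ p x ≤ 1) {a : 𝒢.ReducedCStar} (ha : 0 ≤ a) :
    posExt (𝒢.weightOf m) (𝒢.diagElt p * a * 𝒢.diagElt p) ≤ posExt (𝒢.weightOf m) a := by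
  rw [posExt_weightOf _ _ ((𝒢.isSelfAdjoint_diagElt p).conjugate_nonneg ha), posExt_weightOf _ _ ha]
  refine lintegral_mono fun x => ENNReal.ofReal_le_ofReal ?_
  rw [condExp_diagElt_conj_re]
  exact mul_le_of_le_one_left (𝒢.condExp_re_nonneg ha x) (pow_le_one₀ (hp x).1 (hp x).2)

variable {c : 𝒢.RealHom} {β : ℝ} {ψ : {a : 𝒢.ReducedCStar // 0 ≤ a} → ℝ≥0∞}
  {Λ : 𝒢.ReducedCStar →ₗ[ℂ] ℂ}

theorem posExt_mul_mul_le (hopen : IsOpen {g | c g = 0}) (h : IsKMSFunctional ψ (sigma c) β Λ)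
    {p : C_c(X, ℝ)} (hp : ∀ x, 0 ≤ p x ∧ p x ≤ 1) {a : 𝒢.ReducedCStar} (ha : 0 ≤ a) :
    posExt ψ (𝒢.diagElt p * a * 𝒢.diagElt p) ≤ posExt ψ a := by
  obtain ⟨q, hpq⟩ := exists_mul_self_add_mul_self_eq hp
  refine h.posExt_mul_mul_le_of_fixed (r := 𝒢.diagElt q) (𝒢.isSelfAdjoint_diagElt p)
    (diagElt_mem_weightN hopen h p) (fun t => 𝒢.sigma_diagElt c t p) (𝒢.isSelfAdjoint_diagElt q)
    (diagElt_mem_weightN hopen h q) (fun t => 𝒢.sigma_diagElt c t q) ?_ ha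
  rw [eq_sub_iff_add_eq, ← diagElt_mul, ← diagElt_mul, ← diagElt_add, ← diagElt_add, hpq]

variable [MeasurableSpace X] [BorelSpace X] {m : Measure X} [IsFiniteMeasureOnCompacts m]

theorem posExt_mul_mul_eq (hopen : IsOpen {g | c g = 0}) (h : IsKMSFunctional ψ (sigma c) β Λ)
    (hm : ∀ p a, Λ (𝒢.diagElt p * a * 𝒢.diagElt p) =
      ∫ x, 𝒢.condExp (𝒢.diagElt p * a * 𝒢.diagElt p) x ∂m)
    (p : C_c(X, ℝ)) {a : 𝒢.ReducedCStar} (ha : 0 ≤ a) :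
    posExt ψ (𝒢.diagElt p * a * 𝒢.diagElt p) =
      posExt (𝒢.weightOf m) (𝒢.diagElt p * a * 𝒢.diagElt p) := by
  have hpa := (𝒢.isSelfAdjoint_diagElt p).conjugate_nonneg ha
  have hfin : posExt ψ (𝒢.diagElt p * a * 𝒢.diagElt p) < ∞ :=
    h.proper.posExt_mul_mul_lt (𝒢.isSelfAdjoint_diagElt p) (diagElt_mem_weightN hopen h p) ha
  have hfin' : posExt (𝒢.weightOf m) (𝒢.diagElt p * a * 𝒢.diagElt p) < ∞ := by
    rw [posExt_weightOf _ _ hpa]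
    exact 𝒢.weightOf_diagElt_conj_lt_top m p a
  refine (ENNReal.toReal_eq_toReal_iff' hfin.ne hfin'.ne).1 (Complex.ofReal_injective ?_)
  rw [← h.isWeightFunctional _ hfin, hm, posExt_of_nonneg hpa]
  exact (isWeightExtension_weightFunctional
    ⟨_, mem_weightDomain_of_posExt_lt hfin'⟩ hpa).2

theorem eq_weightOf [SecondCountableTopology G] (hopen : IsOpen {g | c g = 0})
    (h : IsKMSFunctional ψ (sigma c) β Λ)
    (hm : ∀ p a, Λ (𝒢.diagElt p * a * 𝒢.diagElt p) =
      ∫ x, 𝒢.condExp (𝒢.diagElt p * a * 𝒢.diagElt p) x ∂m) :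
    m ≠ 0 ∧ ψ = 𝒢.weightOf m := by
  have hle {a : 𝒢.ReducedCStar} (ha : 0 ≤ a) : posExt ψ a ≤ posExt (𝒢.weightOf m) a := by
    obtain ⟨p, hp, hpa⟩ := exists_seq_approx_unit a
    refine h.proper.posExt_le_of_tendsto hpa fun n => ?_
    rw [posExt_mul_mul_eq hopen h hm (p n) ha]
    exact posExt_weightOf_mul_mul_le (hp n) ha
  have hm₀ : m ≠ 0 := by
    rintro rfl
    obtain ⟨⟨a, ha⟩, hne⟩ := h.proper.nonzero
    have hzero := hle ha
    rw [posExt_of_nonneg ha, posExt_weightOf _ _ ha, lintegral_zero_measure] at hzero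
    exact hne (le_zero_iff.1 hzero)
  refine ⟨hm₀, funext fun ⟨a, ha⟩ => ?_⟩
  rw [← posExt_of_nonneg (ψ := ψ) ha, ← posExt_of_nonneg (ψ := 𝒢.weightOf m) ha]
  refine (hle ha).antisymm ?_
  obtain ⟨p, hp, hpa⟩ := exists_seq_approx_unit a
  refine (𝒢.isProperWeight_weightOf m hm₀).posExt_le_of_tendsto hpa fun n => ?_
  rw [← posExt_mul_mul_eq hopen h hm (p n) ha]
  exact posExt_mul_mul_le hopen h (hp n) ha

end Identification

section Injectivity

variable {G X : Type*} [TopologicalSpace G] [TopologicalSpace X] [T2Space G] [LocallyCompactSpace G]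
  {𝒢 : EtaleGroupoid G X} [MeasurableSpace X] [BorelSpace X] {m : Measure X}

theorem apply_eq_integral_condExp {Λ : 𝒢.ReducedCStar →ₗ[ℂ] ℂ}
    (hψ : IsProperWeight (𝒢.weightOf m)) (hΛ : IsWeightFunctional (𝒢.weightOf m) Λ)
    {a : 𝒢.ReducedCStar} (ha : a ∈ weightDomain (𝒢.weightOf m)) :
    Λ a = ∫ x, 𝒢.condExp a x ∂m := by
  suffices ∃ h, Λ a = 𝒢.weightFunctional m ⟨a, h⟩ from this.choose_spec
  rw [hψ.weightDomain_eq_span] at ha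
  induction ha using Submodule.span_induction with
  | mem a ha =>
    have ha₀ := nonneg_of_posExt_lt ha
    refine ⟨mem_weightDomain_of_posExt_lt ha, ?_⟩
    rw [hΛ a ha, posExt_of_nonneg ha₀]
    exact (isWeightExtension_weightFunctional ⟨a, mem_weightDomain_of_posExt_lt ha⟩ ha₀).2.symm
  | zero => exact ⟨zero_mem _, (map_zero Λ).trans (map_zero _).symm⟩
  | add a b _ _ ha hb =>
    obtain ⟨⟨ha, hΛa⟩, hb, hΛb⟩ := And.intro ha hb
    refine ⟨add_mem ha hb, ?_⟩
    rw [map_add, hΛa, hΛb, ← map_add]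
    rfl
  | smul z a _ ha =>
    obtain ⟨ha, hΛa⟩ := ha
    refine ⟨Submodule.smul_mem _ z ha, ?_⟩
    rw [map_smul, hΛa, ← map_smul]
    rfl

theorem ofCc_mem_weightN_weightOf (m : Measure X) [IsFiniteMeasureOnCompacts m] (f : C_c(G, ℂ)) :
    𝒢.ofCc f ∈ weightN (𝒢.weightOf m) := by
  obtain ⟨p, -, -, hp⟩ := 𝒢.exists_local_unit f
  have hconj : star (𝒢.ofCc f) * 𝒢.ofCc f =
      𝒢.diagElt p * (star (𝒢.ofCc f) * 𝒢.ofCc f) * 𝒢.diagElt p := by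
    conv_lhs => rw [← hp, star_mul, (𝒢.isSelfAdjoint_diagElt p).star_eq]
    simp only [_root_.mul_assoc]
  rw [mem_weightN, posExt_weightOf _ _ (star_mul_self_nonneg _), hconj]
  exact 𝒢.weightOf_diagElt_conj_lt_top m p _

theorem eq_of_weightOf_eq {m m' : Measure X} [m.Regular] [m'.Regular]
    (h : 𝒢.weightOf m = 𝒢.weightOf m') : m = m' := by
  have := 𝒢.t2Space_units
  have := 𝒢.locallyCompactSpace_units
  refine Measure.ext_of_integral_eq_on_compactlySupported_nnreal fun f => ?_
  let p : C_c(X, ℝ) := f.compLeft ⟨fun t : NNReal => (t : ℝ), by fun_prop⟩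
  have hp (x : X) : p x = f x := CompactlySupportedContinuousMap.compLeft_apply (by simp) _ _
  have hpos : 0 ≤ 𝒢.diagElt p := by
    obtain ⟨q, hq⟩ := exists_mul_self_eq (p := p) fun x => (hp x).symm ▸ (f x).coe_nonneg
    rw [hq, diagElt_mul]
    exact diagElt_mul_self_nonneg q
  have hlintegral : ∫⁻ x, ENNReal.ofReal (f x) ∂m = ∫⁻ x, ENNReal.ofReal (f x) ∂m' := by
    have heq := congrFun h ⟨_, hpos⟩
    simpa only [weightOf, condExp_diagElt, Complex.ofReal_re, hp] using heq
  have hf : Continuous fun x => (f x : ℝ) := NNReal.continuous_coe.comp f.continuous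
  have hf₀ (x : X) : 0 ≤ (f x : ℝ) := (f x).coe_nonneg
  rw [integral_eq_lintegral_of_nonneg_ae (.of_forall hf₀) hf.aestronglyMeasurable,
    integral_eq_lintegral_of_nonneg_ae (.of_forall hf₀) hf.aestronglyMeasurable, hlintegral]

end Injectivity

section Conformality

variable {G X : Type*} [TopologicalSpace G] [TopologicalSpace X] [T2Space G] [LocallyCompactSpace G]
  [SecondCountableTopology G] [MeasurableSpace X] [BorelSpace X] {𝒢 : EtaleGroupoid G X}
  {c : 𝒢.RealHom} {β : ℝ} {m : Measure X} [IsLocallyFiniteMeasure m]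

theorem integrable_exp_smul_conj_mul_self [MeasurableSpace G] [BorelSpace G] (c : 𝒢.RealHom) (β : ℝ)
    (k : C_c(G, ℂ)) :
    Integrable (fun g => Real.exp (-β * c g) • (starRingEnd ℂ (k g) * k g)) (𝒢.fibreMeasure m) := by
  have hexp : Continuous fun g => Real.exp (-β * c g) := by
    have := c.continuous_toFun
    fun_prop
  have hcont : Continuous fun g => starRingEnd ℂ (k g) * k g :=
    (Complex.continuous_conj.comp k.continuous).mul k.continuous
  exact (hexp.smul hcont).integrable_of_hasCompactSupport
    (HasCompactSupport.mul_left k.hasCompactSupport).smul_left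

/- The function `F` in the KMS condition for `k*` and `k` has the same values on the real line as
the strip transform of `|k|²`, hence also on the other edge. -/
theorem integral_conj_mul_self_inv [MeasurableSpace G] [BorelSpace G]
    (h : IsKMSWeight (𝒢.weightOf m) (sigma c) β) (k : C_c(G, ℂ)) :
    ∫ g, starRingEnd ℂ (k (𝒢.inv g)) * k (𝒢.inv g) ∂(𝒢.fibreMeasure m) =
      ∫ g, Real.exp (-β * c g) • (starRingEnd ℂ (k g) * k g) ∂(𝒢.fibreMeasure m) := by
  obtain ⟨Λ, hΛ⟩ := h.exists_functional
  have hN : 𝒢.ofCc k ∈ weightN (𝒢.weightOf m) := ofCc_mem_weightN_weightOf m k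
  have hN' : star (𝒢.ofCc k) ∈ weightN (𝒢.weightOf m) := by
    rw [← ofCc_invol]
    exact ofCc_mem_weightN_weightOf m _
  have hN'' : star (star (𝒢.ofCc k)) ∈ weightN (𝒢.weightOf m) := by rwa [star_star]
  obtain ⟨F, hcont, ⟨C, hC⟩, hdiff, hF⟩ := hΛ.kms _ _ hN' hN'' hN hN'
  have hlower (t : ℝ) : F t = stripTransform (𝒢.fibreMeasure m) c
      (fun g => starRingEnd ℂ (k g) * k g) t := by
    rw [(hF t).1, apply_eq_integral_condExp h.proper hΛ.isWeightFunctional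
      (mul_mem_weightDomain hN'' (h.invariant.apply_mem t hN)), ← integral_phase_mul c t hN'' hN]
    simp only [star_star, coef_ofCc]
    rfl
  have hupper : F ((0 : ℝ) + Complex.I * β) =
      ∫ g, starRingEnd ℂ (k (𝒢.inv g)) * k (𝒢.inv g) ∂(𝒢.fibreMeasure m) := by
    rw [(hF 0).2, apply_eq_integral_condExp h.proper hΛ.isWeightFunctional
      (mul_mem_weightDomain (h.invariant.star_apply_mem 0 hN') hN'),
      ← integral_phase_inv_mul c 0 hN' hN']
    simp [coef_ofCc, phase]
  have hc : Measurable c := c.continuous_toFun.measurable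
  have hβ := integrable_exp_smul_conj_mul_self (m := m) c β k
  have hk : Integrable (fun g => starRingEnd ℂ (k g) * k g) (𝒢.fibreMeasure m) := by
    simpa using integrable_exp_smul_conj_mul_self (m := m) c 0 k
  have hedge := eq_zero_on_edge_of_eq_zero_on_real
    (hcont.sub (continuousOn_stripTransform hc hk hβ))
    ⟨_, fun z hz => (norm_sub_le _ _).trans
      (add_le_add (hC z hz) (norm_stripTransform_le hk hβ hz))⟩
    (hdiff.sub (differentiableOn_stripTransform hc hk hβ)) (fun t => sub_eq_zero.2 (hlower t)) 0
  rw [← hupper, sub_eq_zero.1 hedge]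
  simp only [stripTransform, cexp_I_mul_add_I_mul, Complex.real_smul]
  simp [phase]

theorem isConformal_of_isKMSWeight (h : IsKMSWeight (𝒢.weightOf m) (sigma c) β) :
    IsConformal c β m := by
  borelize G
  have := TopologicalSpace.metrizableSpace_of_t3_secondCountable G
  have hcont := c.continuous_toFun
  have : (𝒢.fibreMeasure m).Regular := .of_sigmaCompactSpace_of_isLocallyFiniteMeasure _
  have : ((𝒢.fibreMeasure m).map 𝒢.inv).Regular := Measure.Regular.map 𝒢.invHomeo
  have : IsLocallyFiniteMeasure ((𝒢.fibreMeasure m).withDensity fun g =>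
      ENNReal.ofReal (Real.exp (-β * c g))) :=
    IsLocallyFiniteMeasure.withDensity_ofReal (by fun_prop)
  have : ((𝒢.fibreMeasure m).withDensity fun g => ENNReal.ofReal (Real.exp (-β * c g))).Regular :=
    .of_sigmaCompactSpace_of_isLocallyFiniteMeasure _
  refine (isConformal_iff c β m).2
    (Measure.ext_of_integral_eq_on_compactlySupported_nnreal fun f => ?_)
  obtain ⟨k, hk⟩ := exists_conj_mul_self_eq f
  have hinv := integral_conj_mul_self_inv h k
  simp only [hk, Complex.real_smul, ← Complex.ofReal_mul, integral_complex_ofReal] at hinv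
  calc ∫ g, (f g : ℝ) ∂(𝒢.fibreMeasure m).map 𝒢.inv
      = ∫ g, (f (𝒢.inv g) : ℝ) ∂(𝒢.fibreMeasure m) :=
        𝒢.invHomeo.measurableEmbedding.integral_map fun g => (f g : ℝ)
    _ = ∫ g, Real.exp (-β * c g) * f g ∂(𝒢.fibreMeasure m) := Complex.ofReal_injective hinv
    _ = _ := by
        rw [integral_withDensity_eq_integral_toReal_smul (measurable_exp_cocycle c β)
          (.of_forall fun g => ENNReal.ofReal_lt_top)]
        simp only [ENNReal.toReal_ofReal (Real.exp_pos _).le, smul_eq_mul]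

end Conformality

end EtaleGroupoid

end

theorem corollary2p3 {G X : Type*} [TopologicalSpace G] [TopologicalSpace X] [T2Space G]
    [LocallyCompactSpace G] [SecondCountableTopology G] [MeasurableSpace X] [BorelSpace X]
    (𝒢 : EtaleGroupoid G X) (c : 𝒢.RealHom) (β : ℝ)
    (htriv : ∀ x : X, {g : G | c g = 0} ∩ {g : G | 𝒢.r g = x ∧ 𝒢.s g = x} = {𝒢.unit x})
    (hopen : IsOpen {g : G | c g = 0}) :
    Set.BijOn 𝒢.weightOf
      {m : MeasureTheory.Measure X | m.Regular ∧ m ≠ 0 ∧ EtaleGroupoid.IsConformal c β m}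
      {ψ : {a : 𝒢.ReducedCStar // 0 ≤ a} → ENNReal |
        IsKMSWeight ψ (EtaleGroupoid.sigma c) β} := by
  have := 𝒢.t2Space_units
  have := 𝒢.locallyCompactSpace_units
  have := 𝒢.secondCountableTopology_units
  refine ⟨?_, ?_, fun ψ hψ => ?_⟩
  · rintro m ⟨hreg, hm, hconf⟩
    exact EtaleGroupoid.isKMSWeight_weightOf hm hconf
  · rintro m ⟨hreg, -, -⟩ m' ⟨hreg', -, -⟩ heq
    exact EtaleGroupoid.eq_of_weightOf_eq heq
  · obtain ⟨Λ, hΛ⟩ := hψ.exists_functional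
    obtain ⟨m, hreg, hm⟩ := EtaleGroupoid.exists_measure hopen hΛ
    obtain ⟨hm₀, rfl⟩ := EtaleGroupoid.eq_weightOf hopen hΛ
      (EtaleGroupoid.apply_mul_mul_eq_integral htriv hopen hΛ hm)
    exact ⟨m, ⟨hreg, hm₀, EtaleGroupoid.isConformal_of_isKMSWeight hψ⟩, rfl⟩
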